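/- (i) For every $n\in\mathbb N$ let $m=m_n\in\mathbb N$, let $\xi_\alpha=\xi_{\alpha,n}$ ($1\le\alpha\le m$) be i.i.d. $0/1$ random variables with $\mathbb P(\xi_\alpha=1)=p_n$, let $(x_\alpha,y_\alpha)=(x_{\alpha,n},y_{\alpha,n})$ ($1\le\alpha\le m$) be mutually independent pairs of random vectors in $\mathbb R^n$ ($x_\alpha$ and $y_\alpha$ with the same index may be dependent), and let the family $(\xi_\alpha)_\alpha$ be independent of the family $((x_\alpha,y_\alpha))_\alpha$. Put $$\mathcal A_n=\sum_{\alpha=1}^m\xi_\alpha\,(x_\alpha y_\alpha^T+y_\alpha x_\alpha^T),\qquad Q^{x\alpha}=\mathbb E\,x_\alpha x_\alpha^T,\quad Q^{y\alpha}=\mathbb E\,y_\alpha y_\alpha^T,\quad Q^{xy\alpha}=\mathbb E\,x_\alpha y_\alpha^T .$$ Assume that, as $n\to\infty$: (ii) $\frac mn p_n\to c_1$ for some $c_1>0$; (iii) there is $C_0>0$ such that, almost surely, $\|x_\alpha\|_2^2\le C_0$ and $\|y_\alpha\|_2^2\le C_0$ for all $n$ and $\alpha$; and for all deterministic $n\times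 n$ matrices $D=D_n$ with operator norm $\|D_n\|_{op}=1$, $$\sup_{\alpha\le m}\ \max_{u,v\in\{x_\alpha,y_\alpha\}}\operatorname{Var}\,(D_nu,v)=o(1);$$ (iv) $\sup_\alpha\max\{\|Q^{x\alpha}\|_{op},\|Q^{y\alpha}\|_{op},\|Q^{xy\alpha}\|_{op}\}=O(n^{-1})$ and $\sup_\alpha\max\{|\operatorname{Tr}Q^{x\alpha}-1|,|\operatorname{Tr}Q^{y\alpha}-1|\}=o(1)$; (v) for every $n$ and all $n\times n$ matrices $K_1,K_2$, $$\frac1m\sum_\alpha\operatorname{Tr}(Q^{x\alpha}K_1)\operatorname{Tr}(Q^{y\alpha}K_2)=\frac1n\operatorname{Tr}K_1\cdot\frac1n\operatorname{Tr}K_2;$$ (vi) the matrix $Q^{xy}=\big(\frac1m\sum_\alpha|Q^{xy\alpha}_{ij}|\big)_{i,j=1}^n$ has Hilbert–Schmidt norm $\|Q^{xy}\|_{HS}=o(n^{-1/2})$. Then there is a deterministic probability measure $\mathcal N$ on $\mathbb R$ such that the empirical spectral distributions $\mathcal N_{\mathcal A_n}$ (mass $1/n$ at each eigenvalue of $\mathcal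 A_n$, with multiplicity) converge weakly in probability to $\mathcal N$: for every bounded continuous $\varphi:\mathbb R\to\mathbb R$, $\int\varphi\,d\mathcal N_{\mathcal A_n}\to\int\varphi\,d\mathcal N$ in probability. The Stieltjes transform $f(z)=\int\frac{\mathcal N(d\lambda)}{\lambda-z}$ satisfies $$z f(z)^3+(1-2c_1)f(z)^2-zf(z)-1=0,\qquad z\in\mathbb C\setminus\mathbb R,$$ and it is the only solution of this equation on $\mathbb C\setminus\mathbb R$ among the Stieltjes transforms of non-negative Borel measures $\nu$ on $\mathbb R$ with $\int(1+|\lambda|)^{-1}\,\nu(d\lambda)<\infty$ (in particular, among those of finite measures). -/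

import Mathlib

open MeasureTheory ProbabilityTheory Filter Topology Asymptotics
open scoped ENNReal BoundedContinuousFunction

noncomputable section

/-- The Euclidean operator norm of a real square matrix. -/
def opNorm {n : ℕ} (D : Matrix (Fin n) (Fin n) ℝ) : ℝ :=
  ‖Matrix.toEuclideanCLM (𝕜 := ℝ) D‖

/-- The Hilbert-Schmidt norm of a real square matrix. -/
def hsNorm {n : ℕ} (D : Matrix (Fin n) (Fin n) ℝ) : ℝ :=
  Real.sqrt (∑ i, ∑ j, D i j ^ 2)

/-- The bilinear form `(D u, v)`. -/
def bilin {n : ℕ} (D : Matrix (Fin n) (Fin n) ℝ) (u v : EuclideanSpace ℝ (Fin n)) : ℝ :=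
  inner ℝ (Matrix.toEuclideanCLM (𝕜 := ℝ) D u) v

/-- The matrix `E u vᵀ` of (not centered) second moments of two random vectors. -/
def momentMatrix {n : ℕ} {Ω : Type*} [MeasurableSpace Ω] (P : Measure Ω)
    (u v : Ω → EuclideanSpace ℝ (Fin n)) : Matrix (Fin n) (Fin n) ℝ :=
  Matrix.of fun i j => ∫ ω, u ω i * v ω j ∂P

/-- The matrix `∑ α, ξ α (x α (y α)ᵀ + y α (x α)ᵀ)`. -/
def adjacencyMatrix {n m : ℕ} (ξ : Fin m → ℝ) (x y : Fin m → EuclideanSpace ℝ (Fin n)) :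
    Matrix (Fin n) (Fin n) ℝ :=
  ∑ α, ξ α • (Matrix.vecMulVec (x α) (y α) + Matrix.vecMulVec (y α) (x α))

theorem adjacencyMatrix_isHermitian {n m : ℕ} (ξ : Fin m → ℝ)
    (x y : Fin m → EuclideanSpace ℝ (Fin n)) : (adjacencyMatrix ξ x y).IsHermitian := by
  ext i j
  simp only [adjacencyMatrix, Matrix.conjTranspose_apply, Matrix.sum_apply, Matrix.smul_apply,
    Matrix.add_apply, Matrix.vecMulVec_apply, star_trivial, smul_eq_mul]
  refine Finset.sum_congr rfl fun α _ => ?_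
  ring

/-- The empirical spectral distribution of a symmetric matrix: the eigenvalues, counted with
multiplicity, have mass `1 / n` each. -/
def esd {n : ℕ} {M : Matrix (Fin n) (Fin n) ℝ} (hM : M.IsHermitian) : Measure ℝ :=
  (n : ℝ≥0∞)⁻¹ • ∑ i, Measure.dirac (hM.eigenvalues i)

/-- The Stieltjes transform `∫ (t - z)⁻¹ ν(dt)`. -/
def stieltjes (ν : Measure ℝ) (z : ℂ) : ℂ :=
  ∫ t : ℝ, ((t : ℂ) - z)⁻¹ ∂ν

/-- `f` solves `z f³ + (1 - 2 c₁) f² - z f - 1 = 0` off the real axis. -/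
def SolvesCubic (c₁ : ℝ) (f : ℂ → ℂ) : Prop :=
  ∀ z : ℂ, z.im ≠ 0 → z * f z ^ 3 + (1 - 2 * (c₁ : ℂ)) * f z ^ 2 - z * f z - 1 = 0

/-- Random measures `N n`, each on its own probability space, converge weakly in probability to
the deterministic measure `μ`. -/
def ConvergesInProbability {Ω : ℕ → Type*} [∀ n, MeasurableSpace (Ω n)]
    (P : ∀ n, Measure (Ω n)) (N : ∀ n, Ω n → Measure ℝ) (μ : Measure ℝ) : Prop :=
  ∀ φ : ℝ →ᵇ ℝ, ∀ ε : ℝ, 0 < ε →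
    Tendsto (fun n => P n {ω | ε ≤ |(∫ t, φ t ∂(N n ω)) - ∫ t, φ t ∂μ|}) atTop (𝓝 0)

end

/-! Write G = (A - z)⁻¹, f = n⁻¹ Tr G, and G_α for the resolvent of A with its α-th term removed.
Since (A - z)G = 1, the quantity n⁻¹ Tr H + z n⁻¹ Tr GH equals n⁻¹ Tr AGH, a sum over α of ξ_α times
quadratic forms of GH in x_α and y_α. `qf_res_rank_two` expresses these forms through G_α, which is
independent of (ξ_α, x_α, y_α). The variance hypothesis replaces every form of G_α by its mean:
mixed forms in x_α and y_α are negligible on average by the cross moment hypothesis, and the others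
become traces against the second moment matrices Q. If Tr QG is close to f for these Q, the α-th
summand is close to -ξ_α f (Tr Q^{xα}GH + Tr Q^{yα}GH)/(1 - f²). The factorization hypothesis and
the concentration of the ξ_α then give n⁻¹ Tr H + (z + 2c₁f/(1 - f²)) n⁻¹ Tr GH ≈ 0
(`integralLE_norm_self_consistent`).

The closeness of Tr QG to f follows from this same relation, used with H = nQ and with H = 1. The
argument is circular, but for Im z ≥ 64B³ the discrepancy enters the relation with coefficient only
1/8, so it can be absorbed (`integralLE_norm_selfEq`). With H = 1 one finds that 1 + zf + 2c₁f²/(1 -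
f²) tends to 0 in L¹. On the disc of radius 1/64 this expression has a unique zero w(z), and it
controls the distance to that zero (`norm_sub_le_of_selfEq_eq_zero`), so f → w(z) in probability for
every such z.

Convergence of Stieltjes transforms high in the upper half plane is enough for weak convergence
(`exists_convergesInProbability`): 1 + z w(z) → 0 gives tightness, and the Cauchy kernels with poles
far from the real axis, together with the constants, have a closed span containing a
point-separating star algebra. For the limit μ the cubic holds at points accumulating at a point of
the imaginary axis, hence everywhere off the real line by the identity theorem and conjugation. For
uniqueness, any admissible transform tends to 0 along the imaginary axis, so it eventually coincides
with the small root, and the identity theorem applies again. -/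

noncomputable section

open Matrix
open scoped Matrix.Norms.L2Operator

/-! ### Complexified matrices, bilinear forms and norm bounds. -/

/-- The complexification of a real matrix. -/
def cmat {n : ℕ} (X : Matrix (Fin n) (Fin n) ℝ) : Matrix (Fin n) (Fin n) ℂ :=
  X.map Complex.ofRealHom

/-- The resolvent `(X - z)⁻¹` of a real matrix. -/
def res {n : ℕ} (X : Matrix (Fin n) (Fin n) ℝ) (z : ℂ) : Matrix (Fin n) (Fin n) ℂ :=
  (cmat X - z • 1)⁻¹

/-- The complexification of a real vector. -/
def cvec {n : ℕ} (u : EuclideanSpace ℝ (Fin n)) : Fin n → ℂ := fun i => (u i : ℂ)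

/-- The bilinear form `vᵀ K u`. -/
def qf {n : ℕ} (K : Matrix (Fin n) (Fin n) ℂ) (u v : EuclideanSpace ℝ (Fin n)) : ℂ :=
  cvec v ⬝ᵥ (K *ᵥ cvec u)

variable {n : ℕ}

lemma cmat_apply (X : Matrix (Fin n) (Fin n) ℝ) (i j : Fin n) : cmat X i j = (X i j : ℂ) := rfl

lemma cmat_mul (X Y : Matrix (Fin n) (Fin n) ℝ) : cmat (X * Y) = cmat X * cmat Y := by
  simp [cmat, Matrix.map_mul]

lemma cmat_one : cmat (1 : Matrix (Fin n) (Fin n) ℝ) = 1 := by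
  simp [cmat]

lemma cmat_add (X Y : Matrix (Fin n) (Fin n) ℝ) : cmat (X + Y) = cmat X + cmat Y := by
  ext i j; simp [cmat]

lemma cmat_sub (X Y : Matrix (Fin n) (Fin n) ℝ) : cmat (X - Y) = cmat X - cmat Y := by
  ext i j; simp [cmat]

lemma cmat_smul (r : ℝ) (X : Matrix (Fin n) (Fin n) ℝ) : cmat (r • X) = (r : ℂ) • cmat X := by
  ext i j; simp [cmat]

lemma cmat_transpose (X : Matrix (Fin n) (Fin n) ℝ) : cmat Xᵀ = (cmat X)ᵀ := by
  ext i j; simp [cmat]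

lemma cmat_trace (X : Matrix (Fin n) (Fin n) ℝ) : (cmat X).trace = (X.trace : ℂ) := by
  simp [Matrix.trace, cmat]

lemma cmat_vecMulVec (u v : EuclideanSpace ℝ (Fin n)) :
    cmat (Matrix.vecMulVec u v) = Matrix.vecMulVec (cvec u) (cvec v) := by
  ext i j; simp [cmat, cvec, Matrix.vecMulVec_apply]

lemma norm_cvec (u : EuclideanSpace ℝ (Fin n)) : ‖WithLp.toLp 2 (cvec u)‖ = ‖u‖ := by
  simp [EuclideanSpace.norm_eq, cvec]

lemma norm_mulVec_le (K : Matrix (Fin n) (Fin n) ℂ) (w : Fin n → ℂ) :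
    ‖WithLp.toLp 2 (K *ᵥ w)‖ ≤ ‖K‖ * ‖WithLp.toLp 2 w‖ :=
  Matrix.l2_opNorm_mulVec K (WithLp.toLp 2 w)

lemma norm_dotProduct_le (u w : Fin n → ℂ) :
    ‖u ⬝ᵥ w‖ ≤ ‖WithLp.toLp 2 u‖ * ‖WithLp.toLp 2 w‖ := by
  have h := norm_inner_le_norm (𝕜 := ℂ) (WithLp.toLp 2 (star u)) (WithLp.toLp 2 w)
  have h1 : inner ℂ (WithLp.toLp 2 (star u)) (WithLp.toLp 2 w) = u ⬝ᵥ w := by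
    simp [PiLp.inner_apply, dotProduct, mul_comm]
  have h2 : ‖WithLp.toLp 2 (star u)‖ = ‖WithLp.toLp 2 u‖ := by
    simp [EuclideanSpace.norm_eq]
  rwa [h1, h2] at h

lemma norm_qf_le (K : Matrix (Fin n) (Fin n) ℂ) (u v : EuclideanSpace ℝ (Fin n)) :
    ‖qf K u v‖ ≤ ‖K‖ * ‖u‖ * ‖v‖ := by
  unfold qf
  calc _ ≤ ‖WithLp.toLp 2 (cvec v)‖ * ‖WithLp.toLp 2 (K *ᵥ cvec u)‖ := norm_dotProduct_le _ _
    _ ≤ ‖v‖ * (‖K‖ * ‖u‖) := by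
      rw [norm_cvec, ← norm_cvec u]
      gcongr
      exact norm_mulVec_le _ _
    _ = _ := by ring

lemma qf_sub (K L : Matrix (Fin n) (Fin n) ℂ) (u v : EuclideanSpace ℝ (Fin n)) :
    qf (K - L) u v = qf K u v - qf L u v := by
  simp [qf, Matrix.sub_mulVec, dotProduct_sub]

lemma qf_transpose (K : Matrix (Fin n) (Fin n) ℂ) (u v : EuclideanSpace ℝ (Fin n)) :
    qf Kᵀ u v = qf K v u := by
  unfold qf
  rw [Matrix.mulVec_transpose, dotProduct_comm, ← Matrix.dotProduct_mulVec]

lemma trace_vecMulVec_mul (K : Matrix (Fin n) (Fin n) ℂ) (a b : Fin n → ℂ) :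
    (Matrix.vecMulVec a b * K).trace = b ⬝ᵥ (K *ᵥ a) := by
  rw [Matrix.vecMulVec_mul, Matrix.trace_vecMulVec, Matrix.dotProduct_mulVec, dotProduct_comm]

lemma qf_eq_sum (K : Matrix (Fin n) (Fin n) ℂ) (u v : EuclideanSpace ℝ (Fin n)) :
    qf K u v = ∑ i, ∑ j, K i j * ((u j : ℂ) * (v i : ℂ)) := by
  simp only [qf, dotProduct, mulVec, cvec, Finset.mul_sum]
  refine Finset.sum_congr rfl fun i _ => Finset.sum_congr rfl fun j _ => ?_
  ring

lemma bilin_eq_sum (D : Matrix (Fin n) (Fin n) ℝ) (u v : EuclideanSpace ℝ (Fin n)) :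
    bilin D u v = ∑ i, ∑ j, D i j * (u j * v i) := by
  unfold bilin
  rw [real_inner_comm, Matrix.inner_toEuclideanCLM]
  simp only [dotProduct, mulVec, Finset.mul_sum]
  refine Finset.sum_congr rfl fun i _ => Finset.sum_congr rfl fun j _ => ?_
  ring

lemma re_qf (K : Matrix (Fin n) (Fin n) ℂ) (u v : EuclideanSpace ℝ (Fin n)) :
    (qf K u v).re = bilin (K.map Complex.re) u v := by
  rw [qf_eq_sum, bilin_eq_sum]
  simp

lemma im_qf (K : Matrix (Fin n) (Fin n) ℂ) (u v : EuclideanSpace ℝ (Fin n)) :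
    (qf K u v).im = bilin (K.map Complex.im) u v := by
  rw [qf_eq_sum, bilin_eq_sum]
  simp

/-- Taking v = Du in the hypothesis gives ‖Du‖² ≤ c‖u‖‖Du‖. -/
lemma opNorm_le_of_bilin {D : Matrix (Fin n) (Fin n) ℝ} {c : ℝ} (hc : 0 ≤ c)
    (h : ∀ u v, |bilin D u v| ≤ c * ‖u‖ * ‖v‖) : opNorm D ≤ c := by
  unfold opNorm
  refine ContinuousLinearMap.opNorm_le_bound _ hc fun u => ?_
  set w := Matrix.toEuclideanCLM (𝕜 := ℝ) D u with hw
  have h1 := h u w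
  rw [bilin, ← hw, real_inner_self_eq_norm_sq, abs_of_nonneg (sq_nonneg _)] at h1
  rcases (norm_nonneg w).eq_or_lt with h0 | h0
  · rw [← h0]; positivity
  · exact le_of_mul_le_mul_right (by nlinarith) h0

lemma opNorm_re_le (K : Matrix (Fin n) (Fin n) ℂ) : opNorm (K.map Complex.re) ≤ ‖K‖ :=
  opNorm_le_of_bilin (norm_nonneg _) fun u v => by
    rw [← re_qf]
    exact (Complex.abs_re_le_norm _).trans (norm_qf_le K u v)

lemma opNorm_im_le (K : Matrix (Fin n) (Fin n) ℂ) : opNorm (K.map Complex.im) ≤ ‖K‖ :=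
  opNorm_le_of_bilin (norm_nonneg _) fun u v => by
    rw [← im_qf]
    exact (Complex.abs_im_le_norm _).trans (norm_qf_le K u v)

/-- A real matrix acts separately on the real and imaginary parts of a vector, and squared norms
add. -/
lemma norm_cmat_le (D : Matrix (Fin n) (Fin n) ℝ) : ‖cmat D‖ ≤ opNorm D := by
  rw [Matrix.cstar_norm_def]
  refine ContinuousLinearMap.opNorm_le_bound _ (norm_nonneg _) fun w => ?_
  set a : EuclideanSpace ℝ (Fin n) := WithLp.toLp 2 fun i => (w i).re
  set b : EuclideanSpace ℝ (Fin n) := WithLp.toLp 2 fun i => (w i).im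
  have hw : ‖w‖ ^ 2 = ‖a‖ ^ 2 + ‖b‖ ^ 2 := by
    simp only [EuclideanSpace.norm_sq_eq, a, b, ← Finset.sum_add_distrib]
    refine Finset.sum_congr rfl fun i _ => ?_
    rw [Complex.sq_norm, Complex.normSq_apply]
    simp [sq]
  have hD : ‖Matrix.toEuclideanCLM (𝕜 := ℂ) (cmat D) w‖ ^ 2 =
      ‖Matrix.toEuclideanCLM (𝕜 := ℝ) D a‖ ^ 2 + ‖Matrix.toEuclideanCLM (𝕜 := ℝ) D b‖ ^ 2 := by
    simp only [EuclideanSpace.norm_sq_eq, Matrix.ofLp_toEuclideanCLM, ← Finset.sum_add_distrib]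
    refine Finset.sum_congr rfl fun i _ => ?_
    rw [Complex.sq_norm, Complex.normSq_apply]
    simp [sq, mulVec, dotProduct, a, b, cmat_apply]
  have h1 := (Matrix.toEuclideanCLM (𝕜 := ℝ) D).le_opNorm a
  have h2 := (Matrix.toEuclideanCLM (𝕜 := ℝ) D).le_opNorm b
  refine le_of_sq_le_sq ?_ (by unfold opNorm; positivity)
  rw [mul_pow, hw, hD]
  have h3 := pow_le_pow_left₀ (norm_nonneg _) h1 2
  have h4 := pow_le_pow_left₀ (norm_nonneg _) h2 2
  simp only [mul_pow] at h3 h4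
  unfold opNorm
  linarith

/-- Each column is the image of a unit vector, so its squared norm is at most ‖K‖². -/
lemma sum_norm_sq_le (K : Matrix (Fin n) (Fin n) ℂ) :
    ∑ i, ∑ j, ‖K i j‖ ^ 2 ≤ n * ‖K‖ ^ 2 := by
  rw [Finset.sum_comm]
  have h : ∀ j, ∑ i, ‖K i j‖ ^ 2 ≤ ‖K‖ ^ 2 := fun j => by
    have := norm_mulVec_le K (Pi.single j 1)
    have h2 := pow_le_pow_left₀ (norm_nonneg _) this 2
    rw [EuclideanSpace.norm_sq_eq] at h2
    simpa [Matrix.mulVec_single] using h2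
  calc _ ≤ ∑ _j : Fin n, ‖K‖ ^ 2 := Finset.sum_le_sum fun j _ => h j
    _ = _ := by simp

lemma norm_trace_le (K : Matrix (Fin n) (Fin n) ℂ) : ‖K.trace‖ ≤ n * ‖K‖ := by
  have h : ∀ j, ‖K j j‖ ≤ ‖K‖ := fun j => by
    have h1 := norm_qf_le K (EuclideanSpace.single j 1) (EuclideanSpace.single j 1)
    have h2 : qf K (EuclideanSpace.single j 1) (EuclideanSpace.single j 1) = K j j := by
      simp [qf_eq_sum, apply_ite Complex.ofReal]
    simpa [h2] using h1
  calc _ ≤ ∑ j, ‖K j j‖ := norm_sum_le _ _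
    _ ≤ ∑ _j : Fin n, ‖K‖ := Finset.sum_le_sum fun j _ => h j
    _ = _ := by simp

/-! ### The resolvent of a symmetric matrix -/

lemma sub_ne_zero_of_im {z : ℂ} (hz : z.im ≠ 0) (t : ℝ) : (t : ℂ) - z ≠ 0 := fun h => by
  apply hz
  have := congrArg Complex.im h
  simpa using this

lemma abs_im_le_norm_sub (z : ℂ) (t : ℝ) : |z.im| ≤ ‖(t : ℂ) - z‖ := by
  have := Complex.abs_im_le_norm ((t : ℂ) - z)
  simpa using this

lemma norm_inv_sub_le {z : ℂ} (hz : z.im ≠ 0) (t : ℝ) : ‖((t : ℂ) - z)⁻¹‖ ≤ |z.im|⁻¹ := by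
  rw [norm_inv]
  exact inv_anti₀ (abs_pos.2 hz) (abs_im_le_norm_sub z t)

variable {X : Matrix (Fin n) (Fin n) ℝ}

lemma cmat_eq_unitary_conj (hX : X.IsHermitian) :
    ∃ U : Matrix (Fin n) (Fin n) ℂ, star U * U = 1 ∧ U * star U = 1 ∧
      cmat X = U * diagonal (fun i => (hX.eigenvalues i : ℂ)) * star U := by
  refine ⟨cmat (hX.eigenvectorUnitary : Matrix (Fin n) (Fin n) ℝ), ?_, ?_, ?_⟩
  · have := Unitary.coe_star_mul_self hX.eigenvectorUnitary
    have h := congrArg cmat this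
    rw [cmat_mul, cmat_one] at h
    rw [← h]; congr 1; ext i j; simp [cmat]
  · have := Unitary.coe_mul_star_self hX.eigenvectorUnitary
    have h := congrArg cmat this
    rw [cmat_mul, cmat_one] at h
    rw [← h]; congr 1; ext i j; simp [cmat]
  · have h := congrArg cmat hX.spectral_theorem
    rw [Unitary.conjStarAlgAut_apply, cmat_mul, cmat_mul] at h
    rw [h]; congr 1
    · congr 1; ext i j; simp [cmat, diagonal_apply]; split_ifs <;> simp
    · ext i j; simp [cmat]

/-- Diagonalization is the source of all basic resolvent facts: two-sided invertibility, the trace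
as a sum over eigenvalues, and the norm bound |Im z|⁻¹. -/
lemma res_eq_unitary_conj (hX : X.IsHermitian) {z : ℂ} (hz : z.im ≠ 0) :
    (cmat X - z • 1) * res X z = 1 ∧ res X z * (cmat X - z • 1) = 1 ∧
    ∃ U : Matrix (Fin n) (Fin n) ℂ, star U * U = 1 ∧ U * star U = 1 ∧
      res X z = U * diagonal (fun i => ((hX.eigenvalues i : ℂ) - z)⁻¹) * star U := by
  obtain ⟨U, h1, h2, h3⟩ := cmat_eq_unitary_conj hX
  set R := U * diagonal (fun i => ((hX.eigenvalues i : ℂ) - z)⁻¹) * star U with hR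
  have h4 : cmat X - z • 1 = U * diagonal (fun i => (hX.eigenvalues i : ℂ) - z) * star U := by
    have : diagonal (fun i => (hX.eigenvalues i : ℂ) - z)
        = diagonal (fun i => (hX.eigenvalues i : ℂ)) - z • 1 := by
      ext i j; simp [diagonal_apply, Matrix.one_apply]; split_ifs <;> simp
    rw [this, Matrix.mul_sub, Matrix.sub_mul, ← h3]
    simp [h2]
  have h5 : (cmat X - z • 1) * R = 1 := by
    rw [h4, hR]
    calc _ = U * (diagonal (fun i => (hX.eigenvalues i : ℂ) - z) * (star U * U) *
          diagonal (fun i => ((hX.eigenvalues i : ℂ) - z)⁻¹)) * star U := by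
          simp only [Matrix.mul_assoc]
      _ = _ := by
        rw [h1, Matrix.mul_one, Matrix.diagonal_mul_diagonal]
        have : (fun i => ((hX.eigenvalues i : ℂ) - z) * ((hX.eigenvalues i : ℂ) - z)⁻¹)
            = fun _ => 1 := by
          ext i; exact mul_inv_cancel₀ (sub_ne_zero_of_im hz _)
        rw [this, Matrix.diagonal_one, Matrix.mul_one, h2]
  have h6 : res X z = R := Matrix.inv_eq_right_inv h5
  refine ⟨by rw [h6, h5], by rw [h6]; exact mul_eq_one_comm.1 h5, U, h1, h2, h6⟩

lemma sub_mul_res (hX : X.IsHermitian) {z : ℂ} (hz : z.im ≠ 0) :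
    (cmat X - z • 1) * res X z = 1 := (res_eq_unitary_conj hX hz).1

lemma res_mul_sub (hX : X.IsHermitian) {z : ℂ} (hz : z.im ≠ 0) :
    res X z * (cmat X - z • 1) = 1 := (res_eq_unitary_conj hX hz).2.1

lemma cmat_mul_res (hX : X.IsHermitian) {z : ℂ} (hz : z.im ≠ 0) :
    cmat X * res X z = 1 + z • res X z := by
  have h := sub_mul_res hX hz
  rw [Matrix.sub_mul, Matrix.smul_mul, Matrix.one_mul] at h
  rw [← h]; abel

lemma trace_res (hX : X.IsHermitian) {z : ℂ} (hz : z.im ≠ 0) :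
    (res X z).trace = ∑ i, ((hX.eigenvalues i : ℂ) - z)⁻¹ := by
  obtain ⟨-, -, U, h1, h2, h3⟩ := res_eq_unitary_conj hX hz
  rw [h3, Matrix.trace_mul_comm, ← Matrix.mul_assoc, h1, Matrix.one_mul, Matrix.trace_diagonal]

lemma norm_le_one_of_star_mul_self {U : Matrix (Fin n) (Fin n) ℂ} (h : star U * U = 1) :
    ‖U‖ ≤ 1 := by
  have h1 := Matrix.l2_opNorm_conjTranspose_mul_self U
  rw [← Matrix.star_eq_conjTranspose, h] at h1
  have h2 : ‖(1 : Matrix (Fin n) (Fin n) ℂ)‖ ≤ 1 := by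
    rw [← Matrix.diagonal_one, Matrix.l2_opNorm_diagonal]
    exact (pi_norm_le_iff_of_nonneg zero_le_one).2 fun i => by simp
  nlinarith [norm_nonneg U]

lemma norm_one_le : ‖(1 : Matrix (Fin n) (Fin n) ℂ)‖ ≤ 1 :=
  norm_le_one_of_star_mul_self (by simp)

lemma norm_res_le (hX : X.IsHermitian) {z : ℂ} (hz : z.im ≠ 0) : ‖res X z‖ ≤ |z.im|⁻¹ := by
  obtain ⟨-, -, U, h1, h2, h3⟩ := res_eq_unitary_conj hX hz
  have hU := norm_le_one_of_star_mul_self h1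
  have hU' : ‖star U‖ ≤ 1 := by
    rw [Matrix.star_eq_conjTranspose, Matrix.l2_opNorm_conjTranspose]; exact hU
  have hd : ‖diagonal (fun i => ((hX.eigenvalues i : ℂ) - z)⁻¹)‖ ≤ |z.im|⁻¹ := by
    rw [Matrix.l2_opNorm_diagonal]
    exact (pi_norm_le_iff_of_nonneg (by positivity)).2 fun i => norm_inv_sub_le hz _
  rw [h3]
  calc _ ≤ ‖U‖ * ‖diagonal (fun i => ((hX.eigenvalues i : ℂ) - z)⁻¹)‖ * ‖star U‖ :=
        (norm_mul_le _ _).trans (by gcongr; exact norm_mul_le _ _)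
    _ ≤ 1 * |z.im|⁻¹ * 1 := by gcongr
    _ = _ := by ring

lemma res_transpose (hX : X.IsHermitian) (z : ℂ) : (res X z)ᵀ = res X z := by
  have : Xᵀ = X := by simpa using hX.eq
  rw [res, Matrix.transpose_nonsing_inv, Matrix.transpose_sub, ← cmat_transpose, this]
  simp

lemma res_sub_res {Y : Matrix (Fin n) (Fin n) ℝ} (hX : X.IsHermitian) (hY : Y.IsHermitian)
    {z : ℂ} (hz : z.im ≠ 0) :
    res X z - res Y z = res X z * cmat (Y - X) * res Y z := by
  have h : cmat (Y - X) = (cmat Y - z • 1) - (cmat X - z • 1) := by rw [cmat_sub]; abel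
  rw [h, Matrix.mul_sub, Matrix.sub_mul, Matrix.mul_assoc, sub_mul_res hY hz, res_mul_sub hX hz]
  simp

/-! ### Rank two perturbation of the resolvent. -/

/-- The symmetric rank two matrix `u vᵀ + v uᵀ`. -/
def symProd (u v : EuclideanSpace ℝ (Fin n)) : Matrix (Fin n) (Fin n) ℝ :=
  Matrix.vecMulVec u v + Matrix.vecMulVec v u

lemma trace_cmat_symProd_mul (K : Matrix (Fin n) (Fin n) ℂ) (u v : EuclideanSpace ℝ (Fin n)) :
    (cmat (symProd u v) * K).trace = qf K u v + qf K v u := by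
  rw [symProd, cmat_add, cmat_vecMulVec, cmat_vecMulVec, Matrix.add_mul, Matrix.trace_add,
    trace_vecMulVec_mul, trace_vecMulVec_mul]
  rfl

/-- By the resolvent identity and cyclicity, the difference of traces is a sum of two quadratic
forms in u and v, so no factor n appears. -/
lemma norm_trace_mul_res_sub_le {Y : Matrix (Fin n) (Fin n) ℝ} (hX : X.IsHermitian)
    {u v : EuclideanSpace ℝ (Fin n)} (hY : Y.IsHermitian) (hXY : Y = X + symProd u v)
    {z : ℂ} (hz : z.im ≠ 0) (Q L R : Matrix (Fin n) (Fin n) ℂ) :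
    ‖(Q * (L * res X z * R)).trace - (Q * (L * res Y z * R)).trace‖
      ≤ 2 * ‖u‖ * ‖v‖ * |z.im|⁻¹ ^ 2 * (‖L‖ * ‖R‖) * ‖Q‖ := by
  have h1 : (Q * (L * res X z * R)).trace - (Q * (L * res Y z * R)).trace
      = qf (res Y z * (R * Q * L) * res X z) u v + qf (res Y z * (R * Q * L) * res X z) v u := by
    rw [← Matrix.trace_sub, ← Matrix.mul_sub, ← Matrix.sub_mul, ← Matrix.mul_sub,
      res_sub_res hX hY hz, hXY, add_sub_cancel_left, ← trace_cmat_symProd_mul]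
    rw [show Q * (L * (res X z * cmat (symProd u v) * res (X + symProd u v) z) * R) =
      (Q * L * res X z) * (cmat (symProd u v) * (res (X + symProd u v) z * R)) by
        simp only [Matrix.mul_assoc], Matrix.trace_mul_comm]
    simp only [Matrix.mul_assoc]
  have h2 : ‖res Y z * (R * Q * L) * res X z‖ ≤ |z.im|⁻¹ * (‖R‖ * ‖Q‖ * ‖L‖) * |z.im|⁻¹ := by
    refine (norm_mul_le _ _).trans ?_
    gcongr
    · refine (norm_mul_le _ _).trans ?_
      gcongr
      · exact norm_res_le hY hz
      · refine (norm_mul_le _ _).trans ?_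
        gcongr
        exact norm_mul_le _ _
    · exact norm_res_le hX hz
  rw [h1]
  calc _ ≤ ‖res Y z * (R * Q * L) * res X z‖ * ‖u‖ * ‖v‖
        + ‖res Y z * (R * Q * L) * res X z‖ * ‖v‖ * ‖u‖ :=
        (norm_add_le _ _).trans (add_le_add (norm_qf_le _ _ _) (norm_qf_le _ _ _))
    _ = 2 * ‖u‖ * ‖v‖ * ‖res Y z * (R * Q * L) * res X z‖ := by ring
    _ ≤ 2 * ‖u‖ * ‖v‖ * (|z.im|⁻¹ * (‖R‖ * ‖Q‖ * ‖L‖) * |z.im|⁻¹) := by gcongr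
    _ = _ := by ring

/-- The quadratic forms of the resolvent after a symmetric rank two perturbation. -/
lemma qf_res_rank_two {Y : Matrix (Fin n) (Fin n) ℝ} (hX : X.IsHermitian) (hY : Y.IsHermitian)
    {u v : EuclideanSpace ℝ (Fin n)} (hXY : Y = X + symProd u v)
    {z : ℂ} (hz : z.im ≠ 0) (H : Matrix (Fin n) (Fin n) ℂ) :
    (qf (res Y z * H) u v + qf (res Y z * H) v u) *
        ((1 + qf (res X z) u v) ^ 2 - qf (res X z) u u * qf (res X z) v v) =
      (1 + qf (res X z) u v) * (qf (res X z * H) u v + qf (res X z * H) v u)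
        - qf (res X z) v v * qf (res X z * H) u u - qf (res X z) u u * qf (res X z * H) v v := by
  have h := res_sub_res hX hY hz
  rw [hXY, add_sub_cancel_left, ← hXY] at h
  -- The resolvent identity between w and w'. For w, w' in {u, v} it yields two 2 × 2 linear systems
  -- for the forms of the perturbed resolvent, both with determinant (1 + c)² - ab.
  have key : ∀ w w' : EuclideanSpace ℝ (Fin n), qf (res Y z * H) w w' =
      qf (res X z * H) w w' - (qf (res X z) u w' * qf (res Y z * H) w v
        + qf (res X z) v w' * qf (res Y z * H) w u) := fun w w' => by
    have h1 : res Y z * H = res X z * H - res X z * cmat (symProd u v) * (res Y z * H) := by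
      rw [← Matrix.mul_assoc, ← h, Matrix.sub_mul]; abel
    have h2 : qf (res X z * cmat (symProd u v) * (res Y z * H)) w w' =
        qf (res X z) u w' * qf (res Y z * H) w v
        + qf (res X z) v w' * qf (res Y z * H) w u := by
      rw [symProd, cmat_add, cmat_vecMulVec, cmat_vecMulVec, Matrix.mul_add, Matrix.add_mul]
      simp only [qf, Matrix.add_mulVec, dotProduct_add, ← Matrix.mulVec_mulVec,
        Matrix.vecMulVec_mulVec, op_smul_eq_smul, Matrix.mulVec_smul, dotProduct_smul, smul_eq_mul]
      ring
    conv_lhs => rw [h1]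
    rw [qf_sub, h2]
  have hc : qf (res X z) v u = qf (res X z) u v := by
    rw [← qf_transpose, res_transpose hX]
  have e1 := key u u
  have e2 := key u v
  have e3 := key v u
  have e4 := key v v
  rw [hc] at e1 e3
  -- Cramer's rule for the sum of the two mixed unknowns. Keeping the determinant as a factor avoids
  -- assuming that it is nonzero.
  linear_combination (1 + qf (res X z) u v) * (e2 + e3) - qf (res X z) v v * e1
    - qf (res X z) u u * e4

end

noncomputable section

open Matrix
open scoped Matrix.Norms.L2Operator

/-! ### Measurability of resolvents and quadratic forms. -/

instance matrixMeasurableSpace {n : ℕ} {R : Type*} [MeasurableSpace R] :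
    MeasurableSpace (Matrix (Fin n) (Fin n) R) :=
  inferInstanceAs (MeasurableSpace (Fin n → Fin n → R))

instance matrixBorelSpace {n : ℕ} {R : Type*} [MeasurableSpace R] [TopologicalSpace R]
    [SecondCountableTopology R] [BorelSpace R] : BorelSpace (Matrix (Fin n) (Fin n) R) :=
  inferInstanceAs (BorelSpace (Fin n → Fin n → R))

variable {n : ℕ}

lemma measurable_matrix_apply {R : Type*} [MeasurableSpace R] (i j : Fin n) :
    Measurable fun X : Matrix (Fin n) (Fin n) R => X i j :=
  (measurable_pi_apply j).comp (measurable_pi_apply i)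

lemma measurable_matrix_iff {R Ω : Type*} [MeasurableSpace R] [MeasurableSpace Ω]
    {f : Ω → Matrix (Fin n) (Fin n) R} :
    Measurable f ↔ ∀ i j, Measurable fun ω => f ω i j :=
  ⟨fun h i j => (measurable_matrix_apply i j).comp h,
    fun h => measurable_pi_iff.2 fun i => measurable_pi_iff.2 fun j => h i j⟩

/-- The entries are an adjugate entry times an inverse determinant. Inversion is measurable on all
of ℂ, so singular matrices need no exclusion. -/
lemma measurable_res (z : ℂ) :
    Measurable fun X : Matrix (Fin n) (Fin n) ℝ => res X z := by
  have h1 : Continuous fun X : Matrix (Fin n) (Fin n) ℝ => cmat X - z • 1 :=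
    (continuous_id.matrix_map Complex.continuous_ofReal).sub continuous_const
  rw [measurable_matrix_iff]
  intro i j
  have h2 : (fun X : Matrix (Fin n) (Fin n) ℝ => res X z i j) =
      fun X => (cmat X - z • 1).det⁻¹ * (cmat X - z • 1).adjugate i j := by
    ext X
    simp [res, Matrix.inv_def]
  rw [h2]
  exact h1.matrix_det.measurable.inv.mul (h1.matrix_adjugate.matrix_elem i j).measurable

lemma measurable_mul_res_mul (z : ℂ) (L R : Matrix (Fin n) (Fin n) ℂ) :
    Measurable fun X : Matrix (Fin n) (Fin n) ℝ => L * res X z * R := by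
  have h : Continuous fun G : Matrix (Fin n) (Fin n) ℂ => L * G * R := by fun_prop
  exact h.measurable.comp (measurable_res z)

lemma measurable_trace_mul (Q : Matrix (Fin n) (Fin n) ℂ) :
    Measurable fun K : Matrix (Fin n) (Fin n) ℂ => (Q * K).trace := by
  have h : Continuous fun K : Matrix (Fin n) (Fin n) ℂ => (Q * K).trace :=
    (continuous_const.matrix_mul continuous_id).matrix_trace
  exact h.measurable

lemma Measurable.qf {Ω : Type*} [MeasurableSpace Ω] {K : Ω → Matrix (Fin n) (Fin n) ℂ}
    {u v : Ω → EuclideanSpace ℝ (Fin n)} (hK : Measurable K) (hu : Measurable u)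
    (hv : Measurable v) : Measurable fun ω => _root_.qf (K ω) (u ω) (v ω) := by
  simp only [qf_eq_sum]
  refine Finset.measurable_sum _ fun i _ => Finset.measurable_sum _ fun j _ => ?_
  refine ((measurable_matrix_iff.1 hK) i j).mul ?_
  have h1 : Measurable fun ω => u ω j := by fun_prop
  have h2 : Measurable fun ω => v ω i := by fun_prop
  exact (Complex.measurable_ofReal.comp h1).mul (Complex.measurable_ofReal.comp h2)

variable {Ω : Type*} [MeasurableSpace Ω] {P : Measure Ω} [IsProbabilityMeasure P]

lemma integrable_of_ae_bdd {E : Type*} [NormedAddCommGroup E] [MeasurableSpace E] [BorelSpace E]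
    [SecondCountableTopology E] {f : Ω → E} (hf : Measurable f) (C : ℝ)
    (h : ∀ᵐ ω ∂P, ‖f ω‖ ≤ C) : Integrable f P :=
  Integrable.of_bound hf.aestronglyMeasurable C h

/-! ### Means and concentration of quadratic forms. -/

section Moments

variable {u v : Ω → EuclideanSpace ℝ (Fin n)} {B : ℝ}

omit [IsProbabilityMeasure P] in
lemma norm_qf_ae_le (hu : ∀ᵐ ω ∂P, ‖u ω‖ ^ 2 ≤ B) (hv : ∀ᵐ ω ∂P, ‖v ω‖ ^ 2 ≤ B)
    (K : Ω → Matrix (Fin n) (Fin n) ℂ) : ∀ᵐ ω ∂P, ‖qf (K ω) (u ω) (v ω)‖ ≤ B * ‖K ω‖ := by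
  filter_upwards [hu, hv] with ω h1 h2
  have h3 : ‖u ω‖ * ‖v ω‖ ≤ B := by nlinarith [sq_nonneg (‖u ω‖ - ‖v ω‖)]
  calc _ ≤ ‖K ω‖ * ‖u ω‖ * ‖v ω‖ := norm_qf_le _ _ _
    _ = ‖u ω‖ * ‖v ω‖ * ‖K ω‖ := by ring
    _ ≤ _ := by gcongr

lemma integrable_qf (hum : Measurable u) (hvm : Measurable v)
    (hu : ∀ᵐ ω ∂P, ‖u ω‖ ^ 2 ≤ B) (hv : ∀ᵐ ω ∂P, ‖v ω‖ ^ 2 ≤ B)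
    (K : Matrix (Fin n) (Fin n) ℂ) : Integrable (fun ω => qf K (u ω) (v ω)) P :=
  integrable_of_ae_bdd (Measurable.qf measurable_const hum hvm) _ (norm_qf_ae_le hu hv fun _ => K)

/-- This identifies the trace as the mean of the quadratic form, the centre around which the
variance hypothesis gives concentration. -/
lemma trace_momentMatrix_mul (hum : Measurable u) (hvm : Measurable v)
    (hu : ∀ᵐ ω ∂P, ‖u ω‖ ^ 2 ≤ B) (hv : ∀ᵐ ω ∂P, ‖v ω‖ ^ 2 ≤ B)
    (K : Matrix (Fin n) (Fin n) ℂ) :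
    (cmat (momentMatrix P u v) * K).trace = ∫ ω, qf K (u ω) (v ω) ∂P := by
  have hint : ∀ i j, Integrable (fun ω => ((u ω j : ℂ) * (v ω i : ℂ))) P := fun i j => by
    have h1 : Measurable fun ω => u ω j := by fun_prop
    have h2 : Measurable fun ω => v ω i := by fun_prop
    refine integrable_of_ae_bdd
      ((Complex.measurable_ofReal.comp h1).mul (Complex.measurable_ofReal.comp h2)) B ?_
    filter_upwards [hu, hv] with ω h3 h4
    have h5 := PiLp.norm_apply_le (u ω) j
    have h6 := PiLp.norm_apply_le (v ω) i
    rw [norm_mul, Complex.norm_real, Complex.norm_real]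
    have : ‖u ω‖ * ‖v ω‖ ≤ B := by nlinarith [sq_nonneg (‖u ω‖ - ‖v ω‖)]
    exact (mul_le_mul h5 h6 (norm_nonneg _) (norm_nonneg _)).trans this
  have hsum : ∫ ω, qf K (u ω) (v ω) ∂P = ∑ i, ∑ j, K i j * ∫ ω, (u ω j : ℂ) * (v ω i : ℂ) ∂P := by
    calc _ = ∫ ω, ∑ i, ∑ j, K i j * ((u ω j : ℂ) * (v ω i : ℂ)) ∂P := by simp only [qf_eq_sum]
      _ = ∑ i, ∫ ω, ∑ j, K i j * ((u ω j : ℂ) * (v ω i : ℂ)) ∂P :=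
        integral_finsetSum _ fun i _ => integrable_finsetSum _ fun j _ => (hint i j).const_mul _
      _ = _ := Finset.sum_congr rfl fun i _ => by
        rw [integral_finsetSum _ fun j _ => (hint i j).const_mul _]
        exact Finset.sum_congr rfl fun j _ => integral_const_mul _ _
  rw [hsum]
  simp only [Matrix.trace, Matrix.diag_apply, Matrix.mul_apply]
  rw [Finset.sum_comm]
  refine Finset.sum_congr rfl fun i _ => Finset.sum_congr rfl fun j _ => ?_
  rw [mul_comm]
  congr 1
  rw [cmat_apply, momentMatrix, Matrix.of_apply, ← integral_complex_ofReal]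
  simp

lemma norm_trace_momentMatrix_mul_le (hum : Measurable u) (hvm : Measurable v)
    (hu : ∀ᵐ ω ∂P, ‖u ω‖ ^ 2 ≤ B) (hv : ∀ᵐ ω ∂P, ‖v ω‖ ^ 2 ≤ B)
    (K : Matrix (Fin n) (Fin n) ℂ) :
    ‖(cmat (momentMatrix P u v) * K).trace‖ ≤ B * ‖K‖ := by
  rw [trace_momentMatrix_mul hum hvm hu hv]
  have := norm_integral_le_of_norm_le_const (norm_qf_ae_le hu hv fun _ => K)
  simpa using this

/-- The variance bound concerns real matrices, so the real and imaginary parts of K are treated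
separately. Each contributes at most θ to the mean deviation. -/
lemma integral_norm_qf_sub_trace_le (hum : Measurable u) (hvm : Measurable v)
    (hu : ∀ᵐ ω ∂P, ‖u ω‖ ^ 2 ≤ B) (hv : ∀ᵐ ω ∂P, ‖v ω‖ ^ 2 ≤ B) {θ : ℝ} (hθ : 0 < θ)
    (hvar : ∀ D : Matrix (Fin n) (Fin n) ℝ, opNorm D ≤ 1 →
      variance (fun ω => bilin D (u ω) (v ω)) P ≤ θ ^ 2)
    {K : Matrix (Fin n) (Fin n) ℂ} (hK : ‖K‖ ≤ 1) :
    ∫ ω, ‖qf K (u ω) (v ω) - (cmat (momentMatrix P u v) * K).trace‖ ∂P ≤ 2 * θ := by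
  have hq := integrable_qf hum hvm hu hv K
  have hqm := Measurable.qf (K := fun _ => K) measurable_const hum hvm
  have key : ∀ f : Ω → ℝ, Measurable f → (∃ C, ∀ᵐ ω ∂P, ‖f ω‖ ≤ C) → variance f P ≤ θ ^ 2 →
      Integrable (fun ω => |f ω - ∫ ω', f ω' ∂P|) P ∧ ∫ ω, |f ω - ∫ ω', f ω' ∂P| ∂P ≤ θ := by
    rintro f hf ⟨C, hC⟩ hv
    have hi : Integrable f P := integrable_of_ae_bdd hf C hC
    have hL : MemLp f 2 P := MemLp.of_bound hf.aestronglyMeasurable C hC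
    have hi1 : Integrable (fun ω => |f ω - ∫ ω', f ω' ∂P|) P :=
      (hi.sub (integrable_const _)).abs
    have hi2 : Integrable (fun ω => (f ω - ∫ ω', f ω' ∂P) ^ 2) P :=
      (hL.sub (memLp_const _)).integrable_sq
    refine ⟨hi1, ?_⟩
    rw [variance_eq_integral hf.aemeasurable] at hv
    -- Pointwise |s| ≤ s²/(2θ) + θ/2; after integration the variance bound makes the two halves add
    -- up to θ.
    have h1 : ∫ ω, |f ω - ∫ ω', f ω' ∂P| ∂P ≤
        ∫ ω, ((f ω - ∫ ω', f ω' ∂P) ^ 2 * (1 / (2 * θ)) + θ / 2) ∂P := by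
      refine integral_mono hi1 ((hi2.mul_const _).add (integrable_const _)) fun ω => ?_
      have := sq_nonneg (|f ω - ∫ ω', f ω' ∂P| - θ)
      rw [sub_sq, sq_abs] at this
      simp only
      rw [mul_one_div, div_add' _ _ _ (by positivity), le_div_iff₀ (by positivity)]
      nlinarith
    rw [integral_add (hi2.mul_const _) (integrable_const _), integral_mul_const] at h1
    simp only [integral_const, probReal_univ, one_smul] at h1
    calc _ ≤ _ := h1
      _ ≤ θ ^ 2 * (1 / (2 * θ)) + θ / 2 := by gcongr
      _ = θ := by field_simp; norm_num
  have hbd := norm_qf_ae_le hu hv fun _ => K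
  have h1 := key (fun ω => (qf K (u ω) (v ω)).re) (Complex.measurable_re.comp hqm)
    ⟨_, hbd.mono fun ω h => (Complex.abs_re_le_norm _).trans h⟩
    (by simp only [re_qf]; exact hvar _ ((opNorm_re_le K).trans hK))
  have h2 := key (fun ω => (qf K (u ω) (v ω)).im) (Complex.measurable_im.comp hqm)
    ⟨_, hbd.mono fun ω h => (Complex.abs_im_le_norm _).trans h⟩
    (by simp only [im_qf]; exact hvar _ ((opNorm_im_le K).trans hK))
  rw [trace_momentMatrix_mul hum hvm hu hv]
  calc _ ≤ ∫ ω, (|(qf K (u ω) (v ω)).re - ∫ ω', (qf K (u ω') (v ω')).re ∂P| +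
        |(qf K (u ω) (v ω)).im - ∫ ω', (qf K (u ω') (v ω')).im ∂P|) ∂P := by
        refine integral_mono (hq.sub (integrable_const _)).norm (h1.1.add h2.1) fun ω => ?_
        have e1 : ∫ ω', (qf K (u ω') (v ω')).re ∂P = (∫ ω', qf K (u ω') (v ω') ∂P).re :=
          integral_re hq
        have e2 : ∫ ω', (qf K (u ω') (v ω')).im ∂P = (∫ ω', qf K (u ω') (v ω') ∂P).im :=
          integral_im hq
        simp only [e1, e2, ← Complex.sub_re, ← Complex.sub_im]
        exact Complex.norm_le_abs_re_add_abs_im _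
    _ ≤ 2 * θ := by
      rw [integral_add h1.1 h2.1]
      linarith [h1.2, h2.2]

end Moments

/-! ### Tools for independence. -/

/-- A fiberwise bound on the expectation passes to independent arguments. -/
lemma IndepFun.integral_comp_le {E F : Type*} [MeasurableSpace E] [MeasurableSpace F]
    {X : Ω → E} {Z : Ω → F} (h : IndepFun X Z P) (hX : Measurable X) (hZ : Measurable Z)
    {g : E × F → ℝ} (hg : Measurable g) (hg0 : ∀ q, 0 ≤ g q) {c : ℝ} (hc : 0 ≤ c)
    (hint : ∀ ω, Integrable (fun ω' => g (X ω, Z ω')) P)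
    (hle : ∀ ω, ∫ ω', g (X ω, Z ω') ∂P ≤ c) : ∫ ω, g (X ω, Z ω) ∂P ≤ c := by
  rw [integral_eq_lintegral_of_nonneg_ae (ae_of_all _ fun ω => hg0 _)
    (hg.comp (hX.prodMk hZ)).aestronglyMeasurable]
  refine ENNReal.toReal_le_of_le_ofReal hc ?_
  have hg' : Measurable fun q => ENNReal.ofReal (g q) := hg.ennreal_ofReal
  have e1 : ∫⁻ ω, ENNReal.ofReal (g (X ω, Z ω)) ∂P =
      ∫⁻ q, ENNReal.ofReal (g q) ∂(P.map fun ω => (X ω, Z ω)) :=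
    (lintegral_map hg' (hX.prodMk hZ)).symm
  rw [e1, (indepFun_iff_map_prod_eq_prod_map_map hX.aemeasurable hZ.aemeasurable).1 h,
    lintegral_prod _ hg'.aemeasurable, lintegral_map hg'.lintegral_prod_right' hX]
  calc _ ≤ ∫⁻ _ω, ENNReal.ofReal c ∂P := by
        refine lintegral_mono fun ω => ?_
        rw [lintegral_map (f := fun q => ENNReal.ofReal (g (X ω, q)))
            (hg'.comp measurable_prodMk_left) hZ,
          ← ofReal_integral_eq_lintegral_ofReal (hint ω) (ae_of_all _ fun ω => hg0 _)]
        exact ENNReal.ofReal_le_ofReal (hle ω)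
    _ = _ := by simp

/-- If the families `X` and `Y` are independent of each other and each of them consists of
independent variables, then the pairs `(X i, Y i)` are independent. -/
lemma iIndepFun_prodMk {ι : Type*} [Fintype ι] {E F : Type*} [MeasurableSpace E]
    [MeasurableSpace F] {X : ι → Ω → E} {Y : ι → Ω → F} (hX : ∀ i, Measurable (X i))
    (hY : ∀ i, Measurable (Y i)) (h1 : iIndepFun X P) (h2 : iIndepFun Y P)
    (h3 : IndepFun (fun ω i => X i ω) (fun ω i => Y i ω) P) :
    iIndepFun (fun i ω => (X i ω, Y i ω)) P := by
  have hXY : ∀ i, Measurable fun ω => (X i ω, Y i ω) := fun i => (hX i).prodMk (hY i)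
  rw [iIndepFun_iff_map_fun_eq_pi_map fun i => (hXY i).aemeasurable]
  have := fun i => Measure.isProbabilityMeasure_map (μ := P) (hX i).aemeasurable
  have := fun i => Measure.isProbabilityMeasure_map (μ := P) (hY i).aemeasurable
  have hp : ∀ i, P.map (fun ω => (X i ω, Y i ω)) = (P.map (X i)).prod (P.map (Y i)) := fun i =>
    (indepFun_iff_map_prod_eq_prod_map_map (hX i).aemeasurable (hY i).aemeasurable).1
      (h3.comp (measurable_pi_apply i) (measurable_pi_apply i))
  simp only [hp]
  have h4 := (indepFun_iff_map_prod_eq_prod_map_map (measurable_pi_lambda _ hX).aemeasurable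
    (measurable_pi_lambda _ hY).aemeasurable).1 h3
  rw [(iIndepFun_iff_map_fun_eq_pi_map fun i => (hX i).aemeasurable).1 h1,
    (iIndepFun_iff_map_fun_eq_pi_map fun i => (hY i).aemeasurable).1 h2] at h4
  -- The product of the two product laws, regrouped coordinate by coordinate, is the product of the
  -- laws of the pairs.
  have h5 := (measurePreserving_arrowProdEquivProdArrow E F ι (fun i => P.map (X i))
    fun i => P.map (Y i)).symm.map_eq
  rw [← h4, Measure.map_map (MeasurableEquiv.measurable _)
    ((measurable_pi_lambda _ hX).prodMk (measurable_pi_lambda _ hY))] at h5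
  exact h5

end

noncomputable section

set_option linter.unusedSectionVars false

open Matrix
open scoped Matrix.Norms.L2Operator

variable {Ω : Type*} [MeasurableSpace Ω]

/-! ### Integral bounds and the quantitative model at a fixed dimension. -/

/-- `f` is integrable with integral at most `c`. -/
def IntegralLE (P : Measure Ω) (f : Ω → ℝ) (c : ℝ) : Prop :=
  Integrable f P ∧ ∫ ω, f ω ∂P ≤ c

namespace IntegralLE

variable {P : Measure Ω} {f g : Ω → ℝ} {c d : ℝ}

lemma add (hf : IntegralLE P f c) (hg : IntegralLE P g d) :
    IntegralLE P (fun ω => f ω + g ω) (c + d) :=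
  ⟨hf.1.add hg.1, by rw [integral_add hf.1 hg.1]; exact add_le_add hf.2 hg.2⟩

lemma const_mul (hf : IntegralLE P f c) {a : ℝ} (ha : 0 ≤ a) :
    IntegralLE P (fun ω => a * f ω) (a * c) :=
  ⟨hf.1.const_mul a, by rw [integral_const_mul]; gcongr; exact hf.2⟩

lemma sum {ι : Type*} {s : Finset ι} {f : ι → Ω → ℝ} {c : ι → ℝ}
    (h : ∀ i ∈ s, IntegralLE P (f i) (c i)) :
    IntegralLE P (fun ω => ∑ i ∈ s, f i ω) (∑ i ∈ s, c i) :=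
  ⟨integrable_finsetSum _ fun i hi => (h i hi).1, by
    rw [integral_finsetSum _ fun i hi => (h i hi).1]
    exact Finset.sum_le_sum fun i hi => (h i hi).2⟩

lemma mono (hf : IntegralLE P f c) (h : c ≤ d) : IntegralLE P f d := ⟨hf.1, hf.2.trans h⟩

lemma const [IsProbabilityMeasure P] (c : ℝ) : IntegralLE P (fun _ => c) c :=
  ⟨integrable_const _, by simp⟩

lemma of_le (hg : IntegralLE P g c) (hf : AEStronglyMeasurable f P) (hf0 : 0 ≤ᵐ[P] f)
    (h : f ≤ᵐ[P] g) : IntegralLE P f c := by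
  have hi : Integrable f P := by
    refine hg.1.mono' hf ?_
    filter_upwards [hf0, h] with ω h1 h2
    rwa [Real.norm_of_nonneg h1]
  exact ⟨hi, (integral_mono_ae hi hg.1 h).trans hg.2⟩

end IntegralLE

/-- The data of the model at a fixed dimension `n`, with quantitative bounds: `B` bounds all
constants, `θ²` the variances, `τ` the deviations of the traces and `κ` the cross moments. -/
structure RankTwoEnsemble (P : Measure Ω) {n m : ℕ} (ξ : Fin m → Ω → ℝ)
    (x y : Fin m → Ω → EuclideanSpace ℝ (Fin n)) (p B θ τ κ : ℝ) : Prop where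
  n_pos : 0 < n
  m_pos : 0 < m
  one_le_B : 1 ≤ B
  θ_pos : 0 < θ
  mp_le : (m : ℝ) / n * p ≤ B
  ξ_meas : ∀ α, Measurable (ξ α)
  x_meas : ∀ α, Measurable (x α)
  y_meas : ∀ α, Measurable (y α)
  ξ_indep : iIndepFun ξ P
  xy_indep : iIndepFun (fun α ω => (x α ω, y α ω)) P
  ξ_xy_indep : IndepFun (fun ω α => ξ α ω) (fun ω α => (x α ω, y α ω)) P
  ξ_values : ∀ α, ∀ᵐ ω ∂P, ξ α ω = 0 ∨ ξ α ω = 1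
  ξ_prob : ∀ α, P.real {ω | ξ α ω = 1} = p
  x_bdd : ∀ α, ∀ᵐ ω ∂P, ‖x α ω‖ ^ 2 ≤ B
  y_bdd : ∀ α, ∀ᵐ ω ∂P, ‖y α ω‖ ^ 2 ≤ B
  var_xx : ∀ D : Matrix (Fin n) (Fin n) ℝ, opNorm D ≤ 1 → ∀ α,
    variance (fun ω => bilin D (x α ω) (x α ω)) P ≤ θ ^ 2
  var_yy : ∀ D : Matrix (Fin n) (Fin n) ℝ, opNorm D ≤ 1 → ∀ α,
    variance (fun ω => bilin D (y α ω) (y α ω)) P ≤ θ ^ 2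
  var_xy : ∀ D : Matrix (Fin n) (Fin n) ℝ, opNorm D ≤ 1 → ∀ α,
    variance (fun ω => bilin D (x α ω) (y α ω)) P ≤ θ ^ 2
  op_xx : ∀ α, opNorm (momentMatrix P (x α) (x α)) ≤ B / n
  op_yy : ∀ α, opNorm (momentMatrix P (y α) (y α)) ≤ B / n
  op_xy : ∀ α, opNorm (momentMatrix P (x α) (y α)) ≤ B / n
  trace_x : ∀ α, |(momentMatrix P (x α) (x α)).trace - 1| ≤ τ
  trace_y : ∀ α, |(momentMatrix P (y α) (y α)).trace - 1| ≤ τ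
  factor : ∀ K₁ K₂ : Matrix (Fin n) (Fin n) ℝ,
    (1 / (m : ℝ)) * ∑ α, (momentMatrix P (x α) (x α) * K₁).trace *
        (momentMatrix P (y α) (y α) * K₂).trace =
      (1 / (n : ℝ) * K₁.trace) * (1 / (n : ℝ) * K₂.trace)
  cross : Real.sqrt n * hsNorm (Matrix.of fun i j =>
    (1 / (m : ℝ)) * ∑ α, |momentMatrix P (x α) (y α) i j|) ≤ κ

variable {n m : ℕ}

lemma adjacencyMatrix_eq_sum_symProd (ξ : Fin m → ℝ) (x y : Fin m → EuclideanSpace ℝ (Fin n)) :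
    adjacencyMatrix ξ x y = ∑ α, ξ α • symProd (x α) (y α) := rfl

lemma adjacencyMatrix_eq_update_add (ξ : Fin m → ℝ) (x y : Fin m → EuclideanSpace ℝ (Fin n))
    (α : Fin m) : adjacencyMatrix ξ x y =
      adjacencyMatrix (Function.update ξ α 0) x y + ξ α • symProd (x α) (y α) := by
  simp only [adjacencyMatrix_eq_sum_symProd]
  rw [← Finset.sum_erase_add _ _ (Finset.mem_univ α),
    ← Finset.sum_erase_add (f := fun β => Function.update ξ α 0 β • symProd (x β) (y β)) _
      (Finset.mem_univ α)]
  simp only [Function.update_self, zero_smul, add_zero]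
  congr 1
  refine Finset.sum_congr rfl fun β hβ => ?_
  rw [Function.update_of_ne (Finset.ne_of_mem_erase hβ)]

lemma measurable_symProd : Measurable fun w : EuclideanSpace ℝ (Fin n) × EuclideanSpace ℝ (Fin n) =>
    symProd w.1 w.2 := by
  rw [measurable_matrix_iff]
  intro i j
  simp only [symProd, Matrix.add_apply, Matrix.vecMulVec_apply]
  fun_prop

/-- The adjacency matrix as a random matrix. -/
def adj (ξ : Fin m → Ω → ℝ) (x y : Fin m → Ω → EuclideanSpace ℝ (Fin n)) (ω : Ω) :
    Matrix (Fin n) (Fin n) ℝ :=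
  adjacencyMatrix (fun α => ξ α ω) (fun α => x α ω) (fun α => y α ω)

/-- The adjacency matrix without the term of index `α`. -/
def adjDel (ξ : Fin m → Ω → ℝ) (x y : Fin m → Ω → EuclideanSpace ℝ (Fin n)) (α : Fin m) (ω : Ω) :
    Matrix (Fin n) (Fin n) ℝ :=
  adjacencyMatrix (Function.update (fun β => ξ β ω) α 0) (fun β => x β ω) (fun β => y β ω)

section

variable (ξ : Fin m → Ω → ℝ) (x y : Fin m → Ω → EuclideanSpace ℝ (Fin n))

lemma adj_isHermitian (ω : Ω) : (adj ξ x y ω).IsHermitian := adjacencyMatrix_isHermitian _ _ _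

lemma adjDel_isHermitian (α : Fin m) (ω : Ω) : (adjDel ξ x y α ω).IsHermitian :=
  adjacencyMatrix_isHermitian _ _ _

lemma adj_eq_adjDel_add (α : Fin m) (ω : Ω) :
    adj ξ x y ω = adjDel ξ x y α ω + ξ α ω • symProd (x α ω) (y α ω) :=
  adjacencyMatrix_eq_update_add _ _ _ α

lemma adjDel_eq_sum (α : Fin m) (ω : Ω) :
    adjDel ξ x y α ω = ∑ β ∈ Finset.univ.erase α, ξ β ω • symProd (x β ω) (y β ω) := by
  rw [adjDel, adjacencyMatrix_eq_sum_symProd, ← Finset.sum_erase_add _ _ (Finset.mem_univ α)]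
  simp only [Function.update_self, zero_smul, add_zero]
  refine Finset.sum_congr rfl fun β hβ => ?_
  rw [Function.update_of_ne (Finset.ne_of_mem_erase hβ)]

lemma measurable_sum_smul_symProd {ι : Type*} (s : Finset ι) {E : Type*} [MeasurableSpace E]
    {ξ : ι → E → ℝ} {x y : ι → E → EuclideanSpace ℝ (Fin n)} (hξ : ∀ i, Measurable (ξ i))
    (hx : ∀ i, Measurable (x i)) (hy : ∀ i, Measurable (y i)) :
    Measurable fun e => ∑ i ∈ s, ξ i e • symProd (x i e) (y i e) := by
  rw [measurable_matrix_iff]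
  intro a b
  simp only [Matrix.sum_apply, Matrix.smul_apply, smul_eq_mul]
  refine Finset.measurable_sum _ fun i _ => (hξ i).mul ?_
  exact (measurable_matrix_iff.1 (measurable_symProd.comp ((hx i).prodMk (hy i)))) a b

end

namespace RankTwoEnsemble

variable {P : Measure Ω} [IsProbabilityMeasure P] {ξ : Fin m → Ω → ℝ}
  {x y : Fin m → Ω → EuclideanSpace ℝ (Fin n)} {p B θ τ κ : ℝ}

section

variable (h : RankTwoEnsemble P ξ x y p B θ τ κ)
include h

lemma measurable_adj : Measurable (adj ξ x y) :=
  measurable_sum_smul_symProd Finset.univ h.ξ_meas h.x_meas h.y_meas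

lemma measurable_adjDel (α : Fin m) : Measurable (adjDel ξ x y α) := by
  have h1 := measurable_sum_smul_symProd (Finset.univ.erase α) h.ξ_meas h.x_meas h.y_meas
  rwa [← funext fun ω => adjDel_eq_sum ξ x y α ω] at h1

/-- The triples (ξ_β, x_β, y_β) are jointly independent over β, and the reduced matrix is a function
of those with β ≠ α. -/
lemma indepFun_adjDel (α : Fin m) :
    IndepFun (adjDel ξ x y α) (fun ω => (ξ α ω, (x α ω, y α ω))) P := by
  have h1 : iIndepFun (fun α ω => (ξ α ω, (x α ω, y α ω))) P :=
    iIndepFun_prodMk h.ξ_meas (fun i => (h.x_meas i).prodMk (h.y_meas i)) h.ξ_indep h.xy_indep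
      h.ξ_xy_indep
  have h2 := h1.indepFun_finset (Finset.univ.erase α) {α} (by simp)
    fun i => (h.ξ_meas i).prodMk ((h.x_meas i).prodMk (h.y_meas i))
  have hφ : Measurable fun Z : (↥(Finset.univ.erase α) →
      ℝ × EuclideanSpace ℝ (Fin n) × EuclideanSpace ℝ (Fin n)) =>
      ∑ β, (Z β).1 • symProd (Z β).2.1 (Z β).2.2 :=
    measurable_sum_smul_symProd _ (fun i => measurable_fst.comp (measurable_pi_apply i))
      (fun i => measurable_fst.comp (measurable_snd.comp (measurable_pi_apply i)))
      (fun i => measurable_snd.comp (measurable_snd.comp (measurable_pi_apply i)))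
  have h3 := h2.comp hφ (measurable_pi_apply (⟨α, by simp⟩ : ({α} : Finset (Fin m))))
  refine h3.congr (ae_of_all _ fun ω => ?_) (ae_of_all _ fun ω => rfl)
  simp only [Function.comp_apply]
  rw [adjDel_eq_sum]
  exact Finset.sum_coe_sort (Finset.univ.erase α)
    fun β => ξ β ω • symProd (x β ω) (y β ω)

lemma abs_ξ_ae_eq (α : Fin m) : ∀ᵐ ω ∂P, |ξ α ω| = {ω | ξ α ω = 1}.indicator (fun _ => 1) ω := by
  filter_upwards [h.ξ_values α] with ω hω
  rcases hω with hω | hω <;> simp [hω]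

lemma integral_abs_ξ (α : Fin m) : ∫ ω, |ξ α ω| ∂P = p := by
  rw [integral_congr_ae (h.abs_ξ_ae_eq α), integral_indicator_const (s := {ω | ξ α ω = 1}) _
    (h.ξ_meas α (measurableSet_singleton 1)), h.ξ_prob]
  simp

lemma p_nonneg : 0 ≤ p := by
  rw [← h.ξ_prob ⟨0, h.m_pos⟩]
  exact measureReal_nonneg

lemma abs_ξ_le (α : Fin m) : ∀ᵐ ω ∂P, |ξ α ω| ≤ 1 := by
  filter_upwards [h.ξ_values α] with ω hω
  rcases hω with hω | hω <;> simp [hω]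

lemma integrable_abs_ξ (α : Fin m) : Integrable (fun ω => |ξ α ω|) P :=
  integrable_of_ae_bdd (h.ξ_meas α).abs 1 (by simpa using h.abs_ξ_le α)

/-- A function of the reduced matrix is independent of `ξ α`. -/
lemma integralLE_abs_ξ_mul (α : Fin m) {g : Matrix (Fin n) (Fin n) ℝ → ℝ} (hg : Measurable g)
    {C c : ℝ} (hC : ∀ X : Matrix (Fin n) (Fin n) ℝ, X.IsHermitian → |g X| ≤ C)
    (hc : ∫ ω, g (adjDel ξ x y α ω) ∂P ≤ c) :
    IntegralLE P (fun ω => |ξ α ω| * g (adjDel ξ x y α ω)) (p * c) := by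
  have h1 : IndepFun (fun ω => |ξ α ω|) (fun ω => g (adjDel ξ x y α ω)) P :=
    ((h.indepFun_adjDel α).comp hg (measurable_fst.abs)).symm
  have hm := hg.comp (h.measurable_adjDel α)
  constructor
  · refine integrable_of_ae_bdd ((h.ξ_meas α).abs.mul hm) C ?_
    filter_upwards [h.abs_ξ_le α] with ω hω
    rw [norm_mul, Real.norm_eq_abs, Real.norm_eq_abs, abs_abs]
    have h2 := hC _ (adjDel_isHermitian ξ x y α ω)
    calc _ ≤ 1 * |g (adjDel ξ x y α ω)| := by gcongr
      _ ≤ C := by rwa [one_mul]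
  · rw [h1.integral_fun_mul_eq_mul_integral (h.ξ_meas α).abs.aestronglyMeasurable
      hm.aestronglyMeasurable, h.integral_abs_ξ]
    exact mul_le_mul_of_nonneg_left hc h.p_nonneg

/-- The quadratic forms of the reduced resolvent concentrate at their conditional means. -/
lemma integralLE_abs_ξ_mul_norm_qf_sub (α : Fin m)
    {s t : EuclideanSpace ℝ (Fin n) × EuclideanSpace ℝ (Fin n) → EuclideanSpace ℝ (Fin n)}
    (hs : Measurable s) (ht : Measurable t)
    (hsb : ∀ᵐ ω ∂P, ‖s (x α ω, y α ω)‖ ^ 2 ≤ B) (htb : ∀ᵐ ω ∂P, ‖t (x α ω, y α ω)‖ ^ 2 ≤ B)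
    (hvar : ∀ D : Matrix (Fin n) (Fin n) ℝ, opNorm D ≤ 1 →
      variance (fun ω => bilin D (s (x α ω, y α ω)) (t (x α ω, y α ω))) P ≤ θ ^ 2)
    {z : ℂ} (hz : z.im ≠ 0) {L R : Matrix (Fin n) (Fin n) ℂ} (hLR : ‖L‖ * |z.im|⁻¹ * ‖R‖ ≤ 1) :
    IntegralLE P (fun ω => |ξ α ω| * ‖qf (L * res (adjDel ξ x y α ω) z * R)
        (s (x α ω, y α ω)) (t (x α ω, y α ω)) -
      (cmat (momentMatrix P (fun ω => s (x α ω, y α ω)) (fun ω => t (x α ω, y α ω))) *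
        (L * res (adjDel ξ x y α ω) z * R)).trace‖) (p * (2 * θ)) := by
  set Q := momentMatrix P (fun ω => s (x α ω, y α ω)) (fun ω => t (x α ω, y α ω))
  have hw : Measurable fun ω => (x α ω, y α ω) := (h.x_meas α).prodMk (h.y_meas α)
  have hZ : Measurable fun ω => (ξ α ω, (x α ω, y α ω)) := (h.ξ_meas α).prodMk hw
  set g : Matrix (Fin n) (Fin n) ℝ × ℝ × EuclideanSpace ℝ (Fin n) × EuclideanSpace ℝ (Fin n) → ℝ :=
    fun q => |q.2.1| * ‖qf (L * res q.1 z * R) (s q.2.2) (t q.2.2) -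
      (cmat Q * (L * res q.1 z * R)).trace‖ with hgdef
  have hg : Measurable g := by
    have hK : Measurable fun q : Matrix (Fin n) (Fin n) ℝ × ℝ × EuclideanSpace ℝ (Fin n) ×
        EuclideanSpace ℝ (Fin n) => L * res q.1 z * R :=
      (measurable_mul_res_mul z L R).comp measurable_fst
    have h2 : Measurable fun q : Matrix (Fin n) (Fin n) ℝ × ℝ × EuclideanSpace ℝ (Fin n) ×
        EuclideanSpace ℝ (Fin n) => q.2.2 := by fun_prop
    have h3 : Measurable fun q : Matrix (Fin n) (Fin n) ℝ × ℝ × EuclideanSpace ℝ (Fin n) ×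
        EuclideanSpace ℝ (Fin n) => |q.2.1| := by fun_prop
    exact h3.mul ((Measurable.qf hK (hs.comp h2) (ht.comp h2)).sub
      ((measurable_trace_mul _).comp hK)).norm
  have hK1 : ∀ X : Matrix (Fin n) (Fin n) ℝ, X.IsHermitian → ‖L * res X z * R‖ ≤ 1 := fun X hX => by
    refine le_trans ?_ hLR
    refine (norm_mul_le _ _).trans ?_
    gcongr
    refine (norm_mul_le _ _).trans ?_
    gcongr
    exact norm_res_le hX hz
  have hB : 0 ≤ B := zero_le_one.trans h.one_le_B
  have hbd : ∀ Y : Ω → Matrix (Fin n) (Fin n) ℝ, (∀ ω, (Y ω).IsHermitian) →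
      ∀ᵐ ω ∂P, ‖g (Y ω, ξ α ω, x α ω, y α ω)‖ ≤ 1 * (B + B) := fun Y hY => by
    filter_upwards [h.abs_ξ_le α, norm_qf_ae_le hsb htb fun ω => L * res (Y ω) z * R]
      with ω h1 h2
    rw [hgdef]
    simp only [norm_mul, Real.norm_eq_abs, abs_abs, abs_norm]
    gcongr
    refine (norm_sub_le _ _).trans (add_le_add ?_ ?_)
    · exact h2.trans (mul_le_of_le_one_right hB (hK1 _ (hY ω)))
    · exact (norm_trace_momentMatrix_mul_le (hs.comp hw) (ht.comp hw) hsb htb _).trans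
        (mul_le_of_le_one_right hB (hK1 _ (hY ω)))
  constructor
  · exact integrable_of_ae_bdd (hg.comp ((h.measurable_adjDel α).prodMk hZ)) _
      (hbd _ (adjDel_isHermitian ξ x y α))
  -- The reduced matrix is frozen at a value, which makes the test matrix deterministic. Then ξ_α,
  -- independent of the vectors, factors out and contributes p.
  refine IndepFun.integral_comp_le (h.indepFun_adjDel α) (h.measurable_adjDel α) hZ hg
    (fun q => by positivity) (mul_nonneg h.p_nonneg (by linarith [h.θ_pos])) (fun ω => ?_)
    fun ω => ?_
  · exact integrable_of_ae_bdd (hg.comp (measurable_const.prodMk hZ)) _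
      (hbd (fun _ => adjDel ξ x y α ω) fun _ => adjDel_isHermitian ξ x y α ω)
  · have hi : IndepFun (fun ω' => |ξ α ω'|) (fun ω' =>
        ‖qf (L * res (adjDel ξ x y α ω) z * R) (s (x α ω', y α ω')) (t (x α ω', y α ω')) -
        (cmat Q * (L * res (adjDel ξ x y α ω) z * R)).trace‖) P := by
      have h1 := h.ξ_xy_indep.comp (measurable_pi_apply α) (measurable_pi_apply α)
      refine h1.comp (φ := fun r : ℝ => |r|) (ψ := fun w =>
        ‖qf (L * res (adjDel ξ x y α ω) z * R) (s w) (t w) -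
        (cmat Q * (L * res (adjDel ξ x y α ω) z * R)).trace‖) (by fun_prop) ?_
      exact ((Measurable.qf measurable_const hs ht).sub measurable_const).norm
    simp only [hgdef]
    rw [hi.integral_fun_mul_eq_mul_integral (h.ξ_meas α).abs.aestronglyMeasurable
      ((Measurable.qf measurable_const (hs.comp hw) (ht.comp hw)).sub
        measurable_const).norm.aestronglyMeasurable, h.integral_abs_ξ]
    exact mul_le_mul_of_nonneg_left (integral_norm_qf_sub_trace_le (hs.comp hw) (ht.comp hw)
      hsb htb h.θ_pos hvar (hK1 _ (adjDel_isHermitian ξ x y α ω))) h.p_nonneg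

end

end RankTwoEnsemble

end

noncomputable section

set_option linter.unusedSectionVars false

open Matrix
open scoped Matrix.Norms.L2Operator

/-! ### Stability of the rank two formula, and trace functionals. -/

/-- Perturbation bound for the ratio in the rank two resolvent formula. -/
lemma norm_rank_two_ratio_add_le {a b c f t₁ t₂ T s₁ s₂ R : ℂ} {t : ℝ} (ha : ‖a‖ ≤ 1 / 64)
    (hb : ‖b‖ ≤ 1 / 64) (hc : ‖c‖ ≤ 1 / 64) (hf : ‖f‖ ≤ 1 / 64) (hs₁ : ‖s₁‖ ≤ t)
    (hs₂ : ‖s₂‖ ≤ t) (ht : t ≤ 1 / 64)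
    (hR : R * ((1 + c) ^ 2 - a * b) = (1 + c) * T - b * t₁ - a * t₂) :
    ‖R + f * (s₁ + s₂) / (1 - f ^ 2)‖ ≤
      4 * (‖c‖ + ‖T‖ + ‖t₁ - s₁‖ + ‖t₂ - s₂‖) + 4 * t * (‖a - f‖ + ‖b - f‖) := by
  have ht0 : 0 ≤ t := (norm_nonneg _).trans hs₁
  set D := (1 + c) ^ 2 - a * b with hD
  set E := 1 - f ^ 2 with hE
  have hff : ‖f ^ 2‖ ≤ 1 / 4096 := by
    rw [norm_pow]; nlinarith [norm_nonneg f]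
  have hEl : 4095 / 4096 ≤ ‖E‖ := by
    have := norm_sub_norm_le (1 : ℂ) (f ^ 2)
    rw [norm_one] at this; linarith
  have hEu : ‖E‖ ≤ 4097 / 4096 := by
    have := norm_sub_le (1 : ℂ) (f ^ 2)
    rw [norm_one] at this; linarith
  have hab : ‖a * b‖ ≤ 1 / 4096 := by
    rw [norm_mul]; nlinarith [norm_nonneg a, norm_nonneg b]
  have hc1 : ‖2 * c + c ^ 2‖ ≤ 3 * ‖c‖ := by
    refine (norm_add_le _ _).trans ?_
    rw [norm_mul, norm_pow, Complex.norm_ofNat]; nlinarith [norm_nonneg c]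
  have hDl : 9 / 10 ≤ ‖D‖ := by
    have h1 : D = 1 - (a * b - (2 * c + c ^ 2)) := by rw [hD]; ring
    have h2 := norm_sub_norm_le (1 : ℂ) (a * b - (2 * c + c ^ 2))
    have h3 := norm_sub_le (a * b) (2 * c + c ^ 2)
    rw [norm_one, ← h1] at h2; linarith
  have hE0 : E ≠ 0 := norm_pos_iff.1 (by linarith)
  have hD0 : D ≠ 0 := norm_pos_iff.1 (by linarith)
  -- At the limiting values a = b = f, c = T = 0, tᵢ = sᵢ, the formula gives R = -f(s₁ + s₂)/(1 -
  -- f²). After clearing denominators, every term on the right contains c, T or one of the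
  -- differences.
  have hN : (R + f * (s₁ + s₂) / E) * (D * E) = E * (1 + c) * T - E * b * (t₁ - s₁)
      - E * a * (t₂ - s₂) - s₁ * ((b - f) + b * f * (a - f) - f * (2 * c + c ^ 2))
      - s₂ * ((a - f) + a * f * (b - f) - f * (2 * c + c ^ 2)) := by
    have h1 : (R + f * (s₁ + s₂) / E) * (D * E) = (R * D) * E + f * (s₁ + s₂) * D := by
      field_simp
    rw [h1, hR, hD, hE]; ring
  have key : ∀ u w : ℂ, ‖u‖ ≤ 1 / 64 → ∀ s : ℂ, ‖s‖ ≤ t →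
      ‖s * ((u - f) + u * f * (w - f) - f * (2 * c + c ^ 2))‖ ≤
        t * (‖u - f‖ + ‖w - f‖ / 4096 + ‖c‖ / 16) := fun u w hu s hs => by
    rw [norm_mul]
    have h1 : ‖u * f * (w - f)‖ ≤ ‖w - f‖ / 4096 := by
      rw [norm_mul, norm_mul]
      have : ‖u‖ * ‖f‖ ≤ 1 / 4096 := by nlinarith [norm_nonneg u, norm_nonneg f]
      nlinarith [norm_nonneg (w - f)]
    have h2 : ‖f * (2 * c + c ^ 2)‖ ≤ ‖c‖ / 16 := by
      rw [norm_mul]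
      calc _ ≤ 1 / 64 * (3 * ‖c‖) := by gcongr
        _ ≤ _ := by linarith [norm_nonneg c]
    gcongr
    calc _ ≤ ‖u - f‖ + ‖u * f * (w - f)‖ + ‖f * (2 * c + c ^ 2)‖ :=
          (norm_sub_le _ _).trans (add_le_add (norm_add_le _ _) le_rfl)
      _ ≤ _ := by linarith
  have k1 := key b a hb s₁ hs₁
  have k2 := key a b ha s₂ hs₂
  have k3 : ‖E * (1 + c) * T‖ ≤ 2 * ‖T‖ := by
    rw [norm_mul, norm_mul]
    have h1 : ‖1 + c‖ ≤ 65 / 64 := by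
      have := norm_add_le (1 : ℂ) c
      rw [norm_one] at this; linarith
    have h2 : ‖E‖ * ‖1 + c‖ ≤ 2 := by
      nlinarith [norm_nonneg E, norm_nonneg (1 + c)]
    gcongr
  have k4 : ∀ u r : ℂ, ‖u‖ ≤ 1 / 64 → ‖E * u * r‖ ≤ ‖r‖ := fun u r hu => by
    rw [norm_mul, norm_mul]
    have h2 : ‖E‖ * ‖u‖ ≤ 1 := by nlinarith [norm_nonneg E, norm_nonneg u]
    exact mul_le_of_le_one_left (norm_nonneg _) h2
  have k5 := k4 b (t₁ - s₁) hb
  have k6 := k4 a (t₂ - s₂) ha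
  have hNn : ‖(R + f * (s₁ + s₂) / E) * (D * E)‖ ≤ 2 * ‖T‖ + ‖t₁ - s₁‖ + ‖t₂ - s₂‖
      + t * (‖b - f‖ + ‖a - f‖ / 4096 + ‖c‖ / 16) + t * (‖a - f‖ + ‖b - f‖ / 4096 + ‖c‖ / 16) := by
    rw [hN]
    refine (norm_sub_le _ _).trans (add_le_add ((norm_sub_le _ _).trans (add_le_add
      ((norm_sub_le _ _).trans (add_le_add ((norm_sub_le _ _).trans (add_le_add k3 k5)) k6)) k1)) k2)
  rw [norm_mul, norm_mul] at hNn
  have hDE : 1 / 2 ≤ ‖D‖ * ‖E‖ := by nlinarith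
  have h1 : ‖R + f * (s₁ + s₂) / E‖ * (1 / 2) ≤ ‖R + f * (s₁ + s₂) / E‖ * (‖D‖ * ‖E‖) := by gcongr
  have h2 : t * ‖c‖ ≤ 1 / 64 * ‖c‖ := by gcongr
  have h3 : 0 ≤ t * ‖a - f‖ := by positivity
  have h4 : 0 ≤ t * ‖b - f‖ := by positivity
  nlinarith [norm_nonneg T, norm_nonneg c, norm_nonneg (t₁ - s₁), norm_nonneg (t₂ - s₂)]

variable {n m : ℕ}

/-- The trace functional `Tr Q L (X - z)⁻¹ R` of the resolvent. -/
def rtr (Q : Matrix (Fin n) (Fin n) ℝ) (z : ℂ) (L R : Matrix (Fin n) (Fin n) ℂ)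
    (X : Matrix (Fin n) (Fin n) ℝ) : ℂ :=
  (cmat Q * (L * res X z * R)).trace

/-- The normalized trace of the resolvent. -/
def ntr (z : ℂ) (R : Matrix (Fin n) (Fin n) ℂ) (X : Matrix (Fin n) (Fin n) ℝ) : ℂ :=
  (n : ℂ)⁻¹ * (res X z * R).trace

lemma measurable_rtr (Q : Matrix (Fin n) (Fin n) ℝ) (z : ℂ) (L R : Matrix (Fin n) (Fin n) ℂ) :
    Measurable (rtr Q z L R) :=
  (measurable_trace_mul (cmat Q)).comp (measurable_mul_res_mul z L R)

lemma ntr_eq_rtr (z : ℂ) (R : Matrix (Fin n) (Fin n) ℂ) (X : Matrix (Fin n) (Fin n) ℝ) :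
    ntr z R X = rtr ((n : ℝ)⁻¹ • 1) z 1 R X := by
  simp [ntr, rtr, cmat_smul, cmat_one]

lemma measurable_ntr (z : ℂ) (R : Matrix (Fin n) (Fin n) ℂ) : Measurable (ntr (n := n) z R) := by
  rw [funext (ntr_eq_rtr z R)]
  exact measurable_rtr _ _ _ _

lemma norm_mul_res_mul_le {X : Matrix (Fin n) (Fin n) ℝ} (hX : X.IsHermitian) {z : ℂ}
    (hz : z.im ≠ 0) (L R : Matrix (Fin n) (Fin n) ℂ) :
    ‖L * res X z * R‖ ≤ ‖L‖ * |z.im|⁻¹ * ‖R‖ := by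
  refine (norm_mul_le _ _).trans ?_
  gcongr
  refine (norm_mul_le _ _).trans ?_
  gcongr
  exact norm_res_le hX hz

lemma norm_ntr_le (hn : 0 < n) {X : Matrix (Fin n) (Fin n) ℝ} (hX : X.IsHermitian) {z : ℂ}
    (hz : z.im ≠ 0) (R : Matrix (Fin n) (Fin n) ℂ) : ‖ntr z R X‖ ≤ |z.im|⁻¹ * ‖R‖ := by
  have hn' : (0 : ℝ) < n := by exact_mod_cast hn
  rw [ntr, norm_mul, norm_inv, Complex.norm_natCast]
  calc _ ≤ (n : ℝ)⁻¹ * (n * (|z.im|⁻¹ * ‖R‖)) := by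
        gcongr
        refine (norm_trace_le _).trans ?_
        gcongr
        refine (norm_mul_le _ _).trans ?_
        gcongr
        exact norm_res_le hX hz
    _ = _ := by field_simp

lemma opNorm_inv_smul_one_le : opNorm ((n : ℝ)⁻¹ • (1 : Matrix (Fin n) (Fin n) ℝ)) ≤ (n : ℝ)⁻¹ := by
  refine opNorm_le_of_bilin (by positivity) fun u v => ?_
  rw [bilin, map_smul, map_one]
  simp only [_root_.smul_apply, one_apply_eq_self]
  rw [real_inner_smul_left, abs_mul, abs_of_nonneg (by positivity : (0 : ℝ) ≤ (n : ℝ)⁻¹), mul_assoc]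
  gcongr
  exact abs_real_inner_le_norm u v

lemma norm_trace_mul_le_sum (Q : Matrix (Fin n) (Fin n) ℝ) (K : Matrix (Fin n) (Fin n) ℂ) :
    ‖(cmat Q * K).trace‖ ≤ ∑ i, ∑ j, |Q i j| * ‖K j i‖ := by
  simp only [Matrix.trace, Matrix.diag_apply, Matrix.mul_apply]
  refine (norm_sum_le _ _).trans (Finset.sum_le_sum fun i _ => ?_)
  refine (norm_sum_le _ _).trans (Finset.sum_le_sum fun j _ => ?_)
  rw [norm_mul, cmat_apply, Complex.norm_real, Real.norm_eq_abs]

lemma sum_sq_le_of_opNorm_le {Q : Matrix (Fin n) (Fin n) ℝ} {c : ℝ} (h : opNorm Q ≤ c) :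
    ∑ i, ∑ j, Q i j ^ 2 ≤ n * c ^ 2 := by
  have h1 := sum_norm_sq_le (cmat Q)
  simp only [cmat_apply, Complex.norm_real, Real.norm_eq_abs, sq_abs] at h1
  refine h1.trans ?_
  gcongr
  exact (norm_cmat_le Q).trans h

/-- A family of matrices with small averaged entries has small averaged traces. -/
lemma sum_norm_trace_le (hm : 0 < m) (Q : Fin m → Matrix (Fin n) (Fin n) ℝ)
    {K : Matrix (Fin n) (Fin n) ℂ} (hK : ‖K‖ ≤ 1) {κ : ℝ}
    (h : Real.sqrt n * hsNorm (Matrix.of fun i j => (1 / (m : ℝ)) * ∑ α, |Q α i j|) ≤ κ) :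
    ∑ α, ‖(cmat (Q α) * K).trace‖ ≤ m * κ := by
  have hm' : (0 : ℝ) < m := by exact_mod_cast hm
  set M : Fin n → Fin n → ℝ := fun i j => (1 / (m : ℝ)) * ∑ α, |Q α i j| with hM
  have h1 : ∑ α, ‖(cmat (Q α) * K).trace‖ ≤ m * ∑ i, ∑ j, M i j * ‖K j i‖ := by
    calc _ ≤ ∑ α, ∑ i, ∑ j, |Q α i j| * ‖K j i‖ :=
          Finset.sum_le_sum fun α _ => norm_trace_mul_le_sum _ _
      _ = ∑ i, ∑ j, ∑ α, |Q α i j| * ‖K j i‖ := by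
        rw [Finset.sum_comm]
        exact Finset.sum_congr rfl fun i _ => Finset.sum_comm
      _ = _ := by
        simp only [Finset.mul_sum]
        refine Finset.sum_congr rfl fun i _ => Finset.sum_congr rfl fun j _ => ?_
        rw [hM, ← Finset.sum_mul]
        field_simp
  -- Cauchy–Schwarz over pairs of indices. The Hilbert–Schmidt norm of K is at most √n, which the
  -- rate o(n^{-1/2}) of the cross moments is meant to beat.
  have h2 : ∑ i, ∑ j, M i j * ‖K j i‖ ≤ Real.sqrt (∑ i, ∑ j, M i j ^ 2) * Real.sqrt n := by
    have h3 := Real.sum_mul_le_sqrt_mul_sqrt Finset.univ (fun q : Fin n × Fin n => M q.1 q.2)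
      fun q => ‖K q.2 q.1‖
    simp only [Fintype.sum_prod_type] at h3
    refine h3.trans ?_
    gcongr
    rw [Finset.sum_comm]
    refine (sum_norm_sq_le K).trans (mul_le_of_le_one_right (by positivity) ?_)
    exact pow_le_one₀ (norm_nonneg _) hK
  refine h1.trans ?_
  gcongr
  refine h2.trans ?_
  rw [mul_comm]
  exact h

/-! ### Removal of one term, and fluctuations of the Bernoulli sums. -/

namespace RankTwoEnsemble

variable {Ω : Type*} [MeasurableSpace Ω] {P : Measure Ω} [IsProbabilityMeasure P]
  {ξ : Fin m → Ω → ℝ} {x y : Fin m → Ω → EuclideanSpace ℝ (Fin n)} {p B θ τ κ : ℝ}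

section

variable (h : RankTwoEnsemble P ξ x y p B θ τ κ)
include h

/-- The height 64B³ makes quadratic forms of resolvents at most 1/64, traces against moment matrices
at most 1/(64B), and the effect of removing one term at most 1/n. -/
lemma im_bounds {z : ℂ} (hz : 64 * B ^ 3 ≤ z.im) :
    z.im ≠ 0 ∧ |z.im| = z.im ∧ B * |z.im|⁻¹ * B ≤ 1 / (64 * B) ∧ |z.im|⁻¹ ≤ 1 / 64 ∧
      B * |z.im|⁻¹ ≤ 1 / 64 ∧ 2 * B ^ 3 * |z.im|⁻¹ ^ 2 ≤ 1 := by
  have hB := h.one_le_B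
  have h3 : 1 ≤ B ^ 3 := one_le_pow₀ hB
  have h2 : 1 ≤ B ^ 2 := one_le_pow₀ hB
  have hv : 0 < z.im := by linarith
  have h64 : 64 ≤ z.im := by linarith
  have hi : z.im⁻¹ ≤ 1 / 64 := by rw [inv_eq_one_div]; gcongr
  have hi0 : 0 < z.im⁻¹ := inv_pos.2 hv
  rw [abs_of_pos hv]
  refine ⟨hv.ne', rfl, ?_, hi, ?_, ?_⟩
  · rw [show B * z.im⁻¹ * B = B ^ 2 / z.im by ring, div_le_div_iff₀ hv (by positivity)]
    nlinarith
  · rw [← div_eq_mul_inv, div_le_div_iff₀ hv (by positivity)]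
    nlinarith
  · have : B ^ 3 * z.im⁻¹ ≤ 1 / 64 := by
      rw [← div_eq_mul_inv, div_le_div_iff₀ hv (by positivity)]; linarith
    nlinarith

/-- Stability of trace functionals under removal of a term. -/
lemma norm_rtr_adj_sub_le {z : ℂ} (hz : 64 * B ^ 3 ≤ z.im) {Q : Matrix (Fin n) (Fin n) ℝ}
    (hQ : opNorm Q ≤ B / n) {L R : Matrix (Fin n) (Fin n) ℂ} (hLR : ‖L‖ * ‖R‖ ≤ B) (α : Fin m) :
    ∀ᵐ ω ∂P, ‖rtr Q z L R (adjDel ξ x y α ω) - rtr Q z L R (adj ξ x y ω)‖ ≤ 1 / n := by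
  obtain ⟨hz0, -, -, -, -, hz2⟩ := h.im_bounds hz
  have hB := h.one_le_B
  filter_upwards [h.ξ_values α, h.x_bdd α, h.y_bdd α] with ω h1 h2 h3
  have h4 := adj_eq_adjDel_add ξ x y α ω
  rcases h1 with h1 | h1
  · rw [h1, zero_smul, add_zero] at h4
    rw [h4, sub_self, norm_zero]; positivity
  · rw [h1, one_smul] at h4
    have h5 := norm_trace_mul_res_sub_le (adjDel_isHermitian ξ x y α ω) (adj_isHermitian ξ x y ω)
      h4 hz0 (cmat Q) L R
    have h6 : ‖x α ω‖ * ‖y α ω‖ ≤ B := by nlinarith [sq_nonneg (‖x α ω‖ - ‖y α ω‖)]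
    refine h5.trans ?_
    calc _ = 2 * (‖x α ω‖ * ‖y α ω‖) * |z.im|⁻¹ ^ 2 * (‖L‖ * ‖R‖) * ‖cmat Q‖ := by ring
      _ ≤ 2 * B * |z.im|⁻¹ ^ 2 * B * (B / n) := by
        gcongr
        exact (norm_cmat_le Q).trans hQ
      _ = (2 * B ^ 3 * |z.im|⁻¹ ^ 2) * (1 / n) := by ring
      _ ≤ _ := mul_le_of_le_one_left (by positivity) hz2

lemma norm_ntr_adj_sub_le {z : ℂ} (hz : 64 * B ^ 3 ≤ z.im) {R : Matrix (Fin n) (Fin n) ℂ}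
    (hR : ‖R‖ ≤ B) (α : Fin m) :
    ∀ᵐ ω ∂P, ‖ntr z R (adjDel ξ x y α ω) - ntr z R (adj ξ x y ω)‖ ≤ 1 / n := by
  simp only [ntr_eq_rtr]
  refine h.norm_rtr_adj_sub_le hz (opNorm_inv_smul_one_le.trans ?_) ?_ α
  · rw [inv_eq_one_div]; gcongr; exact h.one_le_B
  · calc _ ≤ 1 * B := by gcongr; exact norm_one_le
      _ = B := one_mul B

lemma integral_ξ (α : Fin m) : ∫ ω, ξ α ω ∂P = p := by
  rw [← h.integral_abs_ξ α]
  refine integral_congr_ae ?_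
  filter_upwards [h.ξ_values α] with ω hω
  rcases hω with hω | hω <;> simp [hω]

lemma memLp_ξ (α : Fin m) : MemLp (ξ α) 2 P :=
  MemLp.of_bound (h.ξ_meas α).aestronglyMeasurable 1 (by simpa using h.abs_ξ_le α)

lemma variance_ξ_le (α : Fin m) : variance (ξ α) P ≤ p := by
  refine (variance_le_expectation_sq (h.ξ_meas α).aestronglyMeasurable).trans ?_
  rw [← h.integral_ξ α]
  refine le_of_eq (integral_congr_ae ?_)
  filter_upwards [h.ξ_values α] with ω hω
  rcases hω with hω | hω <;> simp [hω]

/-- The Hilbert-Schmidt norm of the fluctuation of `∑ α, ξ α • S α`. -/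
lemma integralLE_sum_sq {S : Fin m → Matrix (Fin n) (Fin n) ℝ} (hS : ∀ α, opNorm (S α) ≤ B / n) :
    IntegralLE P (fun ω => ∑ i, ∑ j, (∑ α, (ξ α ω - p) * S α i j) ^ 2) (B ^ 3) := by
  have hn : (0 : ℝ) < n := by exact_mod_cast h.n_pos
  have h1 : ∀ i j, IntegralLE P (fun ω => (∑ α, (ξ α ω - p) * S α i j) ^ 2)
      (∑ α, p * S α i j ^ 2) := fun i j => by
    have hL : ∀ α ∈ (Finset.univ : Finset (Fin m)), MemLp (fun ω => S α i j * ξ α ω) 2 P :=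
      fun α _ => (h.memLp_ξ α).const_mul _
    have hi : ∀ α, Integrable (ξ α) P := fun α => (h.memLp_ξ α).integrable one_le_two
    have hL' : MemLp (fun ω => ∑ α, S α i j * ξ α ω) 2 P := memLp_finsetSum _ hL
    have hmean : ∫ ω, ∑ α, S α i j * ξ α ω ∂P = ∑ α, S α i j * p := by
      rw [integral_finsetSum _ fun α _ => (hi α).const_mul _]
      simp only [integral_const_mul, h.integral_ξ]
    have heq : ∀ ω, (∑ α, (ξ α ω - p) * S α i j) = (∑ α, S α i j * ξ α ω) - ∑ α, S α i j * p :=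
      fun ω => by
        rw [← Finset.sum_sub_distrib]
        exact Finset.sum_congr rfl fun α _ => by ring
    -- Entrywise, the square is centred, so its mean is the variance of a sum of independent
    -- variables.
    have hv := IndepFun.variance_sum hL fun α _ β _ hαβ =>
      (h.ξ_indep.indepFun hαβ).comp (φ := fun r => S α i j * r) (ψ := fun r => S β i j * r)
        (by fun_prop) (by fun_prop)
    have hfun : (∑ α, fun ω => S α i j * ξ α ω) = fun ω => ∑ α, S α i j * ξ α ω := by
      ext ω; simp
    rw [hfun, variance_eq_integral hL'.aestronglyMeasurable.aemeasurable, hmean] at hv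
    constructor
    · simp only [heq]
      exact (hL'.sub (memLp_const _)).integrable_sq
    · simp only [heq]
      rw [hv]
      refine Finset.sum_le_sum fun α _ => ?_
      rw [variance_const_mul, mul_comm]
      gcongr
      exact h.variance_ξ_le α
  refine (IntegralLE.sum fun i _ => IntegralLE.sum fun j _ => h1 i j).mono ?_
  -- Each S_α has squared Hilbert–Schmidt norm at most B²/n, so the total is at most (mp/n)B².
  calc ∑ i, ∑ j, ∑ α, p * S α i j ^ 2 = ∑ α, p * ∑ i, ∑ j, S α i j ^ 2 := by
        simp only [Finset.mul_sum]
        rw [Finset.sum_congr rfl fun i _ => Finset.sum_comm, Finset.sum_comm]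
    _ ≤ ∑ _α : Fin m, p * (n * (B / n) ^ 2) := Finset.sum_le_sum fun α _ =>
        mul_le_mul_of_nonneg_left (sum_sq_le_of_opNorm_le (hS α)) h.p_nonneg
    _ = (m / n * p) * B ^ 2 := by
        simp only [Finset.sum_const, Finset.card_univ, Fintype.card_fin, nsmul_eq_mul]
        field_simp
    _ ≤ B * B ^ 2 := by gcongr; exact h.mp_le
    _ = _ := by ring

end

end RankTwoEnsemble

end

noncomputable section

set_option linter.unusedSectionVars false

open Matrix
open scoped Matrix.Norms.L2Operator

lemma IntegralLE.congr {Ω : Type*} [MeasurableSpace Ω] {P : Measure Ω} {f g : Ω → ℝ} {c : ℝ}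
    (hf : IntegralLE P f c) (h : ∀ ω, g ω = f ω) : IntegralLE P g c := by
  rwa [funext h]

variable {n m : ℕ}

/-! ### Averaging over the index, and the contribution of one term. -/

lemma trace_cmat_mul (Q : Matrix (Fin n) (Fin n) ℝ) (K : Matrix (Fin n) (Fin n) ℂ) :
    (cmat Q * K).trace = ((Q * K.map Complex.re).trace : ℂ)
      + ((Q * K.map Complex.im).trace : ℂ) * Complex.I := by
  simp only [Matrix.trace, Matrix.diag_apply, Matrix.mul_apply, Matrix.map_apply,
    Complex.ofReal_sum, Complex.ofReal_mul, Finset.sum_mul, ← Finset.sum_add_distrib, cmat_apply]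
  refine Finset.sum_congr rfl fun i _ => Finset.sum_congr rfl fun j _ => ?_
  conv_lhs => rw [← Complex.re_add_im (K j i)]
  ring

/-- The deviation of a quadratic form of the resolvent from its conditional mean. -/
def dev (Q : Matrix (Fin n) (Fin n) ℝ) (z : ℂ) (L R : Matrix (Fin n) (Fin n) ℂ)
    (u v : EuclideanSpace ℝ (Fin n)) (X : Matrix (Fin n) (Fin n) ℝ) : ℝ :=
  ‖qf (L * res X z * R) u v - rtr Q z L R X‖

namespace RankTwoEnsemble

variable {Ω : Type*} [MeasurableSpace Ω] {P : Measure Ω} [IsProbabilityMeasure P]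
  {ξ : Fin m → Ω → ℝ} {x y : Fin m → Ω → EuclideanSpace ℝ (Fin n)} {p B θ τ κ : ℝ}

section

variable (h : RankTwoEnsemble P ξ x y p B θ τ κ)
include h

lemma τ_nonneg : 0 ≤ τ := (abs_nonneg _).trans (h.trace_x ⟨0, h.m_pos⟩)

lemma κ_nonneg : 0 ≤ κ :=
  (mul_nonneg (Real.sqrt_nonneg _) (Real.sqrt_nonneg _)).trans h.cross

/-- This is the factorization hypothesis with K₂ = 1, extended to complex matrices by linearity. The
weights Tr Q^{yα} are close to 1, so the Q^{xα} average approximately to a multiple of the identity.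
-/
lemma sum_trace_mul_factor_x (K : Matrix (Fin n) (Fin n) ℂ) :
    ∑ α, ((momentMatrix P (y α) (y α)).trace : ℂ) * (cmat (momentMatrix P (x α) (x α)) * K).trace
      = (m : ℂ) / n * K.trace := by
  have hn : (n : ℂ) ≠ 0 := by exact_mod_cast h.n_pos.ne'
  have hm : (m : ℂ) ≠ 0 := by exact_mod_cast h.m_pos.ne'
  have hr : ∀ K : Matrix (Fin n) (Fin n) ℝ, ∑ α, ((momentMatrix P (y α) (y α)).trace : ℂ) *
      ((momentMatrix P (x α) (x α) * K).trace : ℂ) = (m : ℂ) / n * K.trace := fun K => by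
    have h1 := congrArg (fun r : ℝ => (r : ℂ)) (h.factor K 1)
    simp only [Matrix.mul_one, Matrix.trace_one, Fintype.card_fin] at h1
    push_cast at h1
    rw [one_div_mul_cancel hn] at h1
    simp only [mul_comm ((momentMatrix P (y _) (y _)).trace : ℂ)]
    field_simp at h1 ⊢
    linear_combination h1
  have hK : K.trace = ((K.map Complex.re).trace : ℂ) + ((K.map Complex.im).trace : ℂ) * Complex.I := by
    have := trace_cmat_mul 1 K
    simpa [cmat_one] using this
  simp only [trace_cmat_mul _ K, mul_add, ← mul_assoc, Finset.sum_add_distrib, ← Finset.sum_mul, hr]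
  rw [hK]; ring

lemma sum_trace_mul_factor_y (K : Matrix (Fin n) (Fin n) ℂ) :
    ∑ α, ((momentMatrix P (x α) (x α)).trace : ℂ) * (cmat (momentMatrix P (y α) (y α)) * K).trace
      = (m : ℂ) / n * K.trace := by
  have hn : (n : ℂ) ≠ 0 := by exact_mod_cast h.n_pos.ne'
  have hm : (m : ℂ) ≠ 0 := by exact_mod_cast h.m_pos.ne'
  have hr : ∀ K : Matrix (Fin n) (Fin n) ℝ, ∑ α, ((momentMatrix P (x α) (x α)).trace : ℂ) *
      ((momentMatrix P (y α) (y α) * K).trace : ℂ) = (m : ℂ) / n * K.trace := fun K => by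
    have h1 := congrArg (fun r : ℝ => (r : ℂ)) (h.factor 1 K)
    simp only [Matrix.mul_one, Matrix.trace_one, Fintype.card_fin] at h1
    push_cast at h1
    rw [one_div_mul_cancel hn] at h1
    field_simp at h1 ⊢
    linear_combination h1
  have hK : K.trace = ((K.map Complex.re).trace : ℂ) + ((K.map Complex.im).trace : ℂ) * Complex.I := by
    have := trace_cmat_mul 1 K
    simpa [cmat_one] using this
  simp only [trace_cmat_mul _ K, mul_add, ← mul_assoc, Finset.sum_add_distrib, ← Finset.sum_mul, hr]
  rw [hK]; ring

/-- The average `(1 / n) ∑ α, ξ α Tr (S α) G H` is close to `c₁ (1 / n) Tr G H`. -/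
lemma integralLE_norm_sum_ξ_rtr_sub {S : Fin m → Matrix (Fin n) (Fin n) ℝ}
    (hS : ∀ α, opNorm (S α) ≤ B / n)
    (hSB : ∀ α (K : Matrix (Fin n) (Fin n) ℂ), ‖(cmat (S α) * K).trace‖ ≤ B * ‖K‖)
    {r : Fin m → ℝ} (hr : ∀ α, |r α - 1| ≤ τ)
    (hSr : ∀ K : Matrix (Fin n) (Fin n) ℂ,
      ∑ α, (r α : ℂ) * (cmat (S α) * K).trace = (m : ℂ) / n * K.trace)
    {z : ℂ} (hz : 64 * B ^ 3 ≤ z.im) {H : Matrix (Fin n) (Fin n) ℂ} (hH : ‖H‖ ≤ B) (c₁ : ℝ) :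
    IntegralLE P (fun ω => ‖(n : ℂ)⁻¹ * ∑ α, (ξ α ω : ℂ) * rtr (S α) z 1 H (adj ξ x y ω)
        - c₁ * ntr z H (adj ξ x y ω)‖)
      (B ^ 3 / Real.sqrt n + B ^ 2 * τ + |(m : ℝ) / n * p - c₁|) := by
  obtain ⟨hz0, -, -, hz1, hz2, -⟩ := h.im_bounds hz
  have hn : (0 : ℝ) < n := by exact_mod_cast h.n_pos
  have hB := h.one_le_B
  have hs : 0 < Real.sqrt n := Real.sqrt_pos.2 hn
  have hss : Real.sqrt n * Real.sqrt n = n := Real.mul_self_sqrt hn.le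
  have hp := h.p_nonneg
  have hτ := h.τ_nonneg
  have hA := h.measurable_adj
  have h1 := ((h.integralLE_sum_sq hS).const_mul
    (a := 1 / (2 * Real.sqrt n)) (by positivity)).add
    (IntegralLE.const (P := P) (1 / (2 * Real.sqrt n) + B ^ 2 * τ + |(m : ℝ) / n * p - c₁|))
  refine IntegralLE.mono (IntegralLE.of_le h1 ?_ (ae_of_all _ fun ω => norm_nonneg _)
    (ae_of_all _ fun ω => ?_)) ?_
  · refine (Measurable.norm (Measurable.sub (measurable_const.mul
      (Finset.measurable_sum _ fun α _ => ?_)) (measurable_const.mul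
        ((measurable_ntr z H).comp hA)))).aestronglyMeasurable
    exact (Complex.measurable_ofReal.comp (h.ξ_meas α)).mul ((measurable_rtr _ z 1 H).comp hA)
  · set K := 1 * res (adj ξ x y ω) z * H with hKdef
    have hK : ‖K‖ ≤ 1 := by
      refine (norm_mul_res_mul_le (adj_isHermitian ξ x y ω) hz0 1 H).trans ?_
      calc _ ≤ 1 * |z.im|⁻¹ * B := by gcongr; exact norm_one_le
        _ ≤ 1 := by linarith
    have e0 : ntr z H (adj ξ x y ω) = (n : ℂ)⁻¹ * K.trace := by
      rw [ntr, hKdef, Matrix.one_mul]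
    -- Three errors are separated: the fluctuation of ξ_α around p, the deviation of the weights r_α
    -- from 1, and the deviation of mp/n from c₁.
    have e1 : (n : ℂ)⁻¹ * ∑ α, (ξ α ω : ℂ) * rtr (S α) z 1 H (adj ξ x y ω)
        - c₁ * ntr z H (adj ξ x y ω) =
        (n : ℂ)⁻¹ * ∑ α, ((ξ α ω - p : ℝ) : ℂ) * (cmat (S α) * K).trace
        - (p : ℂ) / n * ∑ α, ((r α - 1 : ℝ) : ℂ) * (cmat (S α) * K).trace
        + (((m : ℝ) / n * p - c₁ : ℝ) : ℂ) * ((n : ℂ)⁻¹ * K.trace) := by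
      rw [e0]
      simp only [rtr, ← hKdef]
      push_cast
      simp only [sub_mul, Finset.sum_sub_distrib, hSr, one_mul, ← Finset.mul_sum]
      ring
    have b1 : ‖(n : ℂ)⁻¹ * ∑ α, ((ξ α ω - p : ℝ) : ℂ) * (cmat (S α) * K).trace‖ ≤
        1 / (2 * Real.sqrt n) * (∑ i, ∑ j, (∑ α, (ξ α ω - p) * S α i j) ^ 2)
          + 1 / (2 * Real.sqrt n) := by
      have c1 : ∑ α, ((ξ α ω - p : ℝ) : ℂ) * (cmat (S α) * K).trace =
          (cmat (∑ α, (ξ α ω - p) • S α) * K).trace := by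
        have : cmat (∑ α, (ξ α ω - p) • S α) = ∑ α, ((ξ α ω - p : ℝ) : ℂ) • cmat (S α) := by
          ext i j; simp [cmat_apply, Matrix.sum_apply]
        rw [this, Matrix.sum_mul, Matrix.trace_sum]
        simp only [Matrix.smul_mul, Matrix.trace_smul, smul_eq_mul]
      rw [c1, norm_mul, norm_inv, Complex.norm_natCast]
      have c2 := norm_trace_mul_le_sum (∑ α, (ξ α ω - p) • S α) K
      simp only [Matrix.sum_apply, Matrix.smul_apply, smul_eq_mul] at c2
      set D : Fin n → Fin n → ℝ := fun i j => ∑ α, (ξ α ω - p) * S α i j with hD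
      -- K is built from the full resolvent and depends on the ξ_α, so the bound must hold for all K
      -- with ‖K‖ ≤ 1 at once. The arithmetic–geometric mean inequality with weight √n balances the
      -- bounded mean of ‖D‖²_HS against ‖K‖²_HS ≤ n.
      have c3 : ∑ i, ∑ j, |D i j| * ‖K j i‖ ≤
          ∑ i, ∑ j, (Real.sqrt n / 2 * D i j ^ 2 + 1 / (2 * Real.sqrt n) * ‖K j i‖ ^ 2) := by
        refine Finset.sum_le_sum fun i _ => Finset.sum_le_sum fun j _ => ?_
        have := sq_nonneg (Real.sqrt n * |D i j| - ‖K j i‖)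
        rw [← sq_abs (D i j)]
        have e : Real.sqrt n / 2 * |D i j| ^ 2 + 1 / (2 * Real.sqrt n) * ‖K j i‖ ^ 2
            = (Real.sqrt n * Real.sqrt n * |D i j| ^ 2 + ‖K j i‖ ^ 2) / (2 * Real.sqrt n) := by
          field_simp
        rw [e, le_div_iff₀ (by positivity)]
        nlinarith
      have c4 : ∑ i, ∑ j, ‖K j i‖ ^ 2 ≤ n := by
        rw [Finset.sum_comm]
        refine (sum_norm_sq_le K).trans (mul_le_of_le_one_right hn.le ?_)
        exact pow_le_one₀ (norm_nonneg _) hK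
      simp only [Finset.sum_add_distrib, ← Finset.mul_sum] at c3
      calc _ ≤ (n : ℝ)⁻¹ * (Real.sqrt n / 2 * ∑ i, ∑ j, D i j ^ 2
            + 1 / (2 * Real.sqrt n) * n) := by
            gcongr
            refine c2.trans (c3.trans ?_)
            gcongr
        _ = 1 / (2 * Real.sqrt n) * (∑ i, ∑ j, D i j ^ 2) + 1 / (2 * Real.sqrt n) := by
          generalize ∑ i, ∑ j, D i j ^ 2 = T
          generalize Real.sqrt n = s at hss hs ⊢
          rw [← hss]
          field_simp
    have b2 : ‖(p : ℂ) / n * ∑ α, ((r α - 1 : ℝ) : ℂ) * (cmat (S α) * K).trace‖ ≤ B ^ 2 * τ := by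
      rw [norm_mul, norm_div, Complex.norm_natCast, Complex.norm_real, Real.norm_of_nonneg hp]
      calc _ ≤ p / n * ∑ _α : Fin m, τ * (B * 1) := by
            gcongr
            refine (norm_sum_le _ _).trans (Finset.sum_le_sum fun α _ => ?_)
            rw [norm_mul, Complex.norm_real]
            refine mul_le_mul (hr α) ((hSB α K).trans ?_) (norm_nonneg _) hτ
            gcongr
        _ = (m / n * p) * (B * τ) := by
          simp only [Finset.sum_const, Finset.card_univ, Fintype.card_fin, nsmul_eq_mul]; ring
        _ ≤ B * (B * τ) := by gcongr; exact h.mp_le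
        _ = _ := by ring
    have b3 : ‖(((m : ℝ) / n * p - c₁ : ℝ) : ℂ) * ((n : ℂ)⁻¹ * K.trace)‖ ≤
        |(m : ℝ) / n * p - c₁| := by
      rw [norm_mul, norm_mul, Complex.norm_real, norm_inv, Complex.norm_natCast]
      refine mul_le_of_le_one_right (norm_nonneg _) ?_
      rw [inv_mul_le_iff₀ hn]
      refine (norm_trace_le K).trans ?_
      gcongr
    beta_reduce
    rw [e1]
    refine (norm_add_le _ _).trans ?_
    refine (add_le_add (norm_sub_le _ _) le_rfl).trans ?_
    linarith
  · have : 1 / (2 * Real.sqrt n) * B ^ 3 + 1 / (2 * Real.sqrt n) ≤ B ^ 3 / Real.sqrt n := by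
      rw [show 1 / (2 * Real.sqrt n) * B ^ 3 + 1 / (2 * Real.sqrt n)
        = ((B ^ 3 + 1) / 2) / Real.sqrt n by field_simp]
      gcongr
      linarith [one_le_pow₀ hB (n := 3)]
    linarith

lemma norm_trace_x_le (α : Fin m) (K : Matrix (Fin n) (Fin n) ℂ) :
    ‖(cmat (momentMatrix P (x α) (x α)) * K).trace‖ ≤ B * ‖K‖ :=
  norm_trace_momentMatrix_mul_le (h.x_meas α) (h.x_meas α) (h.x_bdd α) (h.x_bdd α) K

lemma norm_trace_y_le (α : Fin m) (K : Matrix (Fin n) (Fin n) ℂ) :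
    ‖(cmat (momentMatrix P (y α) (y α)) * K).trace‖ ≤ B * ‖K‖ :=
  norm_trace_momentMatrix_mul_le (h.y_meas α) (h.y_meas α) (h.y_bdd α) (h.y_bdd α) K

lemma norm_trace_xy_le (α : Fin m) (K : Matrix (Fin n) (Fin n) ℂ) :
    ‖(cmat (momentMatrix P (x α) (y α)) * K).trace‖ ≤ B * ‖K‖ :=
  norm_trace_momentMatrix_mul_le (h.x_meas α) (h.y_meas α) (h.x_bdd α) (h.y_bdd α) K

/-- The contribution of one term to `(1 / n) Tr A G H`, up to errors. -/
lemma norm_ξ_mul_qf_add_le {z : ℂ} (hz : 64 * B ^ 3 ≤ z.im) {H : Matrix (Fin n) (Fin n) ℂ}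
    (hHt : Hᵀ = H) (hH : ‖H‖ ≤ B) (α : Fin m) : ∀ᵐ ω ∂P,
    ‖(ξ α ω : ℂ) * (qf (res (adj ξ x y ω) z * H) (x α ω) (y α ω)
        + qf (res (adj ξ x y ω) z * H) (y α ω) (x α ω))
      + ξ α ω * (ntr z 1 (adj ξ x y ω) * (rtr (momentMatrix P (x α) (x α)) z 1 H (adj ξ x y ω)
        + rtr (momentMatrix P (y α) (y α)) z 1 H (adj ξ x y ω))
        / (1 - ntr z 1 (adj ξ x y ω) ^ 2))‖ ≤
    |ξ α ω| * (4 * (dev (momentMatrix P (x α) (y α)) z 1 1 (x α ω) (y α ω) (adjDel ξ x y α ω)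
      + ‖rtr (momentMatrix P (x α) (y α)) z 1 1 (adjDel ξ x y α ω)‖
      + dev (momentMatrix P (x α) (y α)) z 1 H (x α ω) (y α ω) (adjDel ξ x y α ω)
      + ‖rtr (momentMatrix P (x α) (y α)) z 1 H (adjDel ξ x y α ω)‖
      + dev (momentMatrix P (x α) (y α)) z H 1 (x α ω) (y α ω) (adjDel ξ x y α ω)
      + ‖rtr (momentMatrix P (x α) (y α)) z H 1 (adjDel ξ x y α ω)‖
      + dev (momentMatrix P (x α) (x α)) z 1 H (x α ω) (x α ω) (adjDel ξ x y α ω)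
      + dev (momentMatrix P (y α) (y α)) z 1 H (y α ω) (y α ω) (adjDel ξ x y α ω) + 2 / n)
      + 4 * (1 / (64 * B)) *
        (dev (momentMatrix P (x α) (x α)) z 1 1 (x α ω) (x α ω) (adjDel ξ x y α ω)
      + dev (momentMatrix P (y α) (y α)) z 1 1 (y α ω) (y α ω) (adjDel ξ x y α ω)
      + ‖rtr (momentMatrix P (x α) (x α)) z 1 1 (adjDel ξ x y α ω) - ntr z 1 (adjDel ξ x y α ω)‖
      + ‖rtr (momentMatrix P (y α) (y α)) z 1 1 (adjDel ξ x y α ω) - ntr z 1 (adjDel ξ x y α ω)‖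
      + 2 / n)) := by
  obtain ⟨hz0, -, hz3, hz1, hz2, -⟩ := h.im_bounds hz
  have hB := h.one_le_B
  have h1B : ‖(1 : Matrix (Fin n) (Fin n) ℂ)‖ ≤ B := norm_one_le.trans hB
  have h1H : ‖(1 : Matrix (Fin n) (Fin n) ℂ)‖ * ‖H‖ ≤ B := by
    calc _ ≤ 1 * B := by gcongr; exact norm_one_le
      _ = B := one_mul B
  filter_upwards [h.ξ_values α, h.x_bdd α, h.y_bdd α, h.norm_ntr_adj_sub_le hz h1B α,
    h.norm_rtr_adj_sub_le hz (h.op_xx α) h1H α, h.norm_rtr_adj_sub_le hz (h.op_yy α) h1H α]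
    with ω h1 h2 h3 d1 d2 d3
  have h4 := adj_eq_adjDel_add ξ x y α ω
  -- If ξ_α = 0 both sides vanish; otherwise the full matrix is a rank two perturbation of the
  -- reduced one.
  rcases h1 with h1 | h1
  · simp [h1]
  rw [h1, one_smul] at h4
  rw [h1, abs_one, one_mul, Complex.ofReal_one, one_mul, one_mul]
  have hXh := adjDel_isHermitian ξ x y α ω
  have hAh := adj_isHermitian ξ x y ω
  have hform := qf_res_rank_two hXh hAh h4 hz0 H
  set A := adj ξ x y ω
  set X := adjDel ξ x y α ω
  set u := x α ω
  set v := y α ω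
  have hq : ∀ w w' : EuclideanSpace ℝ (Fin n), ‖w‖ ^ 2 ≤ B → ‖w'‖ ^ 2 ≤ B →
      ‖qf (res X z) w w'‖ ≤ 1 / 64 := fun w w' hw hw' => by
    have : ‖w‖ * ‖w'‖ ≤ B := by nlinarith [sq_nonneg (‖w‖ - ‖w'‖)]
    calc _ ≤ ‖res X z‖ * ‖w‖ * ‖w'‖ := norm_qf_le _ _ _
      _ = (‖w‖ * ‖w'‖) * ‖res X z‖ := by ring
      _ ≤ B * |z.im|⁻¹ := by gcongr; exact norm_res_le hXh hz0
      _ ≤ _ := hz2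
  have hKA : ‖1 * res A z * H‖ ≤ |z.im|⁻¹ * B := by
    refine (norm_mul_res_mul_le hAh hz0 1 H).trans ?_
    calc _ ≤ 1 * |z.im|⁻¹ * B := by gcongr; exact norm_one_le
      _ = _ := by ring
  have hs1 : ‖rtr (momentMatrix P (x α) (x α)) z 1 H A‖ ≤ 1 / (64 * B) := by
    refine (h.norm_trace_x_le α _).trans ?_
    calc _ ≤ B * (|z.im|⁻¹ * B) := by gcongr
      _ = B * |z.im|⁻¹ * B := by ring
      _ ≤ _ := hz3
  have hs2 : ‖rtr (momentMatrix P (y α) (y α)) z 1 H A‖ ≤ 1 / (64 * B) := by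
    refine (h.norm_trace_y_le α _).trans ?_
    calc _ ≤ B * (|z.im|⁻¹ * B) := by gcongr
      _ = B * |z.im|⁻¹ * B := by ring
      _ ≤ _ := hz3
  have hf : ‖ntr z 1 A‖ ≤ 1 / 64 := by
    refine (norm_ntr_le h.n_pos hAh hz0 1).trans ?_
    calc _ ≤ |z.im|⁻¹ * 1 := by gcongr; exact norm_one_le
      _ ≤ _ := by linarith
  have ht : 1 / (64 * B) ≤ 1 / 64 := by
    apply one_div_le_one_div_of_le <;> linarith
  -- Symmetry of H and of the resolvent exchanges the two vectors at the price of moving H to the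
  -- left. Thus only the cross moments of x with y, in this order, are needed, and the functionals
  -- carry factors on both sides.
  have hswap : qf (res X z * H) v u = qf (H * res X z) u v := by
    rw [← qf_transpose, Matrix.transpose_mul, hHt, res_transpose hXh]
  have main := norm_rank_two_ratio_add_le (hq u u h2 h2) (hq v v h3 h3) (hq u v h2 h3) hf hs1 hs2 ht
    hform
  refine main.trans ?_
  have t1 : ‖qf (res X z) u v‖ ≤ dev (momentMatrix P (x α) (y α)) z 1 1 u v X
      + ‖rtr (momentMatrix P (x α) (y α)) z 1 1 X‖ := by
    have := norm_le_norm_sub_add (qf (1 * res X z * 1) u v)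
      (rtr (momentMatrix P (x α) (y α)) z 1 1 X)
    simpa [dev] using this
  have t2 : ‖qf (res X z * H) u v‖ ≤ dev (momentMatrix P (x α) (y α)) z 1 H u v X
      + ‖rtr (momentMatrix P (x α) (y α)) z 1 H X‖ := by
    have := norm_le_norm_sub_add (qf (1 * res X z * H) u v)
      (rtr (momentMatrix P (x α) (y α)) z 1 H X)
    simpa [dev] using this
  have t3 : ‖qf (res X z * H) v u‖ ≤ dev (momentMatrix P (x α) (y α)) z H 1 u v X
      + ‖rtr (momentMatrix P (x α) (y α)) z H 1 X‖ := by
    rw [hswap]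
    have := norm_le_norm_sub_add (qf (H * res X z * 1) u v)
      (rtr (momentMatrix P (x α) (y α)) z H 1 X)
    simpa [dev] using this
  have t4 : ‖qf (res X z * H) u u - rtr (momentMatrix P (x α) (x α)) z 1 H A‖ ≤
      dev (momentMatrix P (x α) (x α)) z 1 H u u X + 1 / n := by
    have := norm_sub_le_norm_sub_add_norm_sub (qf (1 * res X z * H) u u)
      (rtr (momentMatrix P (x α) (x α)) z 1 H X) (rtr (momentMatrix P (x α) (x α)) z 1 H A)
    rw [Matrix.one_mul] at this
    refine this.trans (add_le_add (le_of_eq ?_) d2)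
    rw [dev, Matrix.one_mul]
  have t5 : ‖qf (res X z * H) v v - rtr (momentMatrix P (y α) (y α)) z 1 H A‖ ≤
      dev (momentMatrix P (y α) (y α)) z 1 H v v X + 1 / n := by
    have := norm_sub_le_norm_sub_add_norm_sub (qf (1 * res X z * H) v v)
      (rtr (momentMatrix P (y α) (y α)) z 1 H X) (rtr (momentMatrix P (y α) (y α)) z 1 H A)
    rw [Matrix.one_mul] at this
    refine this.trans (add_le_add (le_of_eq ?_) d3)
    rw [dev, Matrix.one_mul]
  -- Chain of approximations: the quadratic form, its mean Tr QG_α, n⁻¹ Tr G_α, and n⁻¹ Tr G.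
  have t6 : ∀ (Q : Matrix (Fin n) (Fin n) ℝ) (w : EuclideanSpace ℝ (Fin n)),
      ‖qf (res X z) w w - ntr z 1 A‖ ≤ dev Q z 1 1 w w X
        + ‖rtr Q z 1 1 X - ntr z 1 X‖ + 1 / n := fun Q w => by
    have e : qf (res X z) w w - ntr z 1 A = (qf (1 * res X z * 1) w w - rtr Q z 1 1 X)
        + (rtr Q z 1 1 X - ntr z 1 X) + (ntr z 1 X - ntr z 1 A) := by
      rw [Matrix.one_mul, Matrix.mul_one]; ring
    rw [e]
    refine (norm_add_le _ _).trans (add_le_add ((norm_add_le _ _).trans le_rfl) d1)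
  have t7 := t6 (momentMatrix P (x α) (x α)) u
  have t8 := t6 (momentMatrix P (y α) (y α)) v
  have t9 := norm_add_le (qf (res X z * H) u v) (qf (res X z * H) v u)
  have hn2 : (2 : ℝ) / n = 1 / n + 1 / n := by ring
  rw [hn2]
  refine add_le_add (mul_le_mul_of_nonneg_left ?_ (by norm_num))
    (mul_le_mul_of_nonneg_left ?_ (by positivity)) <;> linarith

end

end RankTwoEnsemble

end

noncomputable section

set_option linter.unusedSectionVars false

open Matrix
open scoped Matrix.Norms.L2Operator

variable {n m : ℕ}

namespace RankTwoEnsemble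

variable {Ω : Type*} [MeasurableSpace Ω] {P : Measure Ω} [IsProbabilityMeasure P]
  {ξ : Fin m → Ω → ℝ} {x y : Fin m → Ω → EuclideanSpace ℝ (Fin n)} {p B θ τ κ : ℝ}

section

variable (h : RankTwoEnsemble P ξ x y p B θ τ κ)
include h

/-! ### The self-consistent equation in the mean. -/

lemma integral_adjDel_le (α : Fin m) {g : Matrix (Fin n) (Fin n) ℝ → ℝ} (hg : Measurable g)
    {C c d : ℝ} (hC : ∀ X : Matrix (Fin n) (Fin n) ℝ, X.IsHermitian → |g X| ≤ C)
    (hd : ∀ᵐ ω ∂P, |g (adjDel ξ x y α ω) - g (adj ξ x y ω)| ≤ d)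
    (hc : ∫ ω, g (adj ξ x y ω) ∂P ≤ c) : ∫ ω, g (adjDel ξ x y α ω) ∂P ≤ c + d := by
  have h1 : Integrable (fun ω => g (adj ξ x y ω)) P :=
    integrable_of_ae_bdd (hg.comp h.measurable_adj) C
      (ae_of_all _ fun ω => hC _ (adj_isHermitian ξ x y ω))
  have h2 : Integrable (fun ω => g (adjDel ξ x y α ω)) P :=
    integrable_of_ae_bdd (hg.comp (h.measurable_adjDel α)) C
      (ae_of_all _ fun ω => hC _ (adjDel_isHermitian ξ x y α ω))
  calc _ ≤ ∫ ω, (g (adj ξ x y ω) + d) ∂P := by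
        refine integral_mono_ae h2 (h1.add (integrable_const _)) ?_
        filter_upwards [hd] with ω hω
        have := (abs_le.1 hω).2
        linarith
    _ ≤ c + d := by
      rw [integral_add h1 (integrable_const _)]
      simpa using hc

lemma integralLE_abs_ξ_mul_dev_xx (α : Fin m) {z : ℂ} (hz : z.im ≠ 0)
    {L R : Matrix (Fin n) (Fin n) ℂ} (hLR : ‖L‖ * |z.im|⁻¹ * ‖R‖ ≤ 1) :
    IntegralLE P (fun ω => |ξ α ω| * dev (momentMatrix P (x α) (x α)) z L R (x α ω) (x α ω)
      (adjDel ξ x y α ω)) (p * (2 * θ)) :=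
  h.integralLE_abs_ξ_mul_norm_qf_sub α measurable_fst measurable_fst (h.x_bdd α) (h.x_bdd α)
    (fun D hD => h.var_xx D hD α) hz hLR

lemma integralLE_abs_ξ_mul_dev_yy (α : Fin m) {z : ℂ} (hz : z.im ≠ 0)
    {L R : Matrix (Fin n) (Fin n) ℂ} (hLR : ‖L‖ * |z.im|⁻¹ * ‖R‖ ≤ 1) :
    IntegralLE P (fun ω => |ξ α ω| * dev (momentMatrix P (y α) (y α)) z L R (y α ω) (y α ω)
      (adjDel ξ x y α ω)) (p * (2 * θ)) :=
  h.integralLE_abs_ξ_mul_norm_qf_sub α measurable_snd measurable_snd (h.y_bdd α) (h.y_bdd α)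
    (fun D hD => h.var_yy D hD α) hz hLR

lemma integralLE_abs_ξ_mul_dev_xy (α : Fin m) {z : ℂ} (hz : z.im ≠ 0)
    {L R : Matrix (Fin n) (Fin n) ℂ} (hLR : ‖L‖ * |z.im|⁻¹ * ‖R‖ ≤ 1) :
    IntegralLE P (fun ω => |ξ α ω| * dev (momentMatrix P (x α) (y α)) z L R (x α ω) (y α ω)
      (adjDel ξ x y α ω)) (p * (2 * θ)) :=
  h.integralLE_abs_ξ_mul_norm_qf_sub α measurable_fst measurable_snd (h.x_bdd α) (h.y_bdd α)
    (fun D hD => h.var_xy D hD α) hz hLR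

lemma norm_rtr_le {z : ℂ} (hz : z.im ≠ 0) {Q : Matrix (Fin n) (Fin n) ℝ}
    (hQ : ∀ K : Matrix (Fin n) (Fin n) ℂ, ‖(cmat Q * K).trace‖ ≤ B * ‖K‖)
    {L R : Matrix (Fin n) (Fin n) ℂ} (hLR : ‖L‖ * |z.im|⁻¹ * ‖R‖ ≤ 1)
    {X : Matrix (Fin n) (Fin n) ℝ} (hX : X.IsHermitian) : ‖rtr Q z L R X‖ ≤ B := by
  refine (hQ _).trans ?_
  refine mul_le_of_le_one_right (zero_le_one.trans h.one_le_B) ?_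
  exact (norm_mul_res_mul_le hX hz L R).trans hLR

/-- Independence needs the reduced matrix, whereas the cross moment bound, being a sum over α, needs
one matrix common to all α. Hence the mean is moved to the full matrix at cost 1/n. -/
lemma integralLE_abs_ξ_mul_norm_rtr_xy (α : Fin m) {z : ℂ} (hz : 64 * B ^ 3 ≤ z.im)
    {L R : Matrix (Fin n) (Fin n) ℂ} (hLR : ‖L‖ * |z.im|⁻¹ * ‖R‖ ≤ 1) (hLR' : ‖L‖ * ‖R‖ ≤ B) :
    IntegralLE P (fun ω => |ξ α ω| * ‖rtr (momentMatrix P (x α) (y α)) z L R (adjDel ξ x y α ω)‖)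
      (p * (∫ ω, ‖rtr (momentMatrix P (x α) (y α)) z L R (adj ξ x y ω)‖ ∂P + 1 / n)) := by
  have hb : ∀ X : Matrix (Fin n) (Fin n) ℝ, X.IsHermitian →
      |‖rtr (momentMatrix P (x α) (y α)) z L R X‖| ≤ B := fun X hX => by
    rw [abs_norm]; exact h.norm_rtr_le (h.im_bounds hz).1 (h.norm_trace_xy_le α) hLR hX
  refine h.integralLE_abs_ξ_mul α (measurable_rtr _ z L R).norm hb ?_
  refine h.integral_adjDel_le α (measurable_rtr _ z L R).norm hb ?_ le_rfl
  filter_upwards [h.norm_rtr_adj_sub_le hz (h.op_xy α) hLR' α] with ω hω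
  exact (abs_norm_sub_norm_le _ _).trans hω

lemma integralLE_abs_ξ_mul_norm_rtr_sub_ntr (α : Fin m) {z : ℂ} (hz : 64 * B ^ 3 ≤ z.im)
    {Q : Matrix (Fin n) (Fin n) ℝ} (hQo : opNorm Q ≤ B / n)
    (hQ : ∀ K : Matrix (Fin n) (Fin n) ℂ, ‖(cmat Q * K).trace‖ ≤ B * ‖K‖) {δ : ℝ}
    (hδ : ∫ ω, ‖rtr Q z 1 1 (adj ξ x y ω) - ntr z 1 (adj ξ x y ω)‖ ∂P ≤ δ) :
    IntegralLE P (fun ω => |ξ α ω| * ‖rtr Q z 1 1 (adjDel ξ x y α ω)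
      - ntr z 1 (adjDel ξ x y α ω)‖) (p * (δ + 2 / n)) := by
  obtain ⟨hz0, -, -, hz1, -, -⟩ := h.im_bounds hz
  have hB := h.one_le_B
  have h11 : ‖(1 : Matrix (Fin n) (Fin n) ℂ)‖ * ‖(1 : Matrix (Fin n) (Fin n) ℂ)‖ ≤ 1 := by
    calc _ ≤ 1 * 1 := by gcongr <;> exact norm_one_le
      _ = (1 : ℝ) := one_mul 1
  have h12 : ‖(1 : Matrix (Fin n) (Fin n) ℂ)‖ * |z.im|⁻¹ * ‖(1 : Matrix (Fin n) (Fin n) ℂ)‖ ≤ 1 := by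
    calc _ = ‖(1 : Matrix (Fin n) (Fin n) ℂ)‖ * ‖(1 : Matrix (Fin n) (Fin n) ℂ)‖ * |z.im|⁻¹ := by ring
      _ ≤ 1 * 1 := by gcongr; linarith
      _ = 1 := one_mul 1
  have hm : Measurable fun X : Matrix (Fin n) (Fin n) ℝ => ‖rtr Q z 1 1 X - ntr z 1 X‖ :=
    ((measurable_rtr _ z 1 1).sub (measurable_ntr z 1)).norm
  have hb : ∀ X : Matrix (Fin n) (Fin n) ℝ, X.IsHermitian →
      |‖rtr Q z 1 1 X - ntr z 1 X‖| ≤ B + 1 := fun X hX => by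
    rw [abs_norm]
    refine (norm_sub_le _ _).trans (add_le_add (h.norm_rtr_le hz0 hQ h12 hX) ?_)
    refine (norm_ntr_le h.n_pos hX hz0 1).trans ?_
    calc _ ≤ 1 * 1 := by gcongr; linarith; exact norm_one_le
      _ = (1 : ℝ) := one_mul 1
  refine h.integralLE_abs_ξ_mul α hm hb ?_
  refine h.integral_adjDel_le α hm hb ?_ hδ
  filter_upwards [h.norm_rtr_adj_sub_le hz hQo (h11.trans hB) α,
    h.norm_ntr_adj_sub_le hz (norm_one_le.trans hB) α] with ω h1 h2
  refine (abs_norm_sub_norm_le _ _).trans ?_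
  rw [show (2 : ℝ) / n = 1 / n + 1 / n by ring]
  refine le_trans ?_ (add_le_add h1 h2)
  rw [sub_sub_sub_comm]
  exact norm_sub_le _ _

/-- The self-consistent equation, tested against a symmetric matrix `H`. -/
lemma integralLE_norm_self_consistent {z : ℂ} (hz : 64 * B ^ 3 ≤ z.im)
    {H : Matrix (Fin n) (Fin n) ℂ} (hHt : Hᵀ = H) (hH : ‖H‖ ≤ B) (c₁ : ℝ) {δ : ℝ}
    (hδx : ∀ α, ∫ ω, ‖rtr (momentMatrix P (x α) (x α)) z 1 1 (adj ξ x y ω)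
      - ntr z 1 (adj ξ x y ω)‖ ∂P ≤ δ)
    (hδy : ∀ α, ∫ ω, ‖rtr (momentMatrix P (y α) (y α)) z 1 1 (adj ξ x y ω)
      - ntr z 1 (adj ξ x y ω)‖ ∂P ≤ δ) :
    IntegralLE P (fun ω => ‖(n : ℂ)⁻¹ * H.trace + z * ntr z H (adj ξ x y ω)
        + 2 * c₁ * ntr z 1 (adj ξ x y ω) / (1 - ntr z 1 (adj ξ x y ω) ^ 2)
          * ntr z H (adj ξ x y ω)‖)
      (δ / 8 + 70 * B ^ 3 * (θ + κ + τ + 1 / Real.sqrt n + |(m : ℝ) / n * p - c₁|)) := by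
  obtain ⟨hz0, -, hz3, hz1, hz2, -⟩ := h.im_bounds hz
  have hB := h.one_le_B
  have hp := h.p_nonneg
  have hn : (0 : ℝ) < n := by exact_mod_cast h.n_pos
  have hm : (0 : ℝ) < m := by exact_mod_cast h.m_pos
  have hnC : (n : ℂ) ≠ 0 := by exact_mod_cast h.n_pos.ne'
  have hθ := h.θ_pos
  have hκ := h.κ_nonneg
  have hτ := h.τ_nonneg
  have hA := h.measurable_adj
  have hδ0 : 0 ≤ δ := (integral_nonneg fun _ => norm_nonneg _).trans (hδx ⟨0, h.m_pos⟩)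
  set t := 1 / (64 * B) with ht
  have ht0 : 0 ≤ t := by positivity
  have n1 : ‖(1 : Matrix (Fin n) (Fin n) ℂ)‖ ≤ 1 := norm_one_le
  have l11 : ‖(1 : Matrix (Fin n) (Fin n) ℂ)‖ * |z.im|⁻¹ * ‖(1 : Matrix (Fin n) (Fin n) ℂ)‖ ≤ 1 := by
    calc _ ≤ 1 * |z.im|⁻¹ * 1 := by gcongr
      _ ≤ 1 := by linarith
  have l1H : ‖(1 : Matrix (Fin n) (Fin n) ℂ)‖ * |z.im|⁻¹ * ‖H‖ ≤ 1 := by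
    calc _ ≤ 1 * |z.im|⁻¹ * B := by gcongr
      _ ≤ 1 := by linarith
  have lH1 : ‖H‖ * |z.im|⁻¹ * ‖(1 : Matrix (Fin n) (Fin n) ℂ)‖ ≤ 1 := by
    calc _ ≤ B * |z.im|⁻¹ * 1 := by gcongr
      _ ≤ 1 := by linarith
  have k11 : ‖(1 : Matrix (Fin n) (Fin n) ℂ)‖ * ‖(1 : Matrix (Fin n) (Fin n) ℂ)‖ ≤ B := by
    calc _ ≤ 1 * 1 := by gcongr
      _ ≤ B := by linarith
  have k1H : ‖(1 : Matrix (Fin n) (Fin n) ℂ)‖ * ‖H‖ ≤ B := by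
    calc _ ≤ 1 * B := by gcongr
      _ = B := one_mul B
  have kH1 : ‖H‖ * ‖(1 : Matrix (Fin n) (Fin n) ℂ)‖ ≤ B := by rwa [mul_comm]
  set q : Matrix (Fin n) (Fin n) ℂ → Matrix (Fin n) (Fin n) ℂ → Fin m → ℝ := fun L R α =>
    ∫ ω, ‖rtr (momentMatrix P (x α) (y α)) z L R (adj ξ x y ω)‖ ∂P with hq
  -- Individual cross traces need not be small; only their sum over α is controlled.
  have hqsum : ∀ L R : Matrix (Fin n) (Fin n) ℂ, ‖L‖ * |z.im|⁻¹ * ‖R‖ ≤ 1 →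
      ∑ α, q L R α ≤ m * κ := fun L R hLR => by
    have hi : ∀ α ∈ (Finset.univ : Finset (Fin m)), Integrable (fun ω =>
        ‖rtr (momentMatrix P (x α) (y α)) z L R (adj ξ x y ω)‖) P := fun α _ =>
      integrable_of_ae_bdd ((measurable_rtr _ z L R).comp hA).norm B (ae_of_all _ fun ω => by
        rw [norm_norm]
        exact h.norm_rtr_le hz0 (h.norm_trace_xy_le α) hLR (adj_isHermitian ξ x y ω))
    rw [hq, ← integral_finsetSum _ hi]
    calc _ ≤ ∫ _ω, (m : ℝ) * κ ∂P := by
          refine integral_mono (integrable_finsetSum _ hi) (integrable_const _) fun ω => ?_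
          exact sum_norm_trace_le h.m_pos _
            ((norm_mul_res_mul_le (adj_isHermitian ξ x y ω) hz0 L R).trans hLR) h.cross
      _ = _ := by simp
  have term : ∀ α, _ := fun α =>
    (((((((((h.integralLE_abs_ξ_mul_dev_xy α hz0 l11).add
      (h.integralLE_abs_ξ_mul_norm_rtr_xy α hz l11 k11)).add
      (h.integralLE_abs_ξ_mul_dev_xy α hz0 l1H)).add
      (h.integralLE_abs_ξ_mul_norm_rtr_xy α hz l1H k1H)).add
      (h.integralLE_abs_ξ_mul_dev_xy α hz0 lH1)).add
      (h.integralLE_abs_ξ_mul_norm_rtr_xy α hz lH1 kH1)).add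
      (h.integralLE_abs_ξ_mul_dev_xx α hz0 l1H)).add
      (h.integralLE_abs_ξ_mul_dev_yy α hz0 l1H)).const_mul (a := 4) (by norm_num)).add
    (((((h.integralLE_abs_ξ_mul_dev_xx α hz0 l11).add
      (h.integralLE_abs_ξ_mul_dev_yy α hz0 l11)).add
      (h.integralLE_abs_ξ_mul_norm_rtr_sub_ntr α hz (h.op_xx α) (h.norm_trace_x_le α) (hδx α))).add
      (h.integralLE_abs_ξ_mul_norm_rtr_sub_ntr α hz (h.op_yy α) (h.norm_trace_y_le α)
        (hδy α))).const_mul (a := 4 * t) (by positivity))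
  have hξ : ∀ α, IntegralLE P (fun ω => |ξ α ω|) p := fun α =>
    ⟨h.integrable_abs_ξ α, (h.integral_abs_ξ α).le⟩
  have term' : ∀ α, _ := fun α => (term α).add ((hξ α).const_mul (a := 4 * (2 / n) + 4 * t * (2 / n))
    (by positivity))
  have tot := ((IntegralLE.sum (s := Finset.univ) fun α _ => term' α).const_mul
    (a := (n : ℝ)⁻¹) (by positivity)).add
    ((h.integralLE_norm_sum_ξ_rtr_sub h.op_xx h.norm_trace_x_le h.trace_y h.sum_trace_mul_factor_x
      hz hH c₁).add (h.integralLE_norm_sum_ξ_rtr_sub h.op_yy h.norm_trace_y_le h.trace_x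
        h.sum_trace_mul_factor_y hz hH c₁))
  refine IntegralLE.mono (IntegralLE.of_le tot ?_ (ae_of_all _ fun ω => norm_nonneg _) ?_) ?_
  · have m1 : Measurable fun ω => ntr z 1 (adj ξ x y ω) := (measurable_ntr z 1).comp hA
    have mH : Measurable fun ω => ntr z H (adj ξ x y ω) := (measurable_ntr z H).comp hA
    exact (Measurable.norm (by fun_prop)).aestronglyMeasurable
  · filter_upwards [ae_all_iff.2 fun α => h.norm_ξ_mul_qf_add_le hz hHt hH α] with ω hω
    have hAh := adj_isHermitian ξ x y ω
    set A := adj ξ x y ω with hAdef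
    set f := ntr z 1 A with hf
    set sx := fun α => rtr (momentMatrix P (x α) (x α)) z 1 H A
    set sy := fun α => rtr (momentMatrix P (y α) (y α)) z 1 H A
    set W := fun α => qf (res A z * H) (x α ω) (y α ω) + qf (res A z * H) (y α ω) (x α ω)
    -- AGH = H + zGH, with A expanded into its rank two terms.
    have e1 : (n : ℂ)⁻¹ * H.trace + z * ntr z H A = (n : ℂ)⁻¹ * ∑ α, (ξ α ω : ℂ) * W α := by
      have e2 : cmat A = ∑ α, (ξ α ω : ℂ) • cmat (symProd (x α ω) (y α ω)) := by
        rw [hAdef, adj, adjacencyMatrix_eq_sum_symProd]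
        ext i j; simp [cmat_apply, Matrix.sum_apply]
      have e3 : (cmat A * (res A z * H)).trace = H.trace + z * (res A z * H).trace := by
        rw [← Matrix.mul_assoc, cmat_mul_res hAh hz0, Matrix.add_mul, Matrix.one_mul,
          Matrix.smul_mul, Matrix.trace_add, Matrix.trace_smul, smul_eq_mul]
      have e4 : (cmat A * (res A z * H)).trace = ∑ α, (ξ α ω : ℂ) * W α := by
        rw [e2, Matrix.sum_mul, Matrix.trace_sum]
        refine Finset.sum_congr rfl fun α _ => ?_
        rw [Matrix.smul_mul, Matrix.trace_smul, trace_cmat_symProd_mul, smul_eq_mul]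
      rw [← e4, e3, ntr]; ring
    -- The approximate value of each term is added and subtracted. The first sum holds the local
    -- errors, and the bracket holds the two averaging errors for x and y.
    have e5 : (n : ℂ)⁻¹ * H.trace + z * ntr z H A + 2 * c₁ * f / (1 - f ^ 2) * ntr z H A =
        (n : ℂ)⁻¹ * ∑ α, ((ξ α ω : ℂ) * W α + ξ α ω * (f * (sx α + sy α) / (1 - f ^ 2)))
        - f / (1 - f ^ 2) * (((n : ℂ)⁻¹ * ∑ α, (ξ α ω : ℂ) * sx α - c₁ * ntr z H A)
          + ((n : ℂ)⁻¹ * ∑ α, (ξ α ω : ℂ) * sy α - c₁ * ntr z H A)) := by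
      have e6 : ∑ α, (ξ α ω : ℂ) * (f * (sx α + sy α) / (1 - f ^ 2)) =
          f / (1 - f ^ 2) * (∑ α, (ξ α ω : ℂ) * sx α + ∑ α, (ξ α ω : ℂ) * sy α) := by
        rw [← Finset.sum_add_distrib, Finset.mul_sum]
        exact Finset.sum_congr rfl fun α _ => by ring
      rw [e1, Finset.sum_add_distrib, e6]; ring
    have hfs : ‖f‖ ≤ 1 / 64 := by
      refine (norm_ntr_le h.n_pos hAh hz0 1).trans ?_
      calc _ ≤ |z.im|⁻¹ * 1 := by gcongr
        _ ≤ _ := by linarith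
    have hff : ‖f / (1 - f ^ 2)‖ ≤ 1 := by
      have h1 := norm_sub_norm_le (1 : ℂ) (f ^ 2)
      rw [norm_one, norm_pow] at h1
      rw [norm_div, div_le_one (by nlinarith [norm_nonneg f])]
      nlinarith [norm_nonneg f]
    rw [e5]
    refine (norm_sub_le _ _).trans (add_le_add ?_ ?_)
    · rw [norm_mul, norm_inv, Complex.norm_natCast]
      refine mul_le_mul_of_nonneg_left ?_ (by positivity)
      refine (norm_sum_le _ _).trans (Finset.sum_le_sum fun α _ => (hω α).trans (le_of_eq ?_))
      ring
    · rw [norm_mul]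
      exact (mul_le_of_le_one_left (norm_nonneg _) hff).trans (norm_add_le _ _)
  · have s1 := hqsum 1 1 l11
    have s2 := hqsum 1 H l1H
    have s3 := hqsum H 1 lH1
    have hs : 0 < Real.sqrt n := Real.sqrt_pos.2 hn
    have hinv : 1 / (n : ℝ) ≤ 1 / Real.sqrt n := by
      apply one_div_le_one_div_of_le hs
      rw [Real.sqrt_le_left hn.le]
      have : (1 : ℝ) ≤ n := by exact_mod_cast h.n_pos
      nlinarith
    have hsum : (n : ℝ)⁻¹ * ∑ α, (4 * (p * (2 * θ) + p * (q 1 1 α + 1 / n) + p * (2 * θ)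
        + p * (q 1 H α + 1 / n) + p * (2 * θ) + p * (q H 1 α + 1 / n) + p * (2 * θ) + p * (2 * θ))
        + 4 * t * (p * (2 * θ) + p * (2 * θ) + p * (δ + 2 / n) + p * (δ + 2 / n))
        + (4 * (2 / n) + 4 * t * (2 / n)) * p) =
        4 * (p / n) * (∑ α, q 1 1 α + ∑ α, q 1 H α + ∑ α, q H 1 α)
        + (m / n * p) * (40 * θ + 20 * (1 / n) + t * (16 * θ + 8 * δ + 24 * (1 / n))) := by
      have : ∀ α, (4 * (p * (2 * θ) + p * (q 1 1 α + 1 / n) + p * (2 * θ)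
        + p * (q 1 H α + 1 / n) + p * (2 * θ) + p * (q H 1 α + 1 / n) + p * (2 * θ) + p * (2 * θ))
        + 4 * t * (p * (2 * θ) + p * (2 * θ) + p * (δ + 2 / n) + p * (δ + 2 / n))
        + (4 * (2 / n) + 4 * t * (2 / n)) * p) = 4 * p * (q 1 1 α + q 1 H α + q H 1 α) +
        p * (40 * θ + 20 * (1 / n) + t * (16 * θ + 8 * δ + 24 * (1 / n))) := fun α => by ring
      rw [Finset.sum_congr rfl fun α _ => this α, Finset.sum_add_distrib, ← Finset.mul_sum,
        Finset.sum_add_distrib, Finset.sum_add_distrib]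
      simp only [Finset.sum_const, Finset.card_univ, Fintype.card_fin, nsmul_eq_mul]
      ring
    have hb1 : 4 * (p / n) * (∑ α, q 1 1 α + ∑ α, q 1 H α + ∑ α, q H 1 α) ≤ 12 * B * κ := by
      calc _ ≤ 4 * (p / n) * (m * κ + m * κ + m * κ) := by gcongr
        _ = 12 * (m / n * p) * κ := by ring
        _ ≤ 12 * B * κ := by gcongr; exact h.mp_le
    -- Since Bt = 1/64, the coefficient of δ becomes 8/64 = 1/8, small enough to be absorbed later.
    have hb2 : (m / n * p) * (40 * θ + 20 * (1 / n) + t * (16 * θ + 8 * δ + 24 * (1 / n))) ≤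
        B * (40 * θ + 20 * (1 / Real.sqrt n)) + (16 * θ + 8 * δ + 24 * (1 / Real.sqrt n)) / 64 := by
      calc _ ≤ B * (40 * θ + 20 * (1 / Real.sqrt n)
            + t * (16 * θ + 8 * δ + 24 * (1 / Real.sqrt n))) := by
            gcongr; exact h.mp_le
        _ = _ := by rw [ht]; field_simp
    have hB3 : B ≤ B ^ 3 := le_self_pow₀ hB (by norm_num)
    have hB2 : B ^ 2 ≤ B ^ 3 := pow_le_pow_right₀ hB (by norm_num)
    have hB1 : 1 ≤ B ^ 3 := hB.trans hB3
    set S := 1 / Real.sqrt n with hS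
    have hS0 : 0 ≤ S := by positivity
    have e : B ^ 3 / Real.sqrt n = B ^ 3 * S := by rw [hS]; ring
    set d := |(m : ℝ) / n * p - c₁|
    have hd : 0 ≤ d := abs_nonneg _
    rw [hsum, e]
    have g1 : B * θ ≤ B ^ 3 * θ := by gcongr
    have g2 : B * κ ≤ B ^ 3 * κ := by gcongr
    have g3 : B * S ≤ B ^ 3 * S := by gcongr
    have g4 : B ^ 2 * τ ≤ B ^ 3 * τ := by gcongr
    have g5 : d ≤ B ^ 3 * d := le_mul_of_one_le_left hd hB1
    have g6 : θ ≤ B ^ 3 * θ := le_mul_of_one_le_left hθ.le hB1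
    have g7 : S ≤ B ^ 3 * S := le_mul_of_one_le_left hS0 hB1
    have g8 : 0 ≤ B ^ 3 * τ := by positivity
    have g9 : 0 ≤ B ^ 3 * κ := by positivity
    linarith

end

end RankTwoEnsemble

end

noncomputable section

set_option linter.unusedSectionVars false

open Matrix
open scoped Matrix.Norms.L2Operator

/-! ### The small root of the self-consistent equation -/

/-- The self-consistent expression `1 + z f + 2 c f² / (1 - f²)`. -/
def selfEq (c : ℝ) (z f : ℂ) : ℂ := 1 + z * f + 2 * c * f / (1 - f ^ 2) * f

lemma norm_one_sub_sq_ge {f : ℂ} (hf : ‖f‖ ≤ 1 / 64) : 9 / 10 ≤ ‖1 - f ^ 2‖ := by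
  have h1 := norm_sub_norm_le (1 : ℂ) (f ^ 2)
  rw [norm_one, norm_pow] at h1
  nlinarith [norm_nonneg f]

/-- The difference factors through 2c(f - w)(f + w), and f + w is small on the disc. This Lipschitz
bound gives existence, stability and decay of the small root. -/
lemma norm_mul_sq_div_sub_le {c : ℝ} (hc : 0 ≤ c) {f w : ℂ} (hf : ‖f‖ ≤ 1 / 64)
    (hw : ‖w‖ ≤ 1 / 64) :
    ‖2 * c * f / (1 - f ^ 2) * f - 2 * c * w / (1 - w ^ 2) * w‖ ≤ c * ‖f - w‖ := by
  have hf1 := norm_one_sub_sq_ge hf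
  have hw1 := norm_one_sub_sq_ge hw
  have hf0 : 1 - f ^ 2 ≠ 0 := norm_pos_iff.1 (by linarith)
  have hw0 : 1 - w ^ 2 ≠ 0 := norm_pos_iff.1 (by linarith)
  have e : 2 * c * f / (1 - f ^ 2) * f - 2 * c * w / (1 - w ^ 2) * w =
      c * (f - w) * (2 * (f + w)) / ((1 - f ^ 2) * (1 - w ^ 2)) := by
    field_simp; ring
  rw [e, norm_div, norm_mul, norm_mul, norm_mul, norm_mul, Complex.norm_real,
    Real.norm_of_nonneg hc, Complex.norm_ofNat, div_le_iff₀ (by positivity)]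
  have h1 : 2 * ‖f + w‖ ≤ ‖1 - f ^ 2‖ * ‖1 - w ^ 2‖ := by
    have := norm_add_le f w
    nlinarith
  gcongr

/-- The linear part z(f - w) dominates the nonlinear part, whose Lipschitz constant is c, by at
least ‖f - w‖. -/
lemma norm_sub_le_of_selfEq_eq_zero {c : ℝ} (hc : 0 ≤ c) {z f w : ℂ} (hz : c + 1 ≤ ‖z‖)
    (hf : ‖f‖ ≤ 1 / 64) (hw : ‖w‖ ≤ 1 / 64) (h : selfEq c z w = 0) :
    ‖f - w‖ ≤ ‖selfEq c z f‖ := by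
  have e : z * (f - w) = selfEq c z f - (2 * c * f / (1 - f ^ 2) * f
      - 2 * c * w / (1 - w ^ 2) * w) := by
    have : selfEq c z f = selfEq c z f - selfEq c z w := by rw [h, sub_zero]
    rw [this, selfEq, selfEq]; ring
  have h1 := congrArg norm e
  rw [norm_mul] at h1
  have h2 := norm_sub_le (selfEq c z f) (2 * c * f / (1 - f ^ 2) * f
      - 2 * c * w / (1 - w ^ 2) * w)
  have h3 := norm_mul_sq_div_sub_le hc hf hw
  nlinarith [norm_nonneg (f - w)]

lemma norm_mul_sq_div_le {c : ℝ} (hc : 0 ≤ c) {f : ℂ} (hf : ‖f‖ ≤ 1 / 64) :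
    ‖2 * c * f / (1 - f ^ 2) * f‖ ≤ c * ‖f‖ := by
  have := norm_mul_sq_div_sub_le hc hf (w := 0) (by simp)
  simpa using this

/-- Solving for the linear term gives the map u ↦ -(1 + 2cu²/(1 - u²))/z, a contraction of the disc
of radius 1/64. -/
lemma exists_selfEq_eq_zero {c : ℝ} (hc : 0 ≤ c) {z : ℂ} (hz : 64 * (1 + c) ≤ ‖z‖) :
    ∃ w : ℂ, ‖w‖ ≤ 1 / 64 ∧ selfEq c z w = 0 := by
  have hz0 : 0 < ‖z‖ := by linarith
  have hz0' : z ≠ 0 := norm_pos_iff.1 hz0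
  set T : ℂ → ℂ := fun u => -(1 + 2 * c * u / (1 - u ^ 2) * u) / z with hT
  set s : Set ℂ := Metric.closedBall 0 (1 / 64) with hs
  have hsm : ∀ u, u ∈ s ↔ ‖u‖ ≤ 1 / 64 := fun u => by simp [hs]
  have hmaps : Set.MapsTo T s s := fun u hu => by
    rw [hsm] at hu ⊢
    rw [hT, norm_div, norm_neg, div_le_iff₀ hz0]
    have h1 := norm_add_le (1 : ℂ) (2 * c * u / (1 - u ^ 2) * u)
    have h2 := norm_mul_sq_div_le hc hu
    rw [norm_one] at h1
    nlinarith [norm_nonneg u]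
  have hlip : LipschitzWith (1 / 2) (hmaps.restrict T s s) := by
    refine LipschitzWith.of_dist_le_mul fun u w => ?_
    rw [Subtype.dist_eq, Subtype.dist_eq, dist_eq_norm, dist_eq_norm]
    simp only [Set.MapsTo.val_restrict_apply]
    have hu := (hsm _).1 u.2
    have hw := (hsm _).1 w.2
    have e : T u - T w = -(2 * c * (u : ℂ) / (1 - (u : ℂ) ^ 2) * u
        - 2 * c * (w : ℂ) / (1 - (w : ℂ) ^ 2) * w) / z := by
      simp only [hT]; ring
    rw [e, norm_div, norm_neg, div_le_iff₀ hz0]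
    refine (norm_mul_sq_div_sub_le hc hu hw).trans ?_
    have : c ≤ 1 / 2 * ‖z‖ := by linarith
    calc _ ≤ (1 / 2 * ‖z‖) * ‖(u : ℂ) - w‖ := by gcongr
      _ = _ := by push_cast; ring
  have hcontr : ContractingWith (1 / 2) (hmaps.restrict T s s) :=
    ⟨by rw [← NNReal.coe_lt_coe]; norm_num, hlip⟩
  obtain ⟨w, hws, hfix, -⟩ := hcontr.exists_fixedPoint' Metric.isClosed_closedBall.isComplete
    hmaps (x := 0) (by simp [hs]) (edist_ne_top _ _)
  refine ⟨w, (hsm w).1 hws, ?_⟩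
  have h1 : -(1 + 2 * c * w / (1 - w ^ 2) * w) / z = w := hfix
  rw [div_eq_iff hz0'] at h1
  rw [selfEq]
  linear_combination -h1

/-- The equation bounds zw by c + 1, hence its nonlinear term by c(c + 1)/‖z‖. This decay yields
tightness. -/
lemma norm_one_add_mul_le_of_selfEq_eq_zero {c : ℝ} (hc : 0 ≤ c) {z w : ℂ} (hz : c + 1 ≤ ‖z‖)
    (hw : ‖w‖ ≤ 1 / 64) (h : selfEq c z w = 0) : ‖1 + z * w‖ ≤ c * (c + 1) / ‖z‖ := by
  have hz0 : 0 < ‖z‖ := by linarith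
  have e : 1 + z * w = -(2 * c * w / (1 - w ^ 2) * w) := by
    rw [selfEq] at h; linear_combination h
  have h2 := norm_mul_sq_div_le hc hw
  have h3 : ‖z‖ * ‖w‖ ≤ c + 1 := by
    rw [← norm_mul]
    have e2 : z * w = -1 - 2 * c * w / (1 - w ^ 2) * w := by linear_combination e
    have := norm_sub_le (-1 : ℂ) (2 * c * w / (1 - w ^ 2) * w)
    rw [← e2, norm_neg, norm_one] at this
    nlinarith
  rw [e, norm_neg, le_div_iff₀ hz0]
  nlinarith

/-- For small values the self-consistent equation is the cubic equation. -/
lemma selfEq_eq_zero_iff {c : ℝ} {z f : ℂ} (hf : ‖f‖ ≤ 1 / 64) :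
    selfEq c z f = 0 ↔ z * f ^ 3 + (1 - 2 * (c : ℂ)) * f ^ 2 - z * f - 1 = 0 := by
  have hf1 := norm_one_sub_sq_ge hf
  have hf0 : 1 - f ^ 2 ≠ 0 := norm_pos_iff.1 (by linarith)
  have e : z * f ^ 3 + (1 - 2 * (c : ℂ)) * f ^ 2 - z * f - 1 = -(1 - f ^ 2) * selfEq c z f := by
    rw [selfEq]; field_simp; ring
  rw [e, mul_eq_zero, neg_eq_zero, or_iff_right hf0]

variable {n m : ℕ}

/-! ### Closing the self-consistent equation. -/

namespace RankTwoEnsemble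

variable {Ω : Type*} [MeasurableSpace Ω] {P : Measure Ω} [IsProbabilityMeasure P]
  {ξ : Fin m → Ω → ℝ} {x y : Fin m → Ω → EuclideanSpace ℝ (Fin n)} {p B θ τ κ : ℝ}

section

variable (h : RankTwoEnsemble P ξ x y p B θ τ κ)
include h

lemma norm_ntr_one_le {z : ℂ} (hz : 64 * B ^ 3 ≤ z.im) (ω : Ω) :
    ‖ntr z 1 (adj ξ x y ω)‖ ≤ 1 / 64 := by
  obtain ⟨hz0, -, -, hz1, -, -⟩ := h.im_bounds hz
  refine (norm_ntr_le h.n_pos (adj_isHermitian ξ x y ω) hz0 1).trans ?_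
  calc _ ≤ |z.im|⁻¹ * 1 := by gcongr; exact norm_one_le
    _ ≤ _ := by linarith

/-- The equations tested with H = nQ and H = 1 have the same factor z + s, so their difference is (z
+ s)(Tr QG - f) + Tr Q - 1. The bound ‖Q‖ ≤ B/n makes nQ an admissible test matrix. -/
lemma integralLE_norm_rtr_sub_ntr {z : ℂ} (hz : 64 * B ^ 3 ≤ z.im) {c₁ : ℝ} (hc₀ : 0 ≤ c₁)
    (hc : c₁ ≤ B) {Q : Matrix (Fin n) (Fin n) ℝ} (hQt : Qᵀ = Q) (hQo : opNorm Q ≤ B / n)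
    (hQtr : |Q.trace - 1| ≤ τ) {ε : ℝ}
    (hε : ∀ H : Matrix (Fin n) (Fin n) ℂ, Hᵀ = H → ‖H‖ ≤ B →
      IntegralLE P (fun ω => ‖(n : ℂ)⁻¹ * H.trace + z * ntr z H (adj ξ x y ω)
        + 2 * c₁ * ntr z 1 (adj ξ x y ω) / (1 - ntr z 1 (adj ξ x y ω) ^ 2)
          * ntr z H (adj ξ x y ω)‖) ε) :
    IntegralLE P (fun ω => ‖rtr Q z 1 1 (adj ξ x y ω) - ntr z 1 (adj ξ x y ω)‖)
      (ε + ε + τ) := by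
  have hB := h.one_le_B
  have hn : (0 : ℝ) < n := by exact_mod_cast h.n_pos
  have hnC : (n : ℂ) ≠ 0 := by exact_mod_cast h.n_pos.ne'
  have h1 := hε ((n : ℂ) • cmat Q) (by rw [Matrix.transpose_smul, ← cmat_transpose, hQt]) (by
    rw [norm_smul, Complex.norm_natCast]
    calc _ ≤ n * (B / n) := by gcongr; exact (norm_cmat_le Q).trans hQo
      _ = B := by field_simp)
  have h2 := hε 1 Matrix.transpose_one (norm_one_le.trans hB)
  have hA := h.measurable_adj
  refine IntegralLE.of_le ((h1.add h2).add (IntegralLE.const τ))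
    (((measurable_rtr Q z 1 1).comp hA).sub ((measurable_ntr z 1).comp hA)).norm.aestronglyMeasurable
    (ae_of_all _ fun ω => norm_nonneg _) (ae_of_all _ fun ω => ?_)
  beta_reduce
  set A := adj ξ x y ω
  have hf := h.norm_ntr_one_le hz ω
  set f := ntr z 1 A
  set a := rtr Q z 1 1 A with ha
  have e1 : ntr z ((n : ℂ) • cmat Q) A = a := by
    rw [ntr, ha, rtr, Matrix.mul_smul, Matrix.trace_smul, smul_eq_mul, Matrix.one_mul,
      Matrix.mul_one, Matrix.trace_mul_comm, inv_mul_cancel_left₀ hnC]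
  have e2 : (n : ℂ)⁻¹ * ((n : ℂ) • cmat Q).trace = (Q.trace : ℂ) := by
    rw [Matrix.trace_smul, smul_eq_mul, inv_mul_cancel_left₀ hnC, cmat_trace]
  have e3 : (n : ℂ)⁻¹ * (1 : Matrix (Fin n) (Fin n) ℂ).trace = 1 := by
    simp [hnC]
  rw [e1, e2, e3]
  set s := 2 * c₁ * f / (1 - f ^ 2) with hs
  have hsn : ‖s‖ ≤ c₁ := by
    have h9 := norm_one_sub_sq_ge hf
    rw [hs, norm_div, norm_mul, norm_mul, Complex.norm_ofNat, Complex.norm_real,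
      Real.norm_of_nonneg hc₀, div_le_iff₀ (by linarith)]
    have : 2 * ‖f‖ ≤ ‖1 - f ^ 2‖ := by linarith
    calc _ = c₁ * (2 * ‖f‖) := by ring
      _ ≤ _ := by gcongr
  have hzs : 1 ≤ ‖z + s‖ := by
    have h5 : B ≤ B ^ 3 := le_self_pow₀ hB (by norm_num)
    have h6 := (Complex.abs_im_le_norm z)
    have h7 := le_abs_self z.im
    have h8 := norm_sub_le_norm_add z s
    linarith
  have e4 : (z + s) * (a - f) = ((Q.trace : ℂ) + z * a + s * a) - (1 + z * f + s * f)
      - ((Q.trace - 1 : ℝ) : ℂ) := by push_cast; ring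
  calc ‖a - f‖ ≤ ‖z + s‖ * ‖a - f‖ := le_mul_of_one_le_left (norm_nonneg _) hzs
    _ = ‖((Q.trace : ℂ) + z * a + s * a) - (1 + z * f + s * f)
      - ((Q.trace - 1 : ℝ) : ℂ)‖ := by rw [← norm_mul, e4]
    _ ≤ _ := by
      refine (norm_sub_le _ _).trans (add_le_add (norm_sub_le _ _) ?_)
      rw [Complex.norm_real]; exact hQtr

lemma momentMatrix_self_transpose (u : Ω → EuclideanSpace ℝ (Fin n)) :
    (momentMatrix P u u)ᵀ = momentMatrix P u u := by
  ext i j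
  simp only [momentMatrix, Matrix.transpose_apply, Matrix.of_apply]
  exact integral_congr_ae (ae_of_all _ fun ω => mul_comm _ _)

/-- The normalized trace of the resolvent solves the self-consistent equation up to an error. -/
lemma integralLE_norm_selfEq {z : ℂ} (hz : 64 * B ^ 3 ≤ z.im) {c₁ : ℝ} (hc₀ : 0 ≤ c₁)
    (hc : c₁ ≤ B) :
    IntegralLE P (fun ω => ‖selfEq c₁ z (ntr z 1 (adj ξ x y ω))‖)
      (140 * B ^ 3 * (θ + κ + τ + 1 / Real.sqrt n + |(m : ℝ) / n * p - c₁|)) := by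
  have hB := h.one_le_B
  have hnC : (n : ℂ) ≠ 0 := by exact_mod_cast h.n_pos.ne'
  set Dx : Fin m → ℝ := fun α => ∫ ω, ‖rtr (momentMatrix P (x α) (x α)) z 1 1 (adj ξ x y ω)
      - ntr z 1 (adj ξ x y ω)‖ ∂P with hDx
  set Dy : Fin m → ℝ := fun α => ∫ ω, ‖rtr (momentMatrix P (y α) (y α)) z 1 1 (adj ξ x y ω)
      - ntr z 1 (adj ξ x y ω)‖ ∂P with hDy
  have : Nonempty (Fin m) := ⟨⟨0, h.m_pos⟩⟩
  -- The worst discrepancy over all indices is attained, so the bound it produces can be applied to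
  -- itself.
  obtain ⟨α₀, hα₀⟩ := Finite.exists_max fun α => max (Dx α) (Dy α)
  set δ := max (Dx α₀) (Dy α₀) with hδ
  set ρ := 70 * B ^ 3 * (θ + κ + τ + 1 / Real.sqrt n + |(m : ℝ) / n * p - c₁|) with hρ
  have hmain := fun (H : Matrix (Fin n) (Fin n) ℂ) (h1 : Hᵀ = H) (h2 : ‖H‖ ≤ B) =>
    h.integralLE_norm_self_consistent hz h1 h2 c₁
      (fun α => (le_max_left _ _).trans (hα₀ α)) (fun α => (le_max_right _ _).trans (hα₀ α))
  have hx := (h.integralLE_norm_rtr_sub_ntr hz hc₀ hc (h.momentMatrix_self_transpose (x α₀))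
    (h.op_xx α₀) (h.trace_x α₀) hmain).2
  have hy := (h.integralLE_norm_rtr_sub_ntr hz hc₀ hc (h.momentMatrix_self_transpose (y α₀))
    (h.op_yy α₀) (h.trace_y α₀) hmain).2
  have hτρ : τ ≤ ρ := by
    have h1 : 1 ≤ B ^ 3 := one_le_pow₀ hB
    have hθ := h.θ_pos
    have hκ := h.κ_nonneg
    have hτ := h.τ_nonneg
    have hs : 0 ≤ 1 / Real.sqrt n := by positivity
    have hd := abs_nonneg ((m : ℝ) / n * p - c₁)
    rw [hρ]
    nlinarith
  -- With τ ≤ ρ this forces δ ≤ 4ρ, hence δ/8 + ρ ≤ 2ρ, which gives the constant 140 = 2 · 70.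
  have hδρ : δ ≤ (δ / 8 + ρ) + (δ / 8 + ρ) + τ := by
    rw [hδ]
    exact max_le hx hy
  have h1 := hmain 1 Matrix.transpose_one (norm_one_le.trans hB)
  refine IntegralLE.mono (h1.congr fun ω => ?_) (d := 140 * B ^ 3 * _) ?_
  · have e3 : (n : ℂ)⁻¹ * (1 : Matrix (Fin n) (Fin n) ℂ).trace = 1 := by simp [hnC]
    rw [e3, selfEq]
  · have e : 140 * B ^ 3 * (θ + κ + τ + 1 / Real.sqrt n + |(m : ℝ) / n * p - c₁|) = 2 * ρ := by
      rw [hρ]; ring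
    have hρ0 : 0 ≤ ρ := h.τ_nonneg.trans hτρ
    rw [e, ← hρ]
    linarith

end

end RankTwoEnsemble

end

noncomputable section

/-! ### Cauchy kernels and the algebra they generate. -/

/-- The function `t ↦ (t - z)⁻¹` as a bounded continuous function on the line; it is replaced by
`0` for real `z`. -/
def cauchyKernel (z : ℂ) : ℝ →ᵇ ℂ :=
  if hz : z.im ≠ 0 then
    BoundedContinuousFunction.ofNormedAddCommGroup (fun t : ℝ => ((t : ℂ) - z)⁻¹)
      (Continuous.inv₀ (by fun_prop) (sub_ne_zero_of_im hz)) |z.im|⁻¹ (norm_inv_sub_le hz)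
  else 0

lemma cauchyKernel_apply {z : ℂ} (hz : z.im ≠ 0) (t : ℝ) :
    cauchyKernel z t = ((t : ℂ) - z)⁻¹ := by
  rw [cauchyKernel, dif_pos hz]; rfl

lemma integral_cauchyKernel {z : ℂ} (hz : z.im ≠ 0) (ν : Measure ℝ) :
    ∫ t, cauchyKernel z t ∂ν = stieltjes ν z := by
  simp only [stieltjes, cauchyKernel_apply hz]

lemma norm_cauchyKernel_le {z : ℂ} (hz : z.im ≠ 0) : ‖cauchyKernel z‖ ≤ |z.im|⁻¹ :=
  (BoundedContinuousFunction.norm_le (by positivity)).2 fun t => by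
    rw [cauchyKernel_apply hz]; exact norm_inv_sub_le hz t

lemma cauchyKernel_sub {z w : ℂ} (hz : z.im ≠ 0) (hw : w.im ≠ 0) :
    cauchyKernel z - cauchyKernel w = (z - w) • (cauchyKernel z * cauchyKernel w) := by
  ext t
  have h1 := sub_ne_zero_of_im hz t
  have h2 := sub_ne_zero_of_im hw t
  simp only [BoundedContinuousFunction.coe_sub, Pi.sub_apply, BoundedContinuousFunction.coe_smul,
    BoundedContinuousFunction.coe_mul, Pi.mul_apply, cauchyKernel_apply hz, cauchyKernel_apply hw,
    smul_eq_mul]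
  field_simp
  ring

lemma norm_cauchyKernel_sub_le {K : ℝ} (hK : 0 < K) {z w : ℂ} (hz : K ≤ |z.im|)
    (hw : K ≤ |w.im|) : ‖cauchyKernel z - cauchyKernel w‖ ≤ ‖z - w‖ * (K⁻¹ * K⁻¹) := by
  have hz' : z.im ≠ 0 := fun h => by simp [h] at hz; linarith
  have hw' : w.im ≠ 0 := fun h => by simp [h] at hw; linarith
  rw [cauchyKernel_sub hz' hw', norm_smul]
  gcongr
  refine (norm_mul_le _ _).trans ?_
  gcongr
  · exact (norm_cauchyKernel_le hz').trans (by gcongr)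
  · exact (norm_cauchyKernel_le hw').trans (by gcongr)

lemma star_cauchyKernel (z : ℂ) :
    star (cauchyKernel z) = cauchyKernel ((starRingEnd ℂ) z) := by
  by_cases hz : z.im ≠ 0
  · have hz' : ((starRingEnd ℂ) z).im ≠ 0 := by simpa using hz
    ext t
    simp [cauchyKernel_apply hz, cauchyKernel_apply hz']
  · have hz' : ¬ ((starRingEnd ℂ) z).im ≠ 0 := by simpa using hz
    rw [cauchyKernel, dif_neg hz, cauchyKernel, dif_neg hz', star_zero]

/-- The Cauchy kernels at distance at least `K` from the real axis. -/
def cauchyKernels (K : ℝ) : Set (ℝ →ᵇ ℂ) := cauchyKernel '' {z | K ≤ |z.im|}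

lemma star_cauchyKernels (K : ℝ) : star (cauchyKernels K) ⊆ cauchyKernels K := by
  rintro g ⟨z, hz, hg⟩
  refine ⟨(starRingEnd ℂ) z, by simpa using hz, ?_⟩
  rw [← star_cauchyKernel, hg, star_star]

/-- The closed span of the constants and the Cauchy kernels. -/
def cauchySpan (K : ℝ) : Submodule ℂ (ℝ →ᵇ ℂ) :=
  (Submodule.span ℂ (insert 1 (cauchyKernels K))).topologicalClosure

lemma one_mem_cauchySpan (K : ℝ) : (1 : ℝ →ᵇ ℂ) ∈ cauchySpan K :=
  Submodule.le_topologicalClosure _ (Submodule.subset_span (Set.mem_insert _ _))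

lemma cauchyKernel_mem_cauchySpan {K : ℝ} {z : ℂ} (hz : K ≤ |z.im|) :
    cauchyKernel z ∈ cauchySpan K :=
  Submodule.le_topologicalClosure _
    (Submodule.subset_span (Set.mem_insert_of_mem _ ⟨z, hz, rfl⟩))

lemma isClosed_cauchySpan (K : ℝ) : IsClosed (cauchySpan K : Set (ℝ →ᵇ ℂ)) :=
  Submodule.isClosed_topologicalClosure _

lemma cauchyKernel_mul_cauchyKernel_mem_of_ne {K : ℝ} (hK : 0 < K) {z w : ℂ} (hz : K ≤ |z.im|)
    (hw : K ≤ |w.im|) (h : z ≠ w) : cauchyKernel z * cauchyKernel w ∈ cauchySpan K := by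
  have hz' : z.im ≠ 0 := fun h => by simp [h] at hz; linarith
  have hw' : w.im ≠ 0 := fun h => by simp [h] at hw; linarith
  have : cauchyKernel z * cauchyKernel w = (z - w)⁻¹ • (cauchyKernel z - cauchyKernel w) := by
    rw [cauchyKernel_sub hz' hw', smul_smul, inv_mul_cancel₀ (sub_ne_zero.2 h), one_smul]
  rw [this]
  exact Submodule.smul_mem _ _ (Submodule.sub_mem _ (cauchyKernel_mem_cauchySpan hz)
    (cauchyKernel_mem_cauchySpan hw))

lemma cauchyKernel_mul_cauchyKernel_mem {K : ℝ} (hK : 0 < K) {z w : ℂ} (hz : K ≤ |z.im|)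
    (hw : K ≤ |w.im|) : cauchyKernel z * cauchyKernel w ∈ cauchySpan K := by
  by_cases h : z = w
  · subst h
    -- The square of a kernel is a limit of products with distinct poles; the shifts are real, so
    -- the poles keep their distance from the axis.
    have hlim : Tendsto (fun k : ℕ => cauchyKernel z * cauchyKernel (z + 1 / ((k : ℂ) + 1)))
        atTop (𝓝 (cauchyKernel z * cauchyKernel z)) := by
      refine Tendsto.const_mul _ ?_
      rw [tendsto_iff_norm_sub_tendsto_zero]
      have h0 : Tendsto (fun k : ℕ => ‖(1 : ℂ) / ((k : ℂ) + 1)‖ * (K⁻¹ * K⁻¹)) atTop (𝓝 0) := by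
        have := (tendsto_one_div_add_atTop_nhds_zero_nat (𝕜 := ℂ)).norm.mul_const (K⁻¹ * K⁻¹)
        simpa using this
      refine squeeze_zero (fun _ => norm_nonneg _) (fun k => ?_) h0
      refine (norm_cauchyKernel_sub_le hK ?_ hz).trans (by simp)
      have : ((1 : ℂ) / ((k : ℂ) + 1)).im = 0 := by
        have : (1 : ℂ) / ((k : ℂ) + 1) = ((1 / ((k : ℝ) + 1) : ℝ) : ℂ) := by push_cast; rfl
        rw [this, Complex.ofReal_im]
      rw [Complex.add_im, this, add_zero]
      exact hz
    refine (isClosed_cauchySpan K).mem_of_tendsto hlim (Eventually.of_forall fun k => ?_)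
    have him : ((1 : ℂ) / ((k : ℂ) + 1)).im = 0 := by
      have : (1 : ℂ) / ((k : ℂ) + 1) = ((1 / ((k : ℝ) + 1) : ℝ) : ℂ) := by push_cast; rfl
      rw [this, Complex.ofReal_im]
    refine cauchyKernel_mul_cauchyKernel_mem_of_ne hK hz ?_ ?_
    · rw [Complex.add_im, him, add_zero]
      exact hz
    · intro h
      have : (1 : ℂ) / ((k : ℂ) + 1) = 0 := by
        linear_combination -h
      exact one_div_ne_zero (Nat.cast_add_one_ne_zero k) this
  · exact cauchyKernel_mul_cauchyKernel_mem_of_ne hK hz hw h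

lemma cauchyKernel_mul_mem {K : ℝ} (hK : 0 < K) {z : ℂ} (hz : K ≤ |z.im|) {g : ℝ →ᵇ ℂ}
    (hg : g ∈ cauchySpan K) : cauchyKernel z * g ∈ cauchySpan K := by
  have hle : cauchySpan K ≤ (cauchySpan K).comap (LinearMap.mulLeft ℂ (cauchyKernel z)) := by
    refine Submodule.topologicalClosure_minimal _ (Submodule.span_le.2 ?_) ?_
    · rintro g (rfl | ⟨w, hw, rfl⟩)
      · simpa using cauchyKernel_mem_cauchySpan hz
      · exact cauchyKernel_mul_cauchyKernel_mem hK hz hw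
    · exact (isClosed_cauchySpan K).preimage (continuous_const.mul continuous_id)
  exact hle hg

/-- Kernels are closed under conjugation, and partial fractions keep their products in the closed
span. Convergence of integrals, a linear condition, therefore passes from kernels to the whole star
algebra. -/
lemma adjoin_cauchyKernels_subset {K : ℝ} (hK : 0 < K) {g : ℝ →ᵇ ℂ}
    (hg : g ∈ StarAlgebra.adjoin ℂ (cauchyKernels K)) : g ∈ cauchySpan K := by
  rw [← StarSubalgebra.mem_toSubalgebra, StarAlgebra.adjoin_toSubalgebra,
    Set.union_eq_self_of_subset_right (star_cauchyKernels K), ← Subalgebra.mem_toSubmodule,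
    Algebra.adjoin_eq_span] at hg
  refine Submodule.span_le.2 (fun f hf => ?_) hg
  induction hf using Submonoid.closure_induction_left with
  | one => exact one_mem_cauchySpan K
  | mul_left s hs y _ ih =>
    obtain ⟨z, hz, rfl⟩ := hs
    exact cauchyKernel_mul_mem hK hz ih

lemma separatesPoints_adjoin_cauchyKernels {K : ℝ} (hK : 0 < K) :
    ((StarAlgebra.adjoin ℂ (cauchyKernels K)).map
      (BoundedContinuousFunction.toContinuousMapStarₐ ℂ)).SeparatesPoints := by
  intro s t hst
  have hI : ((K : ℂ) * Complex.I).im = K := by simp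
  have hI' : ((K : ℂ) * Complex.I).im ≠ 0 := by rw [hI]; exact hK.ne'
  refine ⟨cauchyKernel (K * Complex.I), ⟨BoundedContinuousFunction.toContinuousMapStarₐ ℂ
    (cauchyKernel (K * Complex.I)), ⟨_, StarAlgebra.subset_adjoin ℂ _
      ⟨(K : ℂ) * Complex.I, ?_, rfl⟩, rfl⟩, rfl⟩, ?_⟩
  · simp [abs_of_pos hK]
  · rw [cauchyKernel_apply hI', cauchyKernel_apply hI']
    intro h
    have := sub_left_injective (inv_injective h)
    exact hst (by exact_mod_cast this)

lemma norm_integral_sub_le (ν : Measure ℝ) [IsProbabilityMeasure ν] (f g : ℝ →ᵇ ℂ) :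
    ‖(∫ t, f t ∂ν) - ∫ t, g t ∂ν‖ ≤ ‖f - g‖ := by
  rw [← integral_sub (f.integrable ν) (g.integrable ν)]
  have := (f - g).norm_integral_le_norm ν
  simpa using this

/-- The bounded continuous functions whose integrals converge. -/
def convergenceSubmodule (ν : ℕ → ProbabilityMeasure ℝ) (μ : ProbabilityMeasure ℝ) :
    Submodule ℂ (ℝ →ᵇ ℂ) where
  carrier := {g | Tendsto (fun j => ∫ t, g t ∂(ν j : Measure ℝ)) atTop
    (𝓝 (∫ t, g t ∂(μ : Measure ℝ)))}
  zero_mem' := by simp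
  add_mem' {f g} hf hg := by
    have h := hf.add hg
    have e : ∀ ν : ProbabilityMeasure ℝ, ∫ t, (f + g) t ∂(ν : Measure ℝ) =
        ∫ t, f t ∂(ν : Measure ℝ) + ∫ t, g t ∂(ν : Measure ℝ) := fun ν =>
      integral_add (f.integrable _) (g.integrable _)
    simpa only [Set.mem_ofPred_eq, e] using h
  smul_mem' c g hg := by
    have h := hg.const_mul c
    have e : ∀ ν : ProbabilityMeasure ℝ, ∫ t, (c • g) t ∂(ν : Measure ℝ) =
        c * ∫ t, g t ∂(ν : Measure ℝ) := fun ν => integral_const_mul c _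
    simpa only [Set.mem_ofPred_eq, e] using h

lemma isClosed_convergenceSubmodule (ν : ℕ → ProbabilityMeasure ℝ) (μ : ProbabilityMeasure ℝ) :
    IsClosed (convergenceSubmodule ν μ : Set (ℝ →ᵇ ℂ)) := by
  refine isClosed_of_closure_subset fun g hg => ?_
  refine Metric.tendsto_atTop.2 fun ε hε => ?_
  obtain ⟨h, hh, hd⟩ := Metric.mem_closure_iff.1 hg (ε / 3) (by positivity)
  obtain ⟨N, hN⟩ := Metric.tendsto_atTop.1 hh (ε / 3) (by positivity)
  refine ⟨N, fun j hj => ?_⟩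
  have h1 := hN j hj
  have h2 := norm_integral_sub_le (ν j : Measure ℝ) g h
  have h3 := norm_integral_sub_le (μ : Measure ℝ) h g
  rw [dist_eq_norm] at hd h1 ⊢
  rw [norm_sub_rev h g] at h3
  calc _ = ‖((∫ t, g t ∂(ν j : Measure ℝ)) - ∫ t, h t ∂(ν j : Measure ℝ)) +
        ((∫ t, h t ∂(ν j : Measure ℝ)) - ∫ t, h t ∂(μ : Measure ℝ)) +
        ((∫ t, h t ∂(μ : Measure ℝ)) - ∫ t, g t ∂(μ : Measure ℝ))‖ := by congr 1; ring
    _ < ε := by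
      refine (norm_add₃_le).trans_lt ?_
      linarith

/-- A countable dense set of points of the half plane `K ≤ im z`. -/
def ratPoint (K : ℝ) (a b : ℚ) : ℂ := ⟨a, K + |(b : ℝ)|⟩

lemma le_im_ratPoint (K : ℝ) (a b : ℚ) : K ≤ (ratPoint K a b).im :=
  le_add_of_nonneg_right (abs_nonneg _)

lemma exists_ratPoint_near {K : ℝ} {z : ℂ} (hz : K ≤ z.im) {ε : ℝ} (hε : 0 < ε) :
    ∃ a b : ℚ, ‖ratPoint K a b - z‖ < ε := by
  obtain ⟨a, ha⟩ := exists_rat_near z.re (half_pos hε)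
  obtain ⟨b, hb⟩ := exists_rat_near (z.im - K) (half_pos hε)
  refine ⟨a, b, (Complex.norm_le_abs_re_add_abs_im _).trans_lt ?_⟩
  have h1 : |(ratPoint K a b - z).re| = |z.re - a| := by
    rw [abs_sub_comm]; simp [ratPoint]
  have h2 : |(ratPoint K a b - z).im| ≤ |z.im - K - b| := by
    have : (ratPoint K a b - z).im = |(b : ℝ)| - |z.im - K| := by
      rw [abs_of_nonneg (sub_nonneg.2 hz)]; simp [ratPoint]; ring
    rw [this, abs_sub_comm (z.im - K)]
    exact abs_abs_sub_abs_le _ _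
  linarith

/-- Kernels depend continuously in sup norm on the pole, so a countable dense set of poles suffices
in the upper half plane; conjugation gives the lower one. -/
lemma cauchySpan_le_convergenceSubmodule {K : ℝ} (hK : 0 < K) {ν : ℕ → ProbabilityMeasure ℝ}
    {μ : ProbabilityMeasure ℝ}
    (h : ∀ a b : ℚ, cauchyKernel (ratPoint K a b) ∈ convergenceSubmodule ν μ) :
    cauchySpan K ≤ convergenceSubmodule ν μ := by
  have hup : ∀ z : ℂ, K ≤ z.im → cauchyKernel z ∈ convergenceSubmodule ν μ := by
    intro z hz
    refine (isClosed_convergenceSubmodule ν μ).closure_subset (Metric.mem_closure_iff.2 ?_)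
    intro ε hε
    obtain ⟨a, b, hab⟩ := exists_ratPoint_near hz (ε := ε * (K * K)) (by positivity)
    refine ⟨_, h a b, ?_⟩
    rw [dist_comm, dist_eq_norm]
    refine (norm_cauchyKernel_sub_le hK ((le_im_ratPoint K a b).trans (le_abs_self _))
      (hz.trans (le_abs_self _))).trans_lt ?_
    calc _ < ε * (K * K) * (K⁻¹ * K⁻¹) := by gcongr
      _ = ε := by field_simp
  refine Submodule.topologicalClosure_minimal _ (Submodule.span_le.2 ?_)
    (isClosed_convergenceSubmodule ν μ)
  rintro g (rfl | ⟨z, hz, rfl⟩)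
  · change Tendsto _ _ _
    simp
  · rcases le_abs.1 (show K ≤ |z.im| from hz) with hz | hz
    · exact hup z hz
    · have h1 := hup ((starRingEnd ℂ) z) (by simpa using hz)
      rw [← star_cauchyKernel] at h1
      have h2 := (Complex.continuous_conj.tendsto _).comp h1
      refine Tendsto.congr (fun j => ?_) (h2.trans (le_of_eq (congrArg 𝓝 ?_)))
      · simp [← integral_conj]
      · simp [← integral_conj]

/-! ### Tightness and limits from Stieltjes transforms. -/

/-- At z = iy the real part of 1 + z/(t - z) is t²/(t² + y²), which is at least 1/2 when |t| > y. -/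
lemma measure_norm_gt_le (ν : Measure ℝ) [IsProbabilityMeasure ν] {y : ℝ} (hy : 0 < y) :
    ν {t | y < ‖t‖} ≤ ENNReal.ofReal (2 * ‖1 + (⟨0, y⟩ : ℂ) * stieltjes ν ⟨0, y⟩‖) := by
  set z : ℂ := ⟨0, y⟩ with hz
  have hzi : z.im ≠ 0 := hy.ne'
  have hint : Integrable (fun t : ℝ => ((t : ℂ) - z)⁻¹) ν :=
    ((cauchyKernel z).integrable ν).congr (ae_of_all _ fun t => cauchyKernel_apply hzi t)
  have e : 1 + z * stieltjes ν z = ∫ t : ℝ, (1 + z * ((t : ℂ) - z)⁻¹) ∂ν := by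
    rw [integral_add (integrable_const _) (hint.const_mul z), integral_const_mul]
    simp [stieltjes]
  have hint' : Integrable (fun t : ℝ => 1 + z * ((t : ℂ) - z)⁻¹) ν :=
    (integrable_const _).add (hint.const_mul z)
  have hre : ∀ t : ℝ, (1 + z * ((t : ℂ) - z)⁻¹).re = t ^ 2 / (t ^ 2 + y ^ 2) := by
    intro t
    have h1 : ((t : ℂ) - z) ≠ 0 := sub_ne_zero_of_im hzi t
    have h0 : t ^ 2 + y ^ 2 ≠ 0 := by positivity
    simp only [Complex.add_re, Complex.one_re, Complex.mul_re, Complex.inv_re, Complex.inv_im,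
      Complex.sub_re, Complex.sub_im, Complex.ofReal_re, Complex.ofReal_im, Complex.normSq_apply, hz]
    have h2 : t * t + y * y ≠ 0 := by simpa [sq] using h0
    simp
    field_simp
    ring
  have hm : ν.real {t | y < ‖t‖} ≤ 2 * (1 + z * stieltjes ν z).re := by
    have hset : MeasurableSet {t : ℝ | y < ‖t‖} := measurableSet_lt measurable_const measurable_norm
    rw [e, show (∫ t : ℝ, (1 + z * ((t : ℂ) - z)⁻¹) ∂ν).re =
      ∫ t : ℝ, (1 + z * ((t : ℂ) - z)⁻¹).re ∂ν from (integral_re hint').symm,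
      ← integral_const_mul, ← integral_indicator_one hset]
    refine integral_mono ((integrable_const (1 : ℝ)).indicator hset) (hint'.re.const_mul 2) ?_
    intro t
    have hre' := hre t
    by_cases ht : y < ‖t‖
    · have : y ^ 2 ≤ t ^ 2 := by
        rw [Real.norm_eq_abs] at ht
        rw [← sq_abs t]; gcongr
      simp only [Set.indicator_of_mem (show t ∈ {t : ℝ | y < ‖t‖} from ht), Pi.one_apply]
      change 1 ≤ 2 * (1 + z * ((t : ℂ) - z)⁻¹).re
      rw [hre', ← mul_div_assoc, le_div_iff₀ (by positivity)]
      linarith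
    · rw [Set.indicator_of_notMem (show t ∉ {t : ℝ | y < ‖t‖} from ht)]
      change 0 ≤ 2 * (1 + z * ((t : ℂ) - z)⁻¹).re
      rw [hre']; positivity
  rw [← ofReal_measureReal]
  refine ENNReal.ofReal_le_ofReal (hm.trans ?_)
  gcongr
  exact Complex.re_le_norm _

lemma isTightMeasureSet_of_tendsto_stieltjes {K : ℝ} (hK : 0 < K) {ν : ℕ → ProbabilityMeasure ℝ}
    {w : ℂ → ℂ}
    (hw : ∀ b : ℚ, Tendsto (fun j => stieltjes (ν j) (ratPoint K 0 b)) atTop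
      (𝓝 (w (ratPoint K 0 b))))
    (hw' : ∀ ε : ℝ, 0 < ε → ∃ b : ℚ, ‖1 + ratPoint K 0 b * w (ratPoint K 0 b)‖ < ε) :
    IsTightMeasureSet (Set.range fun j => (ν j : Measure ℝ)) := by
  refine isTightMeasureSet_range_of_tendsto_limsup_measure_norm_gt ?_
  rw [ENNReal.tendsto_nhds_zero]
  intro ε hε
  obtain ⟨δ, -, hδ0, hδ⟩ : ∃ δ : ℝ, 0 ≤ δ ∧ 0 < δ ∧ ENNReal.ofReal (2 * δ) ≤ ε := by
    obtain ⟨r, hr0, hr⟩ := ENNReal.lt_iff_exists_real_btwn.1 hε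
    have hr' : 0 < r := by simpa using hr.1
    exact ⟨r / 2, by positivity, by positivity, by rw [mul_div_cancel₀ _ two_ne_zero]; exact hr.2.le⟩
  obtain ⟨b, hb⟩ := hw' δ hδ0
  have hy : 0 < K + |(b : ℝ)| := by positivity
  have hlim : Tendsto (fun j => ENNReal.ofReal
      (2 * ‖1 + ratPoint K 0 b * stieltjes (ν j) (ratPoint K 0 b)‖)) atTop
      (𝓝 (ENNReal.ofReal (2 * ‖1 + ratPoint K 0 b * w (ratPoint K 0 b)‖))) :=
    ENNReal.tendsto_ofReal ((((hw b).const_mul _).const_add 1).norm.const_mul 2)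
  have e : ratPoint K 0 b = ⟨0, K + |(b : ℝ)|⟩ := by simp [ratPoint]
  filter_upwards [eventually_ge_atTop (K + |(b : ℝ)|)] with r hr
  calc limsup (fun j => (ν j : Measure ℝ) {x | r < ‖x‖}) atTop
      ≤ limsup (fun j => ENNReal.ofReal
        (2 * ‖1 + ratPoint K 0 b * stieltjes (ν j) (ratPoint K 0 b)‖)) atTop := by
        refine limsup_le_limsup (Eventually.of_forall fun j => ?_)
        rw [e]
        exact (measure_mono fun t ht => lt_of_le_of_lt hr ht).trans (measure_norm_gt_le _ hy)
    _ = _ := hlim.limsup_eq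
    _ ≤ ENNReal.ofReal (2 * δ) := ENNReal.ofReal_le_ofReal (by linarith)
    _ ≤ ε := hδ

lemma tendsto_of_tendsto_stieltjes {K : ℝ} (hK : 0 < K) {ν : ℕ → ProbabilityMeasure ℝ}
    {μ : ProbabilityMeasure ℝ} (htight : IsTightMeasureSet (Set.range fun j => (ν j : Measure ℝ)))
    (hw : ∀ a b : ℚ, Tendsto (fun j => stieltjes (ν j) (ratPoint K a b)) atTop
      (𝓝 (stieltjes μ (ratPoint K a b)))) : Tendsto ν atTop (𝓝 μ) := by
  refine ProbabilityMeasure.tendsto_of_tight_of_separatesPoints ℂ (by simpa [Set.range] using htight)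
    (separatesPoints_adjoin_cauchyKernels hK) fun g hg => ?_
  refine cauchySpan_le_convergenceSubmodule hK (fun a b => ?_) (adjoin_cauchyKernels_subset hK hg)
  have hz : (ratPoint K a b).im ≠ 0 := (hK.trans_le (le_im_ratPoint K a b)).ne'
  change Tendsto _ _ _
  simpa only [integral_cauchyKernel hz] using hw a b

/-- Prokhorov's theorem gives a limit point, taken along an ultrafilter instead of a subsequence;
its transform is the limit of the transforms. -/
lemma exists_probabilityMeasure_stieltjes_eq {K : ℝ} (hK : 0 < K) {ν : ℕ → ProbabilityMeasure ℝ}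
    (htight : IsTightMeasureSet (Set.range fun j => (ν j : Measure ℝ))) {w : ℂ → ℂ}
    (hw : ∀ a b : ℚ, Tendsto (fun j => stieltjes (ν j) (ratPoint K a b)) atTop
      (𝓝 (w (ratPoint K a b)))) :
    ∃ μ : ProbabilityMeasure ℝ, ∀ a b : ℚ, stieltjes μ (ratPoint K a b) = w (ratPoint K a b) := by
  have hc : IsCompact (closure (Set.range ν)) := by
    refine isCompact_closure_of_isTightMeasureSet ?_
    convert htight using 1
    ext; simp
  obtain ⟨μ, -, hμ⟩ := hc.ultrafilter_le_nhds ((Ultrafilter.of atTop).map ν)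
    (le_principal_iff.2 (Filter.mem_of_superset (Filter.range_mem_map) subset_closure))
  refine ⟨μ, fun a b => ?_⟩
  have hz : (ratPoint K a b).im ≠ 0 := (hK.trans_le (le_im_ratPoint K a b)).ne'
  have hμ' : Tendsto ν ((Ultrafilter.of atTop : Ultrafilter ℕ) : Filter ℕ) (𝓝 μ) := hμ
  have h1 := (ProbabilityMeasure.tendsto_iff_forall_integral_rclike_tendsto ℂ).1 hμ'
    (cauchyKernel (ratPoint K a b))
  simp only [integral_cauchyKernel hz] at h1
  exact tendsto_nhds_unique h1 ((hw a b).mono_left (Ultrafilter.of_le _))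

/-! ### From convergence in probability to deterministic sequences. -/

/-- The spaces are unrelated, so sample points are chosen one n at a time instead of almost surely.
For infinitely many n the set B n has mass above δ, while the first j + 1 exceptional events at
level 1/(j + 1) have total mass at most δ; some point of B n avoids them all. -/
lemma exists_seq_of_tendsto_measure_zero {Ω : ℕ → Type*} [∀ n, MeasurableSpace (Ω n)]
    (P : ∀ n, Measure (Ω n)) {X : ℕ → ∀ n, Ω n → ℝ}
    (hX : ∀ k, ∀ ε : ℝ, 0 < ε → Tendsto (fun n => P n {ω | ε ≤ X k n ω}) atTop (𝓝 0))
    {B : ∀ n, Set (Ω n)} (hB : ¬ Tendsto (fun n => P n (B n)) atTop (𝓝 0)) (N : ℕ) :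
    ∃ φ : ℕ → ℕ, StrictMono φ ∧ (∀ j, N ≤ φ j) ∧ ∃ ω : ∀ j, Ω (φ j), (∀ j, ω j ∈ B (φ j)) ∧
      ∀ k, ∀ ε : ℝ, 0 < ε → ∀ᶠ j in atTop, X k (φ j) (ω j) < ε := by
  rw [ENNReal.tendsto_nhds_zero] at hB
  push Not at hB
  obtain ⟨δ, hδ, hB⟩ := hB
  have hfreq : ∀ j : ℕ, ∃ᶠ n in atTop, N ≤ n ∧
      ∃ ω ∈ B n, ∀ k ∈ Finset.range (j + 1), X k n ω < 1 / ((j : ℝ) + 1) := by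
    intro j
    have hsum : Tendsto (fun n => ∑ k ∈ Finset.range (j + 1),
        P n {ω | 1 / ((j : ℝ) + 1) ≤ X k n ω}) atTop (𝓝 0) := by
      have := tendsto_finsetSum (Finset.range (j + 1))
        fun k _ => hX k (1 / ((j : ℝ) + 1)) (by positivity)
      simpa using this
    refine (hB.and_eventually (((ENNReal.tendsto_nhds_zero.1 hsum) δ hδ).and
      (eventually_ge_atTop N))).mono ?_
    rintro n ⟨h1, h2, h3⟩
    refine ⟨h3, ?_⟩
    by_contra! hcon
    refine absurd (h1.trans_le ((measure_mono ?_).trans ((measure_biUnion_finset_le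
      (Finset.range (j + 1)) fun k => {ω | 1 / ((j : ℝ) + 1) ≤ X k n ω}).trans h2))) (lt_irrefl _)
    intro ω hω
    obtain ⟨k, hk, hk'⟩ := hcon ω hω
    exact Set.mem_biUnion hk hk'
  obtain ⟨φ, hφ, hφ'⟩ := Filter.extraction_forall_of_frequently hfreq
  choose hN ω hω hω' using hφ'
  refine ⟨φ, hφ, hN, ω, hω, fun k ε hε => ?_⟩
  obtain ⟨M, hM⟩ := exists_nat_one_div_lt hε
  filter_upwards [eventually_ge_atTop (max k M)] with j hj
  refine (hω' j k (Finset.mem_range.2 (by have := le_of_max_le_left hj; omega))).trans (lt_of_le_of_lt ?_ hM)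
  have : (M : ℝ) ≤ j := by exact_mod_cast le_of_max_le_right hj
  gcongr

/-- Convergence in probability of the Stieltjes transforms at the points of a half plane to a
function with `1 + z w(z)` small at infinity implies weak convergence in probability. -/
theorem exists_convergesInProbability {Ω : ℕ → Type*} [∀ n, MeasurableSpace (Ω n)]
    (P : ∀ n, Measure (Ω n)) [∀ n, IsProbabilityMeasure (P n)] {N : ∀ n, Ω n → Measure ℝ}
    {n₀ : ℕ} (hN : ∀ n, n₀ ≤ n → ∀ ω, IsProbabilityMeasure (N n ω)) {K : ℝ} (hK : 0 < K)
    {w : ℂ → ℂ}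
    (hw : ∀ z : ℂ, K ≤ z.im → ∀ ε : ℝ, 0 < ε →
      Tendsto (fun n => P n {ω | ε ≤ ‖stieltjes (N n ω) z - w z‖}) atTop (𝓝 0))
    (hw' : ∀ ε : ℝ, 0 < ε → ∃ b : ℚ, ‖1 + ratPoint K 0 b * w (ratPoint K 0 b)‖ < ε) :
    ∃ μ : ProbabilityMeasure ℝ, ConvergesInProbability P N μ ∧
      ∀ a b : ℚ, stieltjes μ (ratPoint K a b) = w (ratPoint K a b) := by
  obtain ⟨e⟩ : Nonempty (ℕ ≃ ℚ × ℚ) := ⟨(Denumerable.eqv (ℚ × ℚ)).symm⟩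
  have hseq : ∀ B : ∀ n, Set (Ω n), ¬ Tendsto (fun n => P n (B n)) atTop (𝓝 0) →
      ∃ φ : ℕ → ℕ, StrictMono φ ∧ ∃ ω : ∀ j, Ω (φ j), (∀ j, ω j ∈ B (φ j)) ∧
      ∃ ν : ℕ → ProbabilityMeasure ℝ, (∀ j, (ν j : Measure ℝ) = N (φ j) (ω j)) ∧
        ∀ a b : ℚ, Tendsto (fun j => stieltjes (ν j) (ratPoint K a b)) atTop
          (𝓝 (w (ratPoint K a b))) := by
    intro B hB
    obtain ⟨φ, hφ, hφN, ω, hω, hlim⟩ := exists_seq_of_tendsto_measure_zero P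
      (X := fun k n ω => ‖stieltjes (N n ω) (ratPoint K (e k).1 (e k).2) -
        w (ratPoint K (e k).1 (e k).2)‖) (fun k ε hε => hw _ (le_im_ratPoint _ _ _) ε hε) hB n₀
    refine ⟨φ, hφ, ω, hω, fun j => ⟨N (φ j) (ω j), hN _ (hφN j) _⟩, fun j => rfl, fun a b => ?_⟩
    have h := hlim (e.symm (a, b))
    simp only [Equiv.apply_symm_apply] at h
    refine Metric.tendsto_nhds.2 fun ε hε => ?_
    filter_upwards [h ε hε] with j hj
    rwa [dist_eq_norm]
  -- The whole space as B yields one realized sequence of measures with convergent transforms, from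
  -- which μ is built.
  obtain ⟨φ, -, ω, -, ν, -, hν⟩ := hseq (fun _ => Set.univ) (by
    simp only [measure_univ]
    intro h
    exact one_ne_zero (tendsto_nhds_unique tendsto_const_nhds h))
  obtain ⟨μ, hμ⟩ := exists_probabilityMeasure_stieltjes_eq hK
    (isTightMeasureSet_of_tendsto_stieltjes hK (fun b => hν 0 b) hw') hν
  refine ⟨μ, fun f ε hε => ?_, hμ⟩
  by_contra hcon
  -- Here B is the deviation event. The realized measures converge weakly to μ yet stay ε away on f,
  -- a contradiction.
  obtain ⟨φ, -, ω, hω, ν, hνN, hν⟩ := hseq _ hcon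
  have hlim : Tendsto ν atTop (𝓝 μ) := tendsto_of_tendsto_stieltjes hK
    (isTightMeasureSet_of_tendsto_stieltjes hK (fun b => hν 0 b) hw') fun a b => by
      rw [hμ]; exact hν a b
  have h1 := (ProbabilityMeasure.tendsto_iff_forall_integral_tendsto.1 hlim) f
  obtain ⟨j, hj⟩ := ((Metric.tendsto_nhds.1 h1) ε hε).exists
  have h2 : ε ≤ |(∫ t, f t ∂(N (φ j) (ω j))) - ∫ t, f t ∂(μ : Measure ℝ)| := hω j
  rw [hνN, Real.dist_eq] at hj
  exact absurd hj (not_lt.2 h2)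

end

noncomputable section

/-! ### Analyticity, decay and uniqueness of Stieltjes transforms. -/

/-- A domination locally uniform in the pole, which lets measures of infinite mass be treated like
finite ones. -/
lemma norm_inv_sub_le_mul {δ R : ℝ} (hδ : 0 < δ) {w : ℂ} (hw : δ ≤ |w.im|) (hR : ‖w‖ ≤ R) (t : ℝ) :
    ‖((t : ℂ) - w)⁻¹‖ ≤ ((1 + R) / δ + 1) * (1 + |t|)⁻¹ := by
  have h1 : δ ≤ ‖(t : ℂ) - w‖ := hw.trans (abs_im_le_norm_sub w t)
  have h2 : |t| ≤ ‖(t : ℂ) - w‖ + ‖w‖ := by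
    have := norm_add_le ((t : ℂ) - w) w
    rwa [sub_add_cancel, Complex.norm_real, Real.norm_eq_abs] at this
  have hR0 : 0 ≤ R := (norm_nonneg _).trans hR
  rw [norm_inv, ← div_eq_mul_inv, inv_le_comm₀ (hδ.trans_le h1) (by positivity), inv_div,
    div_le_iff₀ (by positivity)]
  have h3 : 1 + R ≤ ‖(t : ℂ) - w‖ * ((1 + R) / δ) := by
    calc 1 + R = δ * ((1 + R) / δ) := by field_simp
      _ ≤ _ := by gcongr
  linarith

lemma continuous_inv_sub {z : ℂ} (hz : z.im ≠ 0) : Continuous fun t : ℝ => ((t : ℂ) - z)⁻¹ :=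
  Continuous.inv₀ (by fun_prop) (sub_ne_zero_of_im hz)

lemma integrable_inv_sub {ν : Measure ℝ} (hν : Integrable (fun t : ℝ => (1 + |t|)⁻¹) ν) {z : ℂ}
    (hz : z.im ≠ 0) : Integrable (fun t : ℝ => ((t : ℂ) - z)⁻¹) ν :=
  (hν.const_mul _).mono' (continuous_inv_sub hz).aestronglyMeasurable
    (ae_of_all _ (norm_inv_sub_le_mul (abs_pos.2 hz) le_rfl le_rfl))

lemma differentiableAt_stieltjes {ν : Measure ℝ} (hν : Integrable (fun t : ℝ => (1 + |t|)⁻¹) ν)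
    {z : ℂ} (hz : z.im ≠ 0) : DifferentiableAt ℂ (stieltjes ν) z := by
  set δ : ℝ := |z.im| / 2 with hδ
  have hδ0 : 0 < δ := by have := abs_pos.2 hz; positivity
  have him : ∀ w ∈ Metric.ball z δ, δ ≤ |w.im| := fun w hw => by
    rw [Metric.mem_ball, dist_eq_norm] at hw
    have h1 := Complex.abs_im_le_norm (w - z)
    have h2 := abs_sub_abs_le_abs_sub z.im w.im
    rw [Complex.sub_im, abs_sub_comm] at h1
    linarith
  have hne : ∀ w ∈ Metric.ball z δ, w.im ≠ 0 := fun w hw h => by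
    have := him w hw
    rw [h, abs_zero] at this
    linarith
  have hR : ∀ w ∈ Metric.ball z δ, ‖w‖ ≤ ‖z‖ + δ := fun w hw => by
    rw [Metric.mem_ball, dist_eq_norm] at hw
    have := norm_add_le (w - z) z
    rw [sub_add_cancel] at this
    linarith
  have hmem : Metric.ball z δ ∈ 𝓝 z := Metric.ball_mem_nhds z hδ0
  refine (hasDerivAt_integral_of_dominated_loc_of_deriv_le (μ := ν)
    (F := fun w (t : ℝ) => ((t : ℂ) - w)⁻¹) (F' := fun w t => (((t : ℂ) - w)⁻¹) ^ 2)
    (bound := fun t => δ⁻¹ * (((1 + (‖z‖ + δ)) / δ + 1) * (1 + |t|)⁻¹)) hmem ?_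
    (integrable_inv_sub hν hz) ((continuous_inv_sub hz).pow 2).aestronglyMeasurable ?_
    ((hν.const_mul _).const_mul _) ?_).2.differentiableAt
  · filter_upwards [hmem] with w hw
    exact (continuous_inv_sub (hne w hw)).aestronglyMeasurable
  · refine ae_of_all _ fun t w hw => ?_
    rw [norm_pow, sq]
    gcongr
    · exact (norm_inv_sub_le (hne w hw) t).trans (by gcongr; exact him w hw)
    · exact norm_inv_sub_le_mul hδ0 (him w hw) (hR w hw) t
  · refine ae_of_all _ fun t w hw => ?_
    have h0 := sub_ne_zero_of_im (hne w hw) t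
    have h := ((hasDerivAt_id w).const_sub (t : ℂ)).inv h0
    refine h.congr_deriv ?_
    simp [div_eq_mul_inv]

lemma analyticOnNhd_stieltjes {ν : Measure ℝ} (hν : Integrable (fun t : ℝ => (1 + |t|)⁻¹) ν) :
    AnalyticOnNhd ℂ (stieltjes ν) {z | 0 < z.im} :=
  DifferentiableOn.analyticOnNhd (fun _ hz => (differentiableAt_stieltjes hν
    (ne_of_gt hz)).differentiableWithinAt) (isOpen_lt continuous_const Complex.continuous_im)

lemma stieltjes_conj (ν : Measure ℝ) (z : ℂ) :
    stieltjes ν ((starRingEnd ℂ) z) = (starRingEnd ℂ) (stieltjes ν z) := by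
  rw [stieltjes, stieltjes, ← integral_conj]
  simp

/-- Dominated convergence. No rate is available when the mass is infinite, but uniqueness only needs
the transform to become small. -/
lemma tendsto_stieltjes_atTop {ν : Measure ℝ} (hν : Integrable (fun t : ℝ => (1 + |t|)⁻¹) ν) :
    Tendsto (fun y : ℝ => stieltjes ν ⟨0, y⟩) atTop (𝓝 0) := by
  have h := tendsto_integral_filter_of_dominated_convergence (μ := ν) (l := atTop)
    (F := fun (y : ℝ) (t : ℝ) => ((t : ℂ) - (⟨0, y⟩ : ℂ))⁻¹) (f := fun _ => 0)
    (fun t => 2 * (1 + |t|)⁻¹) ?_ ?_ (hν.const_mul 2) ?_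
  · simpa [stieltjes] using h
  · filter_upwards [eventually_gt_atTop 0] with y hy
    exact (continuous_inv_sub (z := ⟨0, y⟩) hy.ne').aestronglyMeasurable
  · filter_upwards [eventually_ge_atTop 1] with y hy
    refine ae_of_all _ fun t => ?_
    have h1 : y ≤ ‖(t : ℂ) - (⟨0, y⟩ : ℂ)‖ :=
      (le_abs_self y).trans (abs_im_le_norm_sub ⟨0, y⟩ t)
    have h2 : |t| ≤ ‖(t : ℂ) - (⟨0, y⟩ : ℂ)‖ := by
      simpa using Complex.abs_re_le_norm ((t : ℂ) - (⟨0, y⟩ : ℂ))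
    rw [norm_inv, ← div_eq_mul_inv, inv_le_comm₀ (by linarith) (by positivity), inv_div,
      div_le_iff₀ two_pos]
    linarith
  · refine ae_of_all _ fun t => ?_
    refine squeeze_zero_norm' ?_ tendsto_inv_atTop_zero
    filter_upwards [eventually_gt_atTop 0] with y hy
    simpa [abs_of_pos hy] using norm_inv_sub_le (z := ⟨0, y⟩) hy.ne' t

lemma eq_zero_of_eq_zero_on_imaginary_seq {F : ℂ → ℂ} (hF : AnalyticOnNhd ℂ F {z | 0 < z.im})
    {Y : ℝ} (hY : 0 < Y) (h : ∀ k : ℕ, F ⟨0, Y + 1 / ((k : ℝ) + 1)⟩ = 0) {z : ℂ} (hz : 0 < z.im) :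
    F z = 0 := by
  have hconn : IsPreconnected {z : ℂ | 0 < z.im} := (convex_halfSpace_im_gt 0).isPreconnected
  refine hF.eqOn_zero_of_preconnected_of_frequently_eq_zero (z₀ := ⟨0, Y⟩) hconn hY ?_ hz
  have hlim : Tendsto (fun k : ℕ => (⟨0, Y + 1 / ((k : ℝ) + 1)⟩ : ℂ)) atTop (𝓝[≠] ⟨0, Y⟩) := by
    refine tendsto_nhdsWithin_iff.2 ⟨?_, Eventually.of_forall fun k hk => ?_⟩
    · have h1 : Tendsto (fun k : ℕ => Y + 1 / ((k : ℝ) + 1)) atTop (𝓝 (Y + 0)) :=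
        tendsto_one_div_add_atTop_nhds_zero_nat.const_add Y
      rw [add_zero] at h1
      have h2 := (Complex.continuous_ofReal.tendsto Y).comp h1
      have h3 := h2.mul_const Complex.I
      have e : ∀ r : ℝ, (⟨0, r⟩ : ℂ) = (r : ℂ) * Complex.I := fun r => by
        apply Complex.ext <;> simp
      simp only [e]
      exact h3
    · have h1 : Y + 1 / ((k : ℝ) + 1) = Y := congrArg Complex.im hk
      have h2 : 0 < 1 / ((k : ℝ) + 1) := by positivity
      linarith
  exact hlim.frequently (Frequently.of_forall h)

lemma solvesCubic_stieltjes {c : ℝ} {μ : Measure ℝ}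
    (hμ : Integrable (fun t : ℝ => (1 + |t|)⁻¹) μ) {Y : ℝ} (hY : 0 < Y)
    (h : ∀ k : ℕ, ∀ z : ℂ, z = ⟨0, Y + 1 / ((k : ℝ) + 1)⟩ →
      z * stieltjes μ z ^ 3 + (1 - 2 * (c : ℂ)) * stieltjes μ z ^ 2 - z * stieltjes μ z - 1 = 0) :
    SolvesCubic c (stieltjes μ) := by
  have hS := analyticOnNhd_stieltjes hμ
  have hid : AnalyticOnNhd ℂ (fun z : ℂ => z) {z | 0 < z.im} := fun _ _ => analyticAt_id
  have hup : ∀ z : ℂ, 0 < z.im → z * stieltjes μ z ^ 3 + (1 - 2 * (c : ℂ)) * stieltjes μ z ^ 2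
      - z * stieltjes μ z - 1 = 0 := fun z hz =>
    eq_zero_of_eq_zero_on_imaginary_seq ((((hid.mul (hS.pow 3)).add
      (analyticOnNhd_const.mul (hS.pow 2))).sub (hid.mul hS)).sub analyticOnNhd_const) hY
      (fun k => h k _ rfl) hz
  intro z hz
  rcases lt_or_gt_of_ne hz with hz | hz
  · have h1 := hup ((starRingEnd ℂ) z) (by simpa using hz)
    rw [stieltjes_conj] at h1
    have h2 := congrArg (starRingEnd ℂ) h1
    simpa [Complex.conj_ofNat] using h2
  · exact hup z hz

/-- High on the imaginary axis both transforms lie in the disc where the cubic has at most one root.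
They agree there, and analytic continuation and conjugation do the rest. -/
lemma stieltjes_eq_of_solvesCubic {c : ℝ} (hc : 0 ≤ c) {μ ν : Measure ℝ}
    (hμ : Integrable (fun t : ℝ => (1 + |t|)⁻¹) μ) (hν : Integrable (fun t : ℝ => (1 + |t|)⁻¹) ν)
    (hμc : SolvesCubic c (stieltjes μ)) (hνc : SolvesCubic c (stieltjes ν)) {z : ℂ}
    (hz : z.im ≠ 0) : stieltjes ν z = stieltjes μ z := by
  have hsmall : ∀ ν : Measure ℝ, Integrable (fun t : ℝ => (1 + |t|)⁻¹) ν →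
      ∀ᶠ y : ℝ in atTop, ‖stieltjes ν ⟨0, y⟩‖ ≤ 1 / 64 := fun ν hν => by
    have h1 := (tendsto_stieltjes_atTop hν).norm
    rw [norm_zero] at h1
    exact h1.eventually_le_const (by norm_num)
  obtain ⟨Y, hY⟩ := eventually_atTop.1 ((hsmall μ hμ).and
    ((hsmall ν hν).and (eventually_ge_atTop (c + 1))))
  have heq : ∀ y, Y ≤ y → stieltjes ν ⟨0, y⟩ - stieltjes μ ⟨0, y⟩ = 0 := fun y hy => by
    obtain ⟨h1, h2, h3⟩ := hY y hy
    have hy0 : 0 < y := by linarith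
    have hn : c + 1 ≤ ‖(⟨0, y⟩ : ℂ)‖ :=
      h3.trans ((le_abs_self y).trans (Complex.abs_im_le_norm ⟨0, y⟩))
    have e1 := (selfEq_eq_zero_iff h1).2 (hμc ⟨0, y⟩ hy0.ne')
    have e2 := (selfEq_eq_zero_iff h2).2 (hνc ⟨0, y⟩ hy0.ne')
    have := norm_sub_le_of_selfEq_eq_zero hc hn h2 h1 e1
    rwa [e2, norm_zero, norm_le_zero_iff] at this
  have hY1 : 0 < Y := by linarith [(hY Y le_rfl).2.2]
  have hup : ∀ z : ℂ, 0 < z.im → stieltjes ν z = stieltjes μ z := fun z hz =>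
    sub_eq_zero.1 (eq_zero_of_eq_zero_on_imaginary_seq
      ((analyticOnNhd_stieltjes hν).sub (analyticOnNhd_stieltjes hμ)) hY1
      (fun k => heq _ (le_add_of_nonneg_right (by positivity))) hz)
  rcases lt_or_gt_of_ne hz with hz | hz
  · have h1 := hup ((starRingEnd ℂ) z) (by simpa using hz)
    rw [stieltjes_conj, stieltjes_conj] at h1
    exact (starRingEnd ℂ).injective h1
  · exact hup z hz

lemma integrable_one_add_abs_inv (μ : Measure ℝ) [IsFiniteMeasure μ] :
    Integrable (fun t : ℝ => (1 + |t|)⁻¹) μ := by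
  have hc : Continuous fun t : ℝ => (1 + |t|)⁻¹ :=
    Continuous.inv₀ (by fun_prop) fun t => by positivity
  refine (integrable_const (1 : ℝ)).mono' hc.aestronglyMeasurable (ae_of_all _ fun t => ?_)
  rw [Real.norm_of_nonneg (by positivity)]
  exact inv_le_one_of_one_le₀ (le_add_of_nonneg_right (abs_nonneg t))

section

variable {n : ℕ} {M : Matrix (Fin n) (Fin n) ℝ} (hM : M.IsHermitian)

lemma isProbabilityMeasure_esd (hn : 0 < n) : IsProbabilityMeasure (esd hM) := by
  constructor
  have : (n : ℝ≥0∞) ≠ 0 := by exact_mod_cast hn.ne'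
  simp [esd, ENNReal.inv_mul_cancel this (ENNReal.natCast_ne_top n)]

lemma stieltjes_esd {z : ℂ} (hz : z.im ≠ 0) : stieltjes (esd hM) z = ntr z 1 M := by
  rw [stieltjes, esd, integral_smul_measure, integral_finsetSum_measure, ntr, Matrix.mul_one,
    trace_res hM hz]
  · simp [integral_dirac]
  · intro i _
    exact integrable_dirac (by simp)

end

end

noncomputable section

/-! ### From the asymptotic hypotheses to the quantitative model. -/

/-- Choosing a counterexample at every n that has one gives a single sequence testing all cases.
This makes the variance hypothesis, stated per sequence of matrices, uniform over matrices. -/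
lemma eventually_forall_of_forall_seq {D : ℕ → Type*} {C Q : ∀ n, D n → Prop}
    (hC : ∀ n, ∃ d, C n d) (h : ∀ d : ∀ n, D n, (∀ n, C n (d n)) → ∀ᶠ n in atTop, Q n (d n)) :
    ∀ᶠ n in atTop, ∀ d, C n d → Q n d := by
  have : ∀ n, ∃ d, C n d ∧ (Q n d → ∀ d, C n d → Q n d) := fun n => by
    by_cases hn : ∀ d, C n d → Q n d
    · obtain ⟨d, hd⟩ := hC n
      exact ⟨d, hd, fun _ => hn⟩
    · push Not at hn
      obtain ⟨d, hd, hd'⟩ := hn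
      exact ⟨d, hd, fun h => absurd h hd'⟩
  choose d hd hd' using this
  exact (h d hd).mono hd'

lemma opNorm_smul {n : ℕ} (c : ℝ) (D : Matrix (Fin n) (Fin n) ℝ) :
    opNorm (c • D) = |c| * opNorm D := by
  rw [opNorm, map_smul, norm_smul, Real.norm_eq_abs, opNorm]

lemma opNorm_one {n : ℕ} (hn : 1 ≤ n) : opNorm (1 : Matrix (Fin n) (Fin n) ℝ) = 1 := by
  have : Nonempty (Fin n) := ⟨⟨0, hn⟩⟩
  rw [opNorm, map_one, norm_one]

lemma bilin_smul {n : ℕ} (c : ℝ) (D : Matrix (Fin n) (Fin n) ℝ) (u v : EuclideanSpace ℝ (Fin n)) :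
    bilin (c • D) u v = c * bilin D u v := by
  rw [bilin, map_smul, _root_.smul_apply, real_inner_smul_left, bilin]

/-- The variance bound extends from the unit sphere to the unit ball. -/
lemma variance_bilin_le_of_opNorm_le_one {n : ℕ} {Ω : Type*} [MeasurableSpace Ω] {P : Measure Ω}
    {u v : Ω → EuclideanSpace ℝ (Fin n)} {ε : ℝ} (hε : 0 ≤ ε)
    (h : ∀ D : Matrix (Fin n) (Fin n) ℝ, opNorm D = 1 →
      variance (fun ω => bilin D (u ω) (v ω)) P ≤ ε)
    {D : Matrix (Fin n) (Fin n) ℝ} (hD : opNorm D ≤ 1) :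
    variance (fun ω => bilin D (u ω) (v ω)) P ≤ ε := by
  have hD0 : 0 ≤ opNorm D := norm_nonneg _
  rcases hD0.eq_or_lt with h0 | h0
  · have hz : Matrix.toEuclideanCLM (𝕜 := ℝ) D = 0 := norm_eq_zero.1 h0.symm
    have : (fun ω => bilin D (u ω) (v ω)) = 0 := by
      ext ω
      simp [bilin, hz]
    rw [this, variance_zero]
    exact hε
  · have h1 := h ((opNorm D)⁻¹ • D) (by
      rw [opNorm_smul, abs_of_nonneg (inv_nonneg.2 hD0), inv_mul_cancel₀ h0.ne'])
    have e : (fun ω => bilin D (u ω) (v ω)) =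
        fun ω => opNorm D * bilin ((opNorm D)⁻¹ • D) (u ω) (v ω) := by
      ext ω
      rw [bilin_smul, mul_inv_cancel_left₀ h0.ne']
    rw [e, variance_const_mul]
    calc _ ≤ 1 ^ 2 * ε := by
          gcongr
          exact variance_nonneg _ _
      _ = ε := by ring

lemma sqrt_mul_le_of_le_rpow {n : ℕ} (hn : 0 < n) {a κ : ℝ}
    (h : a ≤ κ * (n : ℝ) ^ (-(1 / 2) : ℝ)) : Real.sqrt n * a ≤ κ := by
  have hs : 0 < Real.sqrt n := Real.sqrt_pos.2 (by exact_mod_cast hn)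
  rw [Real.rpow_neg (Nat.cast_nonneg n), ← Real.sqrt_eq_rpow] at h
  calc _ ≤ Real.sqrt n * (κ * (Real.sqrt n)⁻¹) := by gcongr
    _ = κ := by field_simp

/-- Convergence in probability of the Stieltjes transforms from the error in the self-consistent
equation. -/
lemma tendsto_measure_norm_stieltjes_sub {Ω : ℕ → Type*} [∀ n, MeasurableSpace (Ω n)]
    {P : ∀ n, Measure (Ω n)} [∀ n, IsProbabilityMeasure (P n)] {m : ℕ → ℕ} {p : ℕ → ℝ} {c₁ B : ℝ}
    {ξ : ∀ n, Fin (m n) → Ω n → ℝ} {x y : ∀ n, Fin (m n) → Ω n → EuclideanSpace ℝ (Fin n)}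
    (hB : 1 ≤ B) (hc₁ : 0 ≤ c₁) (hcB : c₁ + 1 ≤ B)
    (hp : Tendsto (fun n => (m n : ℝ) / (n : ℝ) * p n) atTop (𝓝 c₁))
    (h : ∀ ε : ℝ, 0 < ε →
      ∀ᶠ n in atTop, RankTwoEnsemble (P n) (ξ n) (x n) (y n) (p n) B ε ε ε)
    {z : ℂ} (hz : 64 * B ^ 3 ≤ z.im) {w : ℂ} (hw : ‖w‖ ≤ 1 / 64) (hw0 : selfEq c₁ z w = 0)
    {ε : ℝ} (hε : 0 < ε) :
    Tendsto (fun n => P n {ω | ε ≤ ‖stieltjes (esd (adjacencyMatrix_isHermitian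
      (fun α => ξ n α ω) (fun α => x n α ω) (fun α => y n α ω))) z - w‖}) atTop (𝓝 0) := by
  have hB3 : B ≤ B ^ 3 := le_self_pow₀ hB three_ne_zero
  have hzi : 0 < z.im := by linarith
  have hzn : c₁ + 1 ≤ ‖z‖ := by
    have := (le_abs_self z.im).trans (Complex.abs_im_le_norm z)
    linarith
  rw [ENNReal.tendsto_nhds_zero]
  intro δ hδ
  obtain ⟨r, hr0, hr⟩ := ENNReal.lt_iff_exists_real_btwn.1 hδ
  have hr' : 0 < r := by simpa using hr.1
  -- Five error terms, each at most η, are multiplied by 140B³, so the mean error is at most εr;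
  -- Markov's inequality then gives probability at most r.
  have hη : 0 < ε * r / (700 * B ^ 3) := by positivity
  set η := ε * r / (700 * B ^ 3) with hηdef
  have hsq : Tendsto (fun n : ℕ => 1 / Real.sqrt n) atTop (𝓝 0) :=
    (tendsto_const_nhds (x := (1 : ℝ))).div_atTop
      (Real.tendsto_sqrt_atTop.comp tendsto_natCast_atTop_atTop)
  filter_upwards [h η hη, hsq.eventually_le_const hη, Metric.tendsto_nhds.1 hp η hη] with n h1 h2 h3
  have h4 := h1.integralLE_norm_selfEq hz hc₁ (by linarith)
  rw [Real.dist_eq] at h3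
  have h5 : ∫ ω, ‖selfEq c₁ z (ntr z 1 (adj (ξ n) (x n) (y n) ω))‖ ∂(P n) ≤ ε * r := by
    refine h4.2.trans ?_
    calc _ ≤ 140 * B ^ 3 * (η + η + η + η + η) := by gcongr
      _ = ε * r := by rw [hηdef]; field_simp; ring
  have h6 := (mul_meas_ge_le_integral_of_nonneg (ae_of_all _ fun ω => norm_nonneg _) h4.1 ε).trans h5
  refine (measure_mono (t := {ω | ε ≤ ‖selfEq c₁ z (ntr z 1 (adj (ξ n) (x n) (y n) ω))‖})
    fun ω hω => ?_).trans ?_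
  · have hω' : ε ≤ ‖stieltjes (esd (adjacencyMatrix_isHermitian
      (fun α => ξ n α ω) (fun α => x n α ω) (fun α => y n α ω))) z - w‖ := hω
    rw [stieltjes_esd _ hzi.ne'] at hω'
    exact hω'.trans (norm_sub_le_of_selfEq_eq_zero hc₁ hzn (h1.norm_ntr_one_le hz ω) hw hw0)
  · rw [← ofReal_measureReal]
    exact (ENNReal.ofReal_le_ofReal (le_of_mul_le_mul_left h6 hε)).trans hr.2.le

end

theorem theoremt
    {Ω : ℕ → Type*} [∀ n, MeasurableSpace (Ω n)]
    (P : ∀ n, Measure (Ω n)) [∀ n, IsProbabilityMeasure (P n)]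
    (m : ℕ → ℕ) (p : ℕ → ℝ) (c₁ C₀ : ℝ)
    (ξ : ∀ n, Fin (m n) → Ω n → ℝ)
    (x y : ∀ n, Fin (m n) → Ω n → EuclideanSpace ℝ (Fin n))
    (hξ_meas : ∀ n α, Measurable (ξ n α))
    (hx_meas : ∀ n α, Measurable (x n α))
    (hy_meas : ∀ n α, Measurable (y n α))
    -- the `ξ α` and the pairs `(x α, y α)` are all mutually independent
    (hξ_indep : ∀ n, iIndepFun (ξ n) (P n))
    (hxy_indep : ∀ n, iIndepFun (fun α ω => (x n α ω, y n α ω)) (P n))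
    (hξxy_indep : ∀ n, IndepFun (fun ω α => ξ n α ω)
      (fun ω α => (x n α ω, y n α ω)) (P n))
    -- Bernoulli variables
    (hξ_values : ∀ n α, ∀ᵐ ω ∂(P n), ξ n α ω = 0 ∨ ξ n α ω = 1)
    (hξ_prob : ∀ n α, (P n).real {ω | ξ n α ω = 1} = p n)
    -- the number of terms
    (hc₁ : 0 < c₁)
    (hp : Tendsto (fun n => (m n : ℝ) / (n : ℝ) * p n) atTop (𝓝 c₁))
    -- bounded vectors with concentrated bilinear forms
    (hC₀ : 0 < C₀)
    (hx_bdd : ∀ n α, ∀ᵐ ω ∂(P n), ‖x n α ω‖ ^ 2 ≤ C₀)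
    (hy_bdd : ∀ n α, ∀ᵐ ω ∂(P n), ‖y n α ω‖ ^ 2 ≤ C₀)
    (h_var : ∀ D : ∀ n, Matrix (Fin n) (Fin n) ℝ, (∀ n, 1 ≤ n → opNorm (D n) = 1) →
      ∀ ε : ℝ, 0 < ε → ∀ᶠ n in atTop, ∀ α,
        ∀ u ∈ ({x n α, y n α} : Set (Ω n → EuclideanSpace ℝ (Fin n))),
        ∀ v ∈ ({x n α, y n α} : Set (Ω n → EuclideanSpace ℝ (Fin n))),
          variance (fun ω => bilin (D n) (u ω) (v ω)) (P n) ≤ ε)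
    -- second moment matrices
    (h_op : ∃ C : ℝ, ∀ᶠ n : ℕ in atTop, ∀ α,
      opNorm (momentMatrix (P n) (x n α) (x n α)) ≤ C / n ∧
      opNorm (momentMatrix (P n) (y n α) (y n α)) ≤ C / n ∧
      opNorm (momentMatrix (P n) (x n α) (y n α)) ≤ C / n)
    (h_trace : ∀ ε : ℝ, 0 < ε → ∀ᶠ n in atTop, ∀ α,
      |(momentMatrix (P n) (x n α) (x n α)).trace - 1| ≤ ε ∧
      |(momentMatrix (P n) (y n α) (y n α)).trace - 1| ≤ ε)
    -- factorization on average
    (h_factor : ∀ n, ∀ K₁ K₂ : Matrix (Fin n) (Fin n) ℝ,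
      (1 / (m n : ℝ)) * ∑ α, (momentMatrix (P n) (x n α) (x n α) * K₁).trace *
          (momentMatrix (P n) (y n α) (y n α) * K₂).trace =
        (1 / (n : ℝ) * K₁.trace) * (1 / (n : ℝ) * K₂.trace))
    -- small averaged cross moments
    (h_cross : (fun n => hsNorm (Matrix.of fun i j =>
        (1 / (m n : ℝ)) * ∑ α, |momentMatrix (P n) (x n α) (y n α) i j|))
      =o[atTop] fun n : ℕ => (n : ℝ) ^ (-(1 / 2) : ℝ)) :
    ∃ μ : Measure ℝ, IsProbabilityMeasure μ ∧
      ConvergesInProbability P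
        (fun n ω => esd (adjacencyMatrix_isHermitian (fun α => ξ n α ω)
          (fun α => x n α ω) (fun α => y n α ω))) μ ∧
      SolvesCubic c₁ (stieltjes μ) ∧
      ∀ ν : Measure ℝ, Integrable (fun t : ℝ => (1 + |t|)⁻¹) ν →
        SolvesCubic c₁ (stieltjes ν) →
        ∀ z : ℂ, z.im ≠ 0 → stieltjes ν z = stieltjes μ z := by
  obtain ⟨C, hC⟩ := h_op
  obtain ⟨B, hB1, hBc, hBC₀, hBC⟩ : ∃ B : ℝ, 1 ≤ B ∧ c₁ + 1 ≤ B ∧ C₀ ≤ B ∧ C ≤ B :=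
    ⟨max (max 1 (c₁ + 1)) (max C₀ C), by simp, by simp, by simp, by simp⟩
  have hB3 : B ≤ B ^ 3 := le_self_pow₀ hB1 three_ne_zero
  have hvar : ∀ ε : ℝ, 0 < ε → ∀ᶠ n in atTop, ∀ D : Matrix (Fin n) (Fin n) ℝ,
      (1 ≤ n → opNorm D = 1) → ∀ α,
        ∀ u ∈ ({x n α, y n α} : Set (Ω n → EuclideanSpace ℝ (Fin n))),
        ∀ v ∈ ({x n α, y n α} : Set (Ω n → EuclideanSpace ℝ (Fin n))),
          variance (fun ω => bilin D (u ω) (v ω)) (P n) ≤ ε := fun ε hε =>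
    eventually_forall_of_forall_seq (fun n => ⟨1, opNorm_one⟩) fun D hD => h_var D hD ε hε
  have hens : ∀ ε : ℝ, 0 < ε →
      ∀ᶠ n in atTop, RankTwoEnsemble (P n) (ξ n) (x n) (y n) (p n) B ε ε ε := by
    intro ε hε
    filter_upwards [eventually_ge_atTop 1, hp.eventually_le_const (by linarith : c₁ < B),
      hvar (ε ^ 2) (by positivity), hC, h_trace ε hε, h_cross.def hε] with n hn1 hpn hv hop htr hcr
    have hdiv : C / (n : ℝ) ≤ B / n := by gcongr
    have hvar1 : ∀ α, ∀ u ∈ ({x n α, y n α} : Set (Ω n → EuclideanSpace ℝ (Fin n))),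
        ∀ v ∈ ({x n α, y n α} : Set (Ω n → EuclideanSpace ℝ (Fin n))),
        ∀ D : Matrix (Fin n) (Fin n) ℝ, opNorm D ≤ 1 →
          variance (fun ω => bilin D (u ω) (v ω)) (P n) ≤ ε ^ 2 := fun α u hu v hv' D hD =>
      variance_bilin_le_of_opNorm_le_one (by positivity)
        (fun D hD => hv D (fun _ => hD) α u hu v hv') hD
    exact
      { n_pos := hn1
        -- If m were 0, the factorization at K₁ = K₂ = 1 would read 0 = 1.
        m_pos := by
          have hn0 : (n : ℝ) ≠ 0 := by positivity
          have hf := h_factor n 1 1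
          simp only [Matrix.trace_one, Fintype.card_fin, one_div_mul_cancel hn0] at hf
          refine Nat.pos_of_ne_zero fun hm => ?_
          rw [show (m n : ℝ) = 0 by exact_mod_cast hm] at hf
          norm_num at hf
        one_le_B := hB1
        θ_pos := hε
        mp_le := hpn
        ξ_meas := hξ_meas n
        x_meas := hx_meas n
        y_meas := hy_meas n
        ξ_indep := hξ_indep n
        xy_indep := hxy_indep n
        ξ_xy_indep := hξxy_indep n
        ξ_values := hξ_values n
        ξ_prob := hξ_prob n
        x_bdd := fun α => (hx_bdd n α).mono fun _ h => h.trans hBC₀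
        y_bdd := fun α => (hy_bdd n α).mono fun _ h => h.trans hBC₀
        var_xx := fun D hD α => hvar1 α _ (by simp) _ (by simp) D hD
        var_yy := fun D hD α => hvar1 α _ (by simp) _ (by simp) D hD
        var_xy := fun D hD α => hvar1 α _ (by simp) _ (by simp) D hD
        op_xx := fun α => (hop α).1.trans hdiv
        op_yy := fun α => (hop α).2.1.trans hdiv
        op_xy := fun α => (hop α).2.2.trans hdiv
        trace_x := fun α => (htr α).1
        trace_y := fun α => (htr α).2
        factor := h_factor n
        cross := by
          refine sqrt_mul_le_of_le_rpow hn1 ((le_abs_self _).trans (hcr.trans_eq ?_))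
          rw [Real.norm_of_nonneg (by positivity)] }
  have hroot : ∀ z : ℂ, ∃ w : ℂ, 64 * B ^ 3 ≤ z.im → ‖w‖ ≤ 1 / 64 ∧ selfEq c₁ z w = 0 := by
    intro z
    by_cases hz : 64 * B ^ 3 ≤ z.im
    · have := (le_abs_self z.im).trans (Complex.abs_im_le_norm z)
      obtain ⟨w, hw⟩ := exists_selfEq_eq_zero hc₁.le (z := z) (by linarith)
      exact ⟨w, fun _ => hw⟩
    · exact ⟨0, fun h => absurd h hz⟩
  choose w hw using hroot
  have hK : (0 : ℝ) < 64 * B ^ 3 := by positivity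
  obtain ⟨μ, hμ, hμw⟩ := exists_convergesInProbability P (n₀ := 1) (K := 64 * B ^ 3) (w := w)
    (fun n hn ω => isProbabilityMeasure_esd (adjacencyMatrix_isHermitian (fun α => ξ n α ω)
      (fun α => x n α ω) (fun α => y n α ω)) hn) hK
    (fun z hz ε hε => tendsto_measure_norm_stieltjes_sub hB1 hc₁.le hBc hp hens hz (hw z hz).1
      (hw z hz).2 hε) (by
    intro ε hε
    -- The point has imaginary part at least b, so the bound c₁(c₁ + 1)/‖z‖ falls below ε.
    obtain ⟨b, hb⟩ := exists_nat_gt (c₁ * (c₁ + 1) / ε)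
    have hz := le_im_ratPoint (64 * B ^ 3) 0 (b : ℚ)
    have him : (ratPoint (64 * B ^ 3) 0 (b : ℚ)).im = 64 * B ^ 3 + b := by simp [ratPoint]
    have hn := (le_abs_self _).trans (Complex.abs_im_le_norm (ratPoint (64 * B ^ 3) 0 (b : ℚ)))
    refine ⟨b, (norm_one_add_mul_le_of_selfEq_eq_zero hc₁.le (by linarith) (hw _ hz).1
      (hw _ hz).2).trans_lt ?_⟩
    rw [div_lt_iff₀ (by linarith)]
    rw [div_lt_iff₀ hε] at hb
    have hbn : (b : ℝ) ≤ ‖ratPoint (64 * B ^ 3) 0 (b : ℚ)‖ := by linarith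
    nlinarith)
  have hint := integrable_one_add_abs_inv (μ : Measure ℝ)
  have hcubic : SolvesCubic c₁ (stieltjes μ) := by
    refine solvesCubic_stieltjes hint hK fun k z hz => ?_
    -- The points accumulating at 64B³i have rational offsets, so they are among those where the
    -- transform of μ is known to equal w.
    have e : z = ratPoint (64 * B ^ 3) 0 (1 / ((k : ℚ) + 1)) := by
      have hk : (0 : ℝ) ≤ 1 / ((k : ℝ) + 1) := by positivity
      rw [hz, ratPoint]
      push_cast
      rw [abs_of_nonneg hk]
    have hz' := le_im_ratPoint (64 * B ^ 3) 0 (1 / ((k : ℚ) + 1))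
    rw [e, hμw]
    exact (selfEq_eq_zero_iff (hw _ hz').1).1 (hw _ hz').2
  exact ⟨μ, inferInstance, hμ, hcubic, fun ν hν hνc z hz =>
    stieltjes_eq_of_solvesCubic hc₁.le hint hν hcubic hνc hz⟩
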